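/- **Theorem.** Let $d\ge 0$. For each $J\in\mathbb N$ let $\{(X^{(0)}_{J,i},\dots,X^{(d)}_{J,i}),\ i\ge 0\}$ be a stationary, jointly Gaussian, real vector-valued process whose components are centred with unit variance. Assume that for all $j,j'\in\{0,\dots,d\}$ the pair $(X^{(j)}_{J,\cdot},X^{(j')}_{J,\cdot})$ has a (possibly complex-valued, integrable) cross-spectral density $f_J^{(j,j')}$ on $(-\pi,\pi)$, i.e. $$\rho_J^{(j,j')}(k):=\mathbb E\big[X^{(j)}_{J,i}X^{(j')}_{J,i+k}\big]=\int_{-\pi}^{\pi}e^{\mathrm i k\lambda}f_J^{(j,j')}(\lambda)\,d\lambda\qquad(k\in\mathbb Z).$$ Assume that there are a non-increasing sequence $(u_J)$ tending to $0$ and $2\pi$-periodic functions $g_\infty^{(j,j')}:\mathbb R\to\mathbb C$, bounded on $(-\pi,\pi)$ and continuous at the origin, such that for all $J$, $j$, $j'$ $$\sup_{\lambda\in(-\pi,\pi)}\big|f_J^{(j,j')}(\lambda)-g_\infty^{(j,j')}(\lambda)\big|\le u_J .$$ Let $X$ be a standard Gaussian variable, $H_\ell$ the $\ell$-th (probabilists')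 Hermite polynomial, and let $h:\mathbb R\to\mathbb R$ be a measurable function that is either bounded or a finite linear combination of Hermite polynomials. Put $c_\ell=\mathbb E[h(X)H_\ell(X)]$ and assume that $h$ has Hermite rank $\tau\ge1$, i.e. $\tau$ is the smallest $\ell\ge 0$ with $c_\ell\ne0$. Let $\beta_0,\dots,\beta_d\in\mathbb R$, $\mathcal H(x_0,\dots,x_d)=\sum_{j=0}^d\beta_jh(x_j)$, and let $(n_J)$ be a sequence of non-negative integers with $n_J\to\infty$. Then, as $J\to\infty$, $$\frac1{\sqrt{n_J}}\sum_{i=1}^{n_J}\mathcal H\big(X^{(0)}_{J,i},\dots,X^{(d)}_{J,i}\big)\xrightarrow{\ d\ }\mathcal N(0,\tilde\sigma^2),$$ where $\tilde\sigma^2$ exists as the limit, and equals the convergent series, $$\tilde\sigma^2=\lim_{J\to\infty}\mathrm{Var}\Big(\frac1{\sqrt{n_J}}\sum_{i=1}^{n_J}\mathcal H\big(X^{(0)}_{J,i},\dots,X^{(d)}_{J,i}\big)\Big)=2\pi\sum_{\ell\ge\tau}\frac{c_\ell^2}{\ell!}\sum_{0\le j,j'\le d}\beta_j\beta_{j'}\,\big(g_\infty^{(j,j')}\big)^{\star\ell}(0).$$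 Here $g^{\star1}=g$ and $g^{\star(\ell+1)}(\lambda)=\int_{-\pi}^{\pi}g^{\star\ell}(\lambda-\mu)g(\mu)\,d\mu$. If $\tilde\sigma^2=0$, $\mathcal N(0,0)$ is the point mass at $0$. -/

import Mathlib

open MeasureTheory ProbabilityTheory Filter Topology

/-- The `l`-th (probabilists') Hermite polynomial, as a function on the real line:
`H_0 = 1`, `H_1 = x`, `H_2 = x ^ 2 - 1`, ... -/
noncomputable def hermiteFun (l : ℕ) (x : ℝ) : ℝ :=
  Polynomial.aeval x (Polynomial.hermite l)

/-- The `l`-th Hermite coefficient `c_l = E[h(X) H_l(X)]`, where `X` is standard Gaussian. -/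
noncomputable def hermiteCoeff (h : ℝ → ℝ) (l : ℕ) : ℝ :=
  ∫ x, h x * hermiteFun l x ∂(gaussianReal 0 1)

/-- `h` has Hermite rank `τ`: `τ` is the smallest `l ≥ 0` with `c_l ≠ 0`.
In particular a function of Hermite rank `τ ≥ 1` satisfies `E[h(X)] = c_0 = 0`. -/
def HasHermiteRank (h : ℝ → ℝ) (τ : ℕ) : Prop :=
  IsLeast {l : ℕ | hermiteCoeff h l ≠ 0} τ

/-- `h` is a finite linear combination of Hermite polynomials. -/
def IsHermiteCombination (h : ℝ → ℝ) : Prop :=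
  ∃ (N : ℕ) (a : ℕ → ℝ), ∀ x, h x = ∑ l ∈ Finset.range N, a l * hermiteFun l x

/-- A real-valued vector process `X j i` (component `j`, time `i ≥ 0`) is a standard stationary
Gaussian process: the components are jointly Gaussian, each variable is centred with unit variance,
and the law of the whole vector process is invariant under time shifts. -/
structure IsStandardStationaryGaussian {Ω ι : Type*} [MeasurableSpace Ω]
    (X : ι → ℕ → Ω → ℝ) (P : Measure Ω) : Prop where
  gaussian : IsGaussianProcess (fun p : ι × ℕ => X p.1 p.2) P
  mean_zero : ∀ j i, ∫ ω, X j i ω ∂P = 0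
  variance_one : ∀ j i, variance (X j i) P = 1
  stationary : ∀ m : ℕ,
    IdentDistrib (fun ω j i => X j (i + m) ω) (fun ω j i => X j i ω) P P

/-- Cross-correlation function of two jointly stationary centred processes indexed by `i ≥ 0`:
`ρ(k) = E[A_i B_{i+k}]` for every integer lag `k`. It is written with the smallest
admissible `i`, so it is `E[A_0 B_k]` for `k ≥ 0` and `E[A_{-k} B_0]` for `k ≤ 0`. -/
noncomputable def crossCorr {Ω : Type*} [MeasurableSpace Ω]
    (A B : ℕ → Ω → ℝ) (P : Measure Ω) (k : ℤ) : ℝ :=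
  ∫ ω, A (-k).toNat ω * B k.toNat ω ∂P

/-- `f` is a cross-spectral density of the jointly stationary processes `A`, `B`: it is integrable
on `(-π, π)` and `ρ(k) = ∫_{-π}^{π} e^{i k t} f(t) dt` for every integer `k`. -/
def HasCrossSpectralDensity {Ω : Type*} [MeasurableSpace Ω]
    (A B : ℕ → Ω → ℝ) (P : Measure Ω) (f : ℝ → ℂ) : Prop :=
  IntervalIntegrable f volume (-Real.pi) Real.pi ∧
  ∀ k : ℤ, (crossCorr A B P k : ℂ) =
    ∫ t in (-Real.pi)..Real.pi, Complex.exp (Complex.I * (k : ℂ) * (t : ℂ)) * f t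

/-- The `l`-fold self-convolution `g^{⋆ l}` over the period `(-π, π)`: `g^{⋆ 1} = g` and
`g^{⋆ (l+1)}(t) = ∫_{-π}^{π} g^{⋆ l}(t - s) g(s) ds`. (The value for `l = 0` is a dummy.) -/
noncomputable def selfConv (g : ℝ → ℂ) : ℕ → ℝ → ℂ
  | 0 => 0
  | 1 => g
  | (l + 2) => fun t => ∫ s in (-Real.pi)..Real.pi, selfConv g (l + 1) (t - s) * g s

/-- The function `H(x) = ∑_j β_j h(x_j)` on `ℝ^{d+1}`. -/
noncomputable def weightedSum {d : ℕ} (β : Fin (d + 1) → ℝ) (h : ℝ → ℝ)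
    (x : Fin (d + 1) → ℝ) : ℝ :=
  ∑ j, β j * h (x j)

/-- The normalised sum `n^{-1/2} ∑_{i=1}^n H(X_i)` of a vector process `X`. -/
noncomputable def normalizedSum {Ω : Type*} {d : ℕ} (H : (Fin (d + 1) → ℝ) → ℝ)
    (X : Fin (d + 1) → ℕ → Ω → ℝ) (n : ℕ) (ω : Ω) : ℝ :=
  (Real.sqrt n)⁻¹ * ∑ i ∈ Finset.Icc 1 n, H (fun j => X j i ω)

/-! Everything is computed under the law of the finite Gaussian vector of all variables in the
window; write `F` for the normalised sum, `C` for the covariance matrix and `ρ` for correlations.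
Two things are needed: the limit of `E[F²]`, and asymptotic normality.

Variance. Hermite polynomials form an orthogonal basis of `L²` of the standard Gaussian, and
`E[H_l(A) H_m(B)]` is `l! ρ^l` if `l = m` and `0` otherwise, for standard jointly Gaussian `A`, `B`.
Hence `E[F²]` is the series over `l` of `c_l²/l!` times averages `n⁻¹ ∑_{i,k} ρ(k-i)^l`
(`hasSum_integral_linearStatistic_sq`). For fixed `l ≥ 1` these averages converge to `2π g^{⋆l}(0)`
(`tendsto_lagAverage_trigCoeff_pow`). For `l = 1` they are Fejér means of the spectral density at
`0`, where `g` is continuous. For `l ≥ 2` Parseval makes the powers of the Fourier coefficients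
summable, with sum `2π g^{⋆l}(0)`, and turns uniform closeness of `f_J` and `g` into `ℓ²` closeness
of coefficients. The averages are bounded uniformly in `l ≥ 1` and `n`, so dominated convergence
sums over `l`.

Normality. This is Stein's method combined with a Poincaré inequality. If `h = x q - q'` with `q`
smooth and compactly supported, Gaussian integration by parts gives `E[F G(F)] = E[Y G'(F)]` with `Y
= ∑_{a,b} w_a w_b C_{ab} q(x_a) h'(x_b)`. Then `E[Y] = E[F²]`, and the Poincaré inequality gives
`Var Y = O(1/n)`, because bounded spectral densities bound the operator norm of `C` independently of
`n`. So the characteristic function of `F` almost solves the Gaussian equation `φ'(s) = -s E[F²]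
φ(s)` (`IsSteinRep.norm_charFun_sub_le`).

General `h`. Since `H_{l+1} = x H_l - H_l'`, the functions `x q - q'` are dense among centred
functions in `L²`. The uniform bound on the averages also gives `E[F²] ≤ K E[h²]` with `K`
independent of `n`, so the approximation error is small uniformly in `J`
(`tendsto_charFun_linearStatistic`). -/

/-! ### Integration by parts and Poincaré inequality from rotation invariance. -/

section GaussianCalculus

variable {E : Type*} [NormedAddCommGroup E] [NormedSpace ℝ E]

lemma norm_rotation_fst_le (θ : ℝ) (p : E × E) :
    ‖Real.cos θ • p.1 + Real.sin θ • p.2‖ ≤ 2 * ‖p‖ := by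
  have h1 : ‖Real.cos θ • p.1‖ ≤ 1 * ‖p‖ := by
    rw [norm_smul]; gcongr
    · exact Real.abs_cos_le_one θ
    · exact norm_fst_le p
  have h2 : ‖Real.sin θ • p.2‖ ≤ 1 * ‖p‖ := by
    rw [norm_smul]; gcongr
    · exact Real.abs_sin_le_one θ
    · exact norm_snd_le p
  linarith [norm_add_le (Real.cos θ • p.1) (Real.sin θ • p.2)]

lemma norm_rotation_snd_le (θ : ℝ) (p : E × E) :
    ‖-Real.sin θ • p.1 + Real.cos θ • p.2‖ ≤ 2 * ‖p‖ := by
  have h1 : ‖-Real.sin θ • p.1‖ ≤ 1 * ‖p‖ := by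
    rw [norm_smul]; gcongr
    · rw [norm_neg]; exact Real.abs_sin_le_one θ
    · exact norm_fst_le p
  have h2 : ‖Real.cos θ • p.2‖ ≤ 1 * ‖p‖ := by
    rw [norm_smul]; gcongr
    · exact Real.abs_cos_le_one θ
    · exact norm_snd_le p
  linarith [norm_add_le (-Real.sin θ • p.1) (Real.cos θ • p.2)]

lemma hasDerivAt_rotation_fst (θ : ℝ) (p : E × E) :
    HasDerivAt (fun θ : ℝ => Real.cos θ • p.1 + Real.sin θ • p.2)
      (-Real.sin θ • p.1 + Real.cos θ • p.2) θ :=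
  ((Real.hasDerivAt_cos θ).smul_const p.1).add ((Real.hasDerivAt_sin θ).smul_const p.2)

lemma hasDerivAt_rotation_snd (θ : ℝ) (p : E × E) :
    HasDerivAt (fun θ : ℝ => -Real.sin θ • p.1 + Real.cos θ • p.2)
      (-(Real.cos θ • p.1 + Real.sin θ • p.2)) θ := by
  refine (((Real.hasDerivAt_sin θ).neg.smul_const p.1).add
    ((Real.hasDerivAt_cos θ).smul_const p.2)).congr_deriv ?_
  rw [neg_add, neg_smul, neg_smul]

variable [MeasurableSpace E] [BorelSpace E] [CompleteSpace E] [SecondCountableTopology E]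
  {μ : Measure E} [IsGaussian μ]

lemma integrable_one_add_norm_pow (μ : Measure E) [IsGaussian μ] (k : ℕ) :
    Integrable (fun x => (1 + ‖x‖) ^ k) μ := by
  have h1 : MemLp (fun x : E => ‖x‖) k μ := (IsGaussian.memLp_id μ k (by simp)).norm
  have h2 : MemLp (fun _ : E => (1 : ℝ)) k μ := memLp_const 1
  have h : MemLp (fun x : E => 1 + ‖x‖) k μ := h2.add h1
  have := h.integrable_norm_pow'
  refine this.congr (ae_of_all _ fun x => ?_)
  simp only [Real.norm_eq_abs]
  rw [abs_of_nonneg (by positivity)]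

/-- Two independent copies of a centred Gaussian vector are jointly invariant under rotation. The
second component is the `θ`-derivative of the first, and this is why differentiating or integrating
in `θ` yields both integration by parts and the Poincaré inequality. -/
lemma integral_comp_rotation {F : Type*} [NormedAddCommGroup F] [NormedSpace ℝ F]
    (hμ : ∫ x, x ∂μ = 0) (θ : ℝ) {f : E × E → F} (hf : Continuous f) 
    [SecondCountableTopology F] :
    ∫ p, f (Real.cos θ • p.1 + Real.sin θ • p.2, -Real.sin θ • p.1 + Real.cos θ • p.2) ∂(μ.prod μ)
      = ∫ p, f p ∂(μ.prod μ) := by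
  conv_rhs => rw [← IsGaussian.map_rotation_eq_self (μ := μ) (by simpa using hμ) θ]
  rw [integral_map (ContinuousLinearMap.continuous _).measurable.aemeasurable
    hf.aestronglyMeasurable]
  rfl

/-- Gaussian integration by parts: a consequence of the invariance of `μ.prod μ` under rotations. -/
theorem gaussian_integral_by_parts {F : Type*} [NormedAddCommGroup F] [NormedSpace ℝ F]
    [SecondCountableTopology F] [CompleteSpace F]
    (hμ : ∫ x, x ∂μ = 0) {Φ : E → F} {Φ' : E → E →L[ℝ] F}
    (hΦ : ∀ x, HasFDerivAt Φ (Φ' x) x) (hΦ' : Continuous Φ') {K : ℝ} {k : ℕ}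
    (hb : ∀ x, ‖Φ x‖ ≤ K * (1 + ‖x‖) ^ k) (hb' : ∀ x, ‖Φ' x‖ ≤ K * (1 + ‖x‖) ^ k)
    (L : E →L[ℝ] ℝ) :
    ∫ x, L x • Φ x ∂μ = ∫ p, L p.2 • Φ' p.1 p.2 ∂(μ.prod μ) := by
  have hΦc : Continuous Φ := continuous_iff_continuousAt.2 fun x => (hΦ x).continuousAt
  have hK : 0 ≤ K := by
    have := (norm_nonneg _).trans (hb 0); simpa using this
  set Z : ℝ → E × E → E := fun θ p => Real.cos θ • p.1 + Real.sin θ • p.2 with hZ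
  set Z' : ℝ → E × E → E := fun θ p => -Real.sin θ • p.1 + Real.cos θ • p.2 with hZ'
  set G : ℝ → E × E → F := fun θ p => L (Z' θ p) • Φ (Z θ p) with hG
  set G' : ℝ → E × E → F := fun θ p =>
    L (-(Z θ p)) • Φ (Z θ p) + L (Z' θ p) • Φ' (Z θ p) (Z' θ p) with hG'
  have hZc : ∀ θ, Continuous (Z θ) := fun θ => by fun_prop
  have hZc' : ∀ θ, Continuous (Z' θ) := fun θ => by fun_prop
  have hGc : ∀ θ, Continuous (G θ) := fun θ =>
    (L.continuous.comp (hZc' θ)).smul (hΦc.comp (hZc θ))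
  have hGc' : ∀ θ, Continuous (G' θ) := fun θ => by
    simp only [hG']
    exact ((L.continuous.comp (hZc θ).neg).smul (hΦc.comp (hZc θ))).add
      ((L.continuous.comp (hZc' θ)).smul ((hΦ'.comp (hZc θ)).clm_apply (hZc' θ)))
  have hr : ∀ (p : E × E) (z : E), ‖z‖ ≤ 2 * ‖p‖ → (1 + ‖z‖) ^ k ≤ 2 ^ k * (1 + ‖p‖) ^ k := by
    intro p z hz
    rw [← mul_pow]
    gcongr
    linarith
  have hbound : ∀ θ p, ‖G' θ p‖ ≤ (8 * ‖L‖ * K * 2 ^ k) * (1 + ‖p‖) ^ (k + 2) := by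
    intro θ p
    have h1 := norm_rotation_fst_le θ p
    have h2 := norm_rotation_snd_le θ p
    have a1 : ‖L (-(Z θ p))‖ ≤ ‖L‖ * (2 * (1 + ‖p‖) ^ 2) := by
      refine (L.le_opNorm _).trans ?_
      gcongr
      rw [norm_neg]
      nlinarith [norm_nonneg p]
    have a2 : ‖Φ (Z θ p)‖ ≤ K * (2 ^ k * (1 + ‖p‖) ^ k) :=
      (hb _).trans (by gcongr; exact hr p _ h1)
    have a3 : ‖L (Z' θ p)‖ ≤ ‖L‖ * (2 * (1 + ‖p‖)) := by
      refine (L.le_opNorm _).trans ?_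
      gcongr
      linarith
    have a4 : ‖Φ' (Z θ p) (Z' θ p)‖ ≤ K * (2 ^ k * (1 + ‖p‖) ^ k) * (2 * (1 + ‖p‖)) := by
      refine (ContinuousLinearMap.le_opNorm _ _).trans ?_
      gcongr
      · exact (hb' _).trans (by gcongr; exact hr p _ h1)
      · linarith
    calc ‖G' θ p‖ ≤ ‖L (-(Z θ p))‖ * ‖Φ (Z θ p)‖ + ‖L (Z' θ p)‖ * ‖Φ' (Z θ p) (Z' θ p)‖ := by
          refine (norm_add_le _ _).trans ?_
          rw [norm_smul, norm_smul]
      _ ≤ ‖L‖ * (2 * (1 + ‖p‖) ^ 2) * (K * (2 ^ k * (1 + ‖p‖) ^ k)) +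
          ‖L‖ * (2 * (1 + ‖p‖)) * (K * (2 ^ k * (1 + ‖p‖) ^ k) * (2 * (1 + ‖p‖))) := by
          gcongr
      _ ≤ (8 * ‖L‖ * K * 2 ^ k) * (1 + ‖p‖) ^ (k + 2) := by
          have : 0 ≤ ‖L‖ * K * 2 ^ k * (1 + ‖p‖) ^ (k + 2) := by positivity
          calc _ = 6 * (‖L‖ * K * 2 ^ k * (1 + ‖p‖) ^ (k + 2)) := by ring
            _ ≤ _ := by linarith
  have hint : Integrable (G 0) (μ.prod μ) := by
    refine Integrable.mono' ((integrable_one_add_norm_pow (μ.prod μ) (k + 1)).const_mul (‖L‖ * K))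
      (hGc 0).aestronglyMeasurable (ae_of_all _ fun p => ?_)
    simp only [hG, hZ, hZ', Real.cos_zero, Real.sin_zero, one_smul, zero_smul, add_zero, neg_zero,
      zero_add, norm_smul]
    calc ‖L p.2‖ * ‖Φ p.1‖ ≤ (‖L‖ * (1 + ‖p‖)) * (K * (1 + ‖p‖) ^ k) := by
          gcongr
          · refine (L.le_opNorm _).trans ?_
            gcongr
            linarith [norm_snd_le p]
          · refine (hb _).trans ?_
            gcongr
            exact norm_fst_le p
      _ = _ := by ring
  obtain ⟨hint', hd⟩ := hasDerivAt_integral_of_dominated_loc_of_deriv_le (μ := μ.prod μ)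
    (F := G) (F' := G') (x₀ := (0 : ℝ)) (s := Set.univ)
    (bound := fun p => (8 * ‖L‖ * K * 2 ^ k) * (1 + ‖p‖) ^ (k + 2)) univ_mem
    (Eventually.of_forall fun θ => (hGc θ).aestronglyMeasurable) hint
    (hGc' 0).aestronglyMeasurable (ae_of_all _ fun p θ _ => hbound θ p)
    ((integrable_one_add_norm_pow (μ.prod μ) (k + 2)).const_mul _)
    (ae_of_all _ fun p θ _ => by
      have h1 := (L.hasFDerivAt.comp_hasDerivAt θ (hasDerivAt_rotation_snd θ p))
      have h2 := ((hΦ (Z θ p)).comp_hasDerivAt θ (hasDerivAt_rotation_fst θ p))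
      have h3 := h1.smul h2
      simp only [Function.comp_def] at h3
      rw [add_comm] at h3
      exact h3)
  -- By rotation invariance the expectation of `G θ` does not depend on `θ`, so its derivative at
  -- `0` vanishes; there `G' 0` is `-L x • Φ x + L y • Φ' x y`, which is the formula.
  have hconst : (fun θ => ∫ p, G θ p ∂(μ.prod μ)) = fun _ => ∫ p, L p.2 • Φ p.1 ∂(μ.prod μ) := by
    funext θ
    exact integral_comp_rotation hμ θ (f := fun p : E × E => L p.2 • Φ p.1)
      ((L.continuous.comp continuous_snd).smul (hΦc.comp continuous_fst))
  rw [hconst] at hd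
  have h0 := hd.unique (hasDerivAt_const (0 : ℝ) _)
  have hA : Integrable (fun x => L x • Φ x) μ := by
    refine Integrable.mono' ((integrable_one_add_norm_pow μ (k + 1)).const_mul (‖L‖ * K))
      (L.continuous.smul hΦc).aestronglyMeasurable (ae_of_all _ fun x => ?_)
    rw [norm_smul]
    calc ‖L x‖ * ‖Φ x‖ ≤ (‖L‖ * (1 + ‖x‖)) * (K * (1 + ‖x‖) ^ k) := by
          gcongr
          · refine (L.le_opNorm _).trans ?_
            gcongr
            linarith
          · exact hb _
      _ = _ := by ring
  have hA' : Integrable (fun p : E × E => L p.1 • Φ p.1) (μ.prod μ) := hA.comp_fst μ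
  have hG0 : G' 0 = fun p => -(L p.1 • Φ p.1) + L p.2 • Φ' p.1 p.2 := by
    funext p
    simp [hG', hZ, hZ']
  have hB : Integrable (fun p : E × E => L p.2 • Φ' p.1 p.2) (μ.prod μ) := by
    have := hint'.add hA'
    rw [hG0] at this
    refine this.congr (ae_of_all _ fun p => ?_)
    simp
  have hN : Integrable (fun p : E × E => -(L p.1 • Φ p.1)) (μ.prod μ) := hA'.neg
  rw [hG0, integral_add hN hB, integral_neg, integral_fun_fst (f := fun x => L x • Φ x)] at h0
  simp only [probReal_univ, one_smul] at h0
  rw [neg_add_eq_zero] at h0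
  exact h0

/-- Cauchy–Schwarz, read off from the nonnegativity of the integral of `(w - m)²`, where `m` is the
mean of `w`. -/
lemma sq_intervalIntegral_le {w : ℝ → ℝ} (hw : Continuous w) {b : ℝ} (hb : 0 < b) :
    (∫ θ in (0 : ℝ)..b, w θ) ^ 2 ≤ b * ∫ θ in (0 : ℝ)..b, w θ ^ 2 := by
  set m := (∫ θ in (0 : ℝ)..b, w θ) / b with hm
  have h0 : 0 ≤ ∫ θ in (0 : ℝ)..b, (w θ - m) ^ 2 :=
    intervalIntegral.integral_nonneg hb.le fun θ _ => sq_nonneg _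
  have h1 : ∫ θ in (0 : ℝ)..b, (w θ - m) ^ 2 =
      (∫ θ in (0 : ℝ)..b, w θ ^ 2) - 2 * m * (∫ θ in (0 : ℝ)..b, w θ) + b * m ^ 2 := by
    have : ∀ θ, (w θ - m) ^ 2 = w θ ^ 2 - 2 * m * w θ + m ^ 2 := fun θ => by ring
    simp_rw [this]
    rw [intervalIntegral.integral_add, intervalIntegral.integral_sub,
      intervalIntegral.integral_const_mul]
    · simp
    all_goals exact Continuous.intervalIntegrable (by fun_prop) _ _
  rw [h1] at h0
  have h2 : ∫ θ in (0 : ℝ)..b, w θ = b * m := by rw [hm]; field_simp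
  rw [h2] at h0 ⊢
  nlinarith

/-- A Gaussian Poincaré inequality (with a non-optimal constant). -/
theorem gaussian_poincare (hμ : ∫ x, x ∂μ = 0) {f : E → ℝ} {f' : E → E →L[ℝ] ℝ}
    (hf : ∀ x, HasFDerivAt f (f' x) x) (hf' : Continuous f') {K : ℝ}
    (hb : ∀ x, |f x| ≤ K) (hb' : ∀ x, ‖f' x‖ ≤ K) :
    Var[f; μ] ≤ Real.pi ^ 2 / 8 * ∫ p, (f' p.1 p.2) ^ 2 ∂(μ.prod μ) := by
  have hfc : Continuous f := continuous_iff_continuousAt.2 fun x => (hf x).continuousAt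
  have hpi := Real.pi_pos
  have hK : 0 ≤ K := (abs_nonneg _).trans (hb 0)
  set W : E × E → ℝ → ℝ := fun p θ => f' (Real.cos θ • p.1 + Real.sin θ • p.2)
    (-Real.sin θ • p.1 + Real.cos θ • p.2) with hW
  have hWc2 : Continuous (fun q : (E × E) × ℝ => W q.1 q.2) := by
    have h1 : Continuous fun q : (E × E) × ℝ => Real.cos q.2 • q.1.1 + Real.sin q.2 • q.1.2 := by
      fun_prop
    have h2 : Continuous fun q : (E × E) × ℝ => -Real.sin q.2 • q.1.1 + Real.cos q.2 • q.1.2 := by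
      fun_prop
    exact (hf'.comp h1).clm_apply h2
  have hWc : ∀ p, Continuous (W p) := fun p => by
    have h1 : Continuous fun θ : ℝ => Real.cos θ • p.1 + Real.sin θ • p.2 := by fun_prop
    have h2 : Continuous fun θ : ℝ => -Real.sin θ • p.1 + Real.cos θ • p.2 := by fun_prop
    exact (hf'.comp h1).clm_apply h2
  -- Integrate the derivative of `f` along the quarter circle from `p.1` to `p.2`, then apply
  -- Cauchy–Schwarz on an interval of length `π / 2`.
  have hpt : ∀ p : E × E, (f p.2 - f p.1) ^ 2 ≤
      Real.pi / 2 * ∫ θ in (0 : ℝ)..(Real.pi / 2), W p θ ^ 2 := by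
    intro p
    have h1 : ∫ θ in (0 : ℝ)..(Real.pi / 2), W p θ = f p.2 - f p.1 := by
      rw [intervalIntegral.integral_eq_sub_of_hasDerivAt
        (f := fun θ => f (Real.cos θ • p.1 + Real.sin θ • p.2))
        (fun θ _ => (hf _).comp_hasDerivAt θ (hasDerivAt_rotation_fst θ p))
        ((hWc p).intervalIntegrable _ _)]
      simp
    rw [← h1]
    exact sq_intervalIntegral_le (hWc p) (by positivity)
  have hWb : ∀ p θ, W p θ ^ 2 ≤ (4 * K ^ 2) * (1 + ‖p‖) ^ 2 := by
    intro p θ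
    have : |W p θ| ≤ K * (2 * (1 + ‖p‖)) := by
      have h1 := (f' (Real.cos θ • p.1 + Real.sin θ • p.2)).le_opNorm
        (-Real.sin θ • p.1 + Real.cos θ • p.2)
      rw [Real.norm_eq_abs] at h1
      have h2 : ‖-Real.sin θ • p.1 + Real.cos θ • p.2‖ ≤ 2 * (1 + ‖p‖) :=
        (norm_rotation_snd_le θ p).trans (by linarith)
      exact h1.trans (mul_le_mul (hb' _) h2 (norm_nonneg _) hK)
    calc W p θ ^ 2 = |W p θ| ^ 2 := (sq_abs _).symm
      _ ≤ (K * (2 * (1 + ‖p‖))) ^ 2 := by gcongr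
      _ = _ := by ring
  have hI : Integrable (fun q : (E × E) × ℝ => W q.1 q.2 ^ 2)
      ((μ.prod μ).prod (volume.restrict (Set.Ioc 0 (Real.pi / 2)))) := by
    have hg : Integrable (fun p : E × E => (4 * K ^ 2) * (1 + ‖p‖) ^ 2) (μ.prod μ) :=
      (integrable_one_add_norm_pow (μ.prod μ) 2).const_mul (4 * K ^ 2)
    have hg' := hg.comp_fst (volume.restrict (Set.Ioc 0 (Real.pi / 2)))
    have hm : Continuous fun q : (E × E) × ℝ => W q.1 q.2 ^ 2 := hWc2.pow 2
    have hm' : AEStronglyMeasurable (fun q : (E × E) × ℝ => W q.1 q.2 ^ 2)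
      ((μ.prod μ).prod (volume.restrict (Set.Ioc 0 (Real.pi / 2)))) := hm.aestronglyMeasurable
    have hle : ∀ q : (E × E) × ℝ, ‖W q.1 q.2 ^ 2‖ ≤ (4 * K ^ 2) * (1 + ‖q.1‖) ^ 2 := fun q => by
      rw [Real.norm_of_nonneg (sq_nonneg _)]
      exact hWb _ _
    exact Integrable.mono' hg' hm' (Eventually.of_forall hle)
  have hpi2 : (0 : ℝ) ≤ Real.pi / 2 := by positivity
  -- Every angle contributes the same integral, which yields a second factor `π / 2`. The two copies
  -- of `f` produce `2 * Var[f; μ]`, whence the constant `π² / 8`.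
  have hswap : ∫ p, (∫ θ in (0 : ℝ)..(Real.pi / 2), W p θ ^ 2) ∂(μ.prod μ) =
      Real.pi / 2 * ∫ p, (f' p.1 p.2) ^ 2 ∂(μ.prod μ) := by
    simp_rw [intervalIntegral.integral_of_le hpi2]
    rw [integral_integral_swap hI]
    have : ∀ θ, ∫ p, W p θ ^ 2 ∂(μ.prod μ) = ∫ p, (f' p.1 p.2) ^ 2 ∂(μ.prod μ) := fun θ =>
      integral_comp_rotation hμ θ (f := fun p : E × E => (f' p.1 p.2) ^ 2)
        (((hf'.comp continuous_fst).clm_apply continuous_snd).pow 2)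
    simp_rw [this]
    simp only [integral_const, smul_eq_mul, measureReal_restrict_apply_univ, Real.volume_real_Ioc,
      sub_zero, max_eq_left hpi2]
  have hfI : Integrable f μ := Integrable.of_bound hfc.aestronglyMeasurable K (ae_of_all _ hb)
  have hf2 : Integrable (fun x => f x ^ 2) μ := 
    Integrable.of_bound (hfc.pow 2).aestronglyMeasurable (K ^ 2) (ae_of_all _ fun x => by
      rw [norm_pow]; gcongr; exact hb x)
  have hvar : ∫ p : E × E, (f p.2 - f p.1) ^ 2 ∂(μ.prod μ) = 2 * Var[f; μ] := by
    rw [variance_eq_sub (memLp_two_iff_integrable_sq hfc.aestronglyMeasurable |>.2 hf2)]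
    have : ∀ p : E × E, (f p.2 - f p.1) ^ 2 = f p.2 ^ 2 + f p.1 ^ 2 - 2 * (f p.1 * f p.2) :=
      fun p => by ring
    simp_rw [this]
    rw [integral_sub, integral_add, integral_const_mul, integral_prod_mul,
      integral_fun_snd (f := fun x => f x ^ 2), integral_fun_fst (f := fun x => f x ^ 2)]
    · simp; ring
    · exact hf2.comp_snd μ
    · exact hf2.comp_fst μ
    · exact (hf2.comp_snd μ).add (hf2.comp_fst μ)
    · exact (hfI.mul_prod hfI).const_mul 2
  have hmono : ∫ p : E × E, (f p.2 - f p.1) ^ 2 ∂(μ.prod μ) ≤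
      ∫ p, Real.pi / 2 * (∫ θ in (0 : ℝ)..(Real.pi / 2), W p θ ^ 2) ∂(μ.prod μ) := by
    have hJ : Integrable (fun p => Real.pi / 2 * ∫ θ in (0 : ℝ)..(Real.pi / 2), W p θ ^ 2)
        (μ.prod μ) := by
      simp_rw [intervalIntegral.integral_of_le hpi2]
      exact hI.integral_prod_left.const_mul _
    exact integral_mono_of_nonneg (ae_of_all _ fun p => sq_nonneg _) hJ (ae_of_all _ hpt)
  rw [integral_const_mul, hswap, hvar] at hmono
  nlinarith

end GaussianCalculus

/-! ### Functions of polynomial growth, the class where Gaussian integrability is automatic. -/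

section PolynomialGrowth

/-- `f` grows at most polynomially. -/
def HasPolyGrowth {E F : Type*} [NormedAddCommGroup E] [NormedAddCommGroup F] (f : E → F) : Prop :=
  ∃ (K : ℝ) (k : ℕ), 0 ≤ K ∧ ∀ x, ‖f x‖ ≤ K * (1 + ‖x‖) ^ k

variable {E F : Type*} [NormedAddCommGroup E] [NormedAddCommGroup F]

lemma HasPolyGrowth.of_bound {f : E → F} {K : ℝ} (h : ∀ x, ‖f x‖ ≤ K) : HasPolyGrowth f :=
  ⟨K, 0, (norm_nonneg _).trans (h 0), by simpa using h⟩

lemma HasPolyGrowth.add {f g : E → F} (hf : HasPolyGrowth f) (hg : HasPolyGrowth g) :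
    HasPolyGrowth fun x => f x + g x := by
  obtain ⟨K, k, hK, h⟩ := hf
  obtain ⟨K', k', hK', h'⟩ := hg
  refine ⟨K + K', k + k', by positivity, fun x => (norm_add_le _ _).trans ?_⟩
  have h1 : (1 + ‖x‖) ^ k ≤ (1 + ‖x‖) ^ (k + k') :=
    pow_le_pow_right₀ (by linarith [norm_nonneg x]) (by omega)
  have h2 : (1 + ‖x‖) ^ k' ≤ (1 + ‖x‖) ^ (k + k') :=
    pow_le_pow_right₀ (by linarith [norm_nonneg x]) (by omega)
  rw [add_mul]
  exact add_le_add ((h x).trans (by gcongr)) ((h' x).trans (by gcongr))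

lemma HasPolyGrowth.smul [NormedSpace ℝ F] {f : E → ℝ} {g : E → F} (hf : HasPolyGrowth f)
    (hg : HasPolyGrowth g) : HasPolyGrowth fun x => f x • g x := by
  obtain ⟨K, k, hK, h⟩ := hf
  obtain ⟨K', k', hK', h'⟩ := hg
  refine ⟨K * K', k + k', by positivity, fun x => ?_⟩
  rw [norm_smul]
  calc ‖f x‖ * ‖g x‖ ≤ (K * (1 + ‖x‖) ^ k) * (K' * (1 + ‖x‖) ^ k') := by
        gcongr
        · exact h x
        · exact h' x
    _ = _ := by ring

lemma HasPolyGrowth.mul {f g : E → ℝ} (hf : HasPolyGrowth f) (hg : HasPolyGrowth g) :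
    HasPolyGrowth fun x => f x * g x :=
  hf.smul hg

lemma HasPolyGrowth.const (c : F) : HasPolyGrowth fun _ : E => c :=
  .of_bound (K := ‖c‖) fun _ => le_rfl

lemma HasPolyGrowth.clm [NormedSpace ℝ E] [NormedSpace ℝ F] (A : E →L[ℝ] F) :
    HasPolyGrowth fun x => A x :=
  ⟨‖A‖, 1, norm_nonneg _, fun x => (A.le_opNorm x).trans (by gcongr; simp)⟩

lemma HasPolyGrowth.comp {G : Type*} [NormedAddCommGroup G] {g : F → G} {f : E → F}
    (hg : HasPolyGrowth g) (hf : HasPolyGrowth f) : HasPolyGrowth fun x => g (f x) := by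
  obtain ⟨K, k, hK, h⟩ := hf
  obtain ⟨K', k', hK', h'⟩ := hg
  refine ⟨K' * (1 + K) ^ k', k * k', by positivity, fun x => (h' _).trans ?_⟩
  have h1 : 1 ≤ (1 + ‖x‖) ^ k := one_le_pow₀ (by linarith [norm_nonneg x])
  rw [mul_assoc, pow_mul, ← mul_pow]
  gcongr
  nlinarith [h x]

lemma HasPolyGrowth.sum {ι : Type*} (s : Finset ι) {f : ι → E → F}
    (hf : ∀ i ∈ s, HasPolyGrowth (f i)) : HasPolyGrowth fun x => ∑ i ∈ s, f i x := by
  classical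
  induction s using Finset.induction_on with
  | empty => simpa using HasPolyGrowth.const (E := E) (0 : F)
  | insert a s ha ih =>
    simp_rw [Finset.sum_insert ha]
    exact (hf a (by simp)).add (ih fun i hi => hf i (by simp [hi]))

lemma HasPolyGrowth.integrable [NormedSpace ℝ E] [MeasurableSpace E] [BorelSpace E]
    [CompleteSpace E] [SecondCountableTopology E] {μ : Measure E} [IsGaussian μ] {f : E → F}
    (hf : HasPolyGrowth f) (hm : AEStronglyMeasurable f μ) : Integrable f μ := by
  obtain ⟨K, k, -, h⟩ := hf
  exact Integrable.mono' ((integrable_one_add_norm_pow μ k).const_mul K) hm (ae_of_all _ h)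

lemma HasPolyGrowth.memLp_two [NormedSpace ℝ E] [MeasurableSpace E] [BorelSpace E]
    [CompleteSpace E] [SecondCountableTopology E] {μ : Measure E} [IsGaussian μ] {f : E → ℝ}
    (hf : HasPolyGrowth f) (hm : AEStronglyMeasurable f μ) : MemLp f 2 μ := by
  rw [memLp_two_iff_integrable_sq hm]
  simp_rw [pow_two]
  exact (hf.mul hf).integrable (hm.mul hm)

theorem HasPolyGrowth.integral_by_parts [NormedSpace ℝ E] [MeasurableSpace E] [BorelSpace E]
    [CompleteSpace E] [SecondCountableTopology E] {μ : Measure E} [IsGaussian μ]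
    [NormedSpace ℝ F] [SecondCountableTopology F] [CompleteSpace F]
    (hμ : ∫ x, x ∂μ = 0) {Φ : E → F} {Φ' : E → E →L[ℝ] F}
    (hΦ : ∀ x, HasFDerivAt Φ (Φ' x) x) (hΦ' : Continuous Φ')
    (hb : HasPolyGrowth Φ) (hb' : HasPolyGrowth Φ') (L : E →L[ℝ] ℝ) :
    ∫ x, L x • Φ x ∂μ = ∫ p, L p.2 • Φ' p.1 p.2 ∂(μ.prod μ) := by
  obtain ⟨K, k, hK, h⟩ := hb
  obtain ⟨K', k', hK', h'⟩ := hb'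
  have aux : ∀ x : E, ∀ i j : ℕ, i ≤ j → (1 + ‖x‖) ^ i ≤ (1 + ‖x‖) ^ j := fun x i j hij =>
    pow_le_pow_right₀ (by linarith [norm_nonneg x]) hij
  refine gaussian_integral_by_parts hμ hΦ hΦ' (K := K + K') (k := k + k')
    (fun x => (h x).trans ?_) (fun x => (h' x).trans ?_) L
  · exact mul_le_mul (by linarith) (aux x _ _ (by omega)) (by positivity) (by positivity)
  · exact mul_le_mul (by linarith) (aux x _ _ (by omega)) (by positivity) (by positivity)

end PolynomialGrowth

/-! ### Hermite polynomials of jointly Gaussian variables. -/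

section Hermite

lemma derivative_hermite_succ (n : ℕ) :
    Polynomial.derivative (Polynomial.hermite (n + 1)) = (n + 1 : ℕ) • Polynomial.hermite n := by
  induction n with
  | zero => simp
  | succ n ih =>
    rw [Polynomial.hermite_succ (n + 1), Polynomial.derivative_sub, Polynomial.derivative_mul,
      Polynomial.derivative_X, ih, one_mul, Polynomial.derivative_smul, mul_smul_comm,
      add_sub_assoc, ← smul_sub, ← Polynomial.hermite_succ, succ_nsmul' _ (n + 1)]

lemma derivative_hermite (n : ℕ) :
    Polynomial.derivative (Polynomial.hermite n) = n • Polynomial.hermite (n - 1) := by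
  cases n with
  | zero => simp
  | succ n => exact derivative_hermite_succ n

@[simp]
lemma hermiteFun_zero (x : ℝ) : hermiteFun 0 x = 1 := by simp [hermiteFun]

lemma hermiteFun_succ (n : ℕ) (x : ℝ) :
    hermiteFun (n + 1) x = x * hermiteFun n x - n * hermiteFun (n - 1) x := by
  simp [hermiteFun, Polynomial.hermite_succ, derivative_hermite]

lemma hasDerivAt_hermiteFun (n : ℕ) (x : ℝ) :
    HasDerivAt (hermiteFun n) (n * hermiteFun (n - 1) x) x := by
  have := (Polynomial.hermite n).hasDerivAt_aeval x
  rw [derivative_hermite, map_nsmul, nsmul_eq_mul] at this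
  exact this

lemma contDiff_hermiteFun (n : ℕ) {m : WithTop ℕ∞} : ContDiff ℝ m (hermiteFun n) :=
  (Polynomial.hermite n).contDiff_aeval m

lemma continuous_hermiteFun (n : ℕ) : Continuous (hermiteFun n) :=
  (contDiff_hermiteFun n (m := 0)).continuous

lemma hasPolyGrowth_hermiteFun (n : ℕ) : HasPolyGrowth (hermiteFun n) := by
  have hid : HasPolyGrowth fun x : ℝ => x := HasPolyGrowth.clm (ContinuousLinearMap.id ℝ ℝ)
  induction n using Nat.strong_induction_on with
  | _ n ih =>
    match n with
    | 0 =>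
      have := HasPolyGrowth.const (E := ℝ) (1 : ℝ)
      simpa [funext hermiteFun_zero] using this
    | n + 1 =>
      have h := (hid.mul (ih n (by omega))).add
        ((HasPolyGrowth.const (E := ℝ) (-(n : ℝ))).mul (ih (n - 1) (by omega)))
      convert h using 1
      funext x
      rw [hermiteFun_succ]
      ring

variable {E : Type*} [NormedAddCommGroup E] [NormedSpace ℝ E] [MeasurableSpace E] [BorelSpace E]
  [CompleteSpace E] [SecondCountableTopology E] {μ : Measure E} [IsGaussian μ]

/-- Write `H_{l+1}(A) = A H_l(A) - l H_{l-1}(A)` and integrate the factor `A` by parts.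
Differentiating `H_l(A)` gives `E[A²] l H_{l-1}(A)`, which cancels the subtracted term because
`E[A²] = 1`; differentiating `H_m(B)` leaves the right-hand side. Truncated indices at `0` are
harmless, being multiplied by `l = 0` or `m = 0`. -/
lemma integral_hermiteFun_succ_mul (hμ : ∫ x, x ∂μ = 0) (A B : E →L[ℝ] ℝ)
    (hA : ∫ x, A x * A x ∂μ = 1) (l m : ℕ) :
    ∫ x, hermiteFun (l + 1) (A x) * hermiteFun m (B x) ∂μ =
      (∫ x, A x * B x ∂μ) * m * ∫ x, hermiteFun l (A x) * hermiteFun (m - 1) (B x) ∂μ := by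
  have gA : ∀ n, HasPolyGrowth fun x => hermiteFun n (A x) := fun n =>
    (hasPolyGrowth_hermiteFun n).comp (.clm A)
  have gB : ∀ n, HasPolyGrowth fun x => hermiteFun n (B x) := fun n =>
    (hasPolyGrowth_hermiteFun n).comp (.clm B)
  have cA : ∀ n, Continuous fun x => hermiteFun n (A x) := fun n =>
    (continuous_hermiteFun n).comp A.continuous
  have cB : ∀ n, Continuous fun x => hermiteFun n (B x) := fun n =>
    (continuous_hermiteFun n).comp B.continuous
  have I : ∀ {f : E → ℝ}, HasPolyGrowth f → Continuous f → Integrable f μ := fun h c =>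
    h.integrable c.aestronglyMeasurable
  have iAA : Integrable (fun x => A x * A x) μ :=
    I ((HasPolyGrowth.clm A).mul (.clm A)) (A.continuous.mul A.continuous)
  have iAB : Integrable (fun x => A x * B x) μ :=
    I ((HasPolyGrowth.clm A).mul (.clm B)) (A.continuous.mul B.continuous)
  set Φ' : E → E →L[ℝ] ℝ := fun x =>
    (l * (hermiteFun (l - 1) (A x) * hermiteFun m (B x))) • A +
      (m * (hermiteFun l (A x) * hermiteFun (m - 1) (B x))) • B with hΦ'
  have g1 : HasPolyGrowth fun x => (l : ℝ) * (hermiteFun (l - 1) (A x) * hermiteFun m (B x)) :=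
    (HasPolyGrowth.const (l : ℝ)).mul ((gA (l - 1)).mul (gB m))
  have c1 : Continuous fun x => (l : ℝ) * (hermiteFun (l - 1) (A x) * hermiteFun m (B x)) :=
    continuous_const.mul ((cA (l - 1)).mul (cB m))
  have g2 : HasPolyGrowth fun x => (m : ℝ) * (hermiteFun l (A x) * hermiteFun (m - 1) (B x)) :=
    (HasPolyGrowth.const (m : ℝ)).mul ((gA l).mul (gB (m - 1)))
  have c2 : Continuous fun x => (m : ℝ) * (hermiteFun l (A x) * hermiteFun (m - 1) (B x)) :=
    continuous_const.mul ((cA l).mul (cB (m - 1)))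
  have key := HasPolyGrowth.integral_by_parts (μ := μ) hμ
    (Φ := fun x => hermiteFun l (A x) * hermiteFun m (B x)) (Φ' := Φ') (fun x => by
      have h1 := (hasDerivAt_hermiteFun l (A x)).comp_hasFDerivAt x A.hasFDerivAt
      have h2 := (hasDerivAt_hermiteFun m (B x)).comp_hasFDerivAt x B.hasFDerivAt
      have h3 := h1.mul h2
      refine h3.congr_fderiv ?_
      ext v
      simp [hΦ']
      ring)
    ((c1.smul continuous_const).add (c2.smul continuous_const))
    ((gA l).mul (gB m)) ((g1.smul (.const A)).add (g2.smul (.const B))) A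
  have e1 : ∫ p, A p.2 • Φ' p.1 p.2 ∂(μ.prod μ) =
      (∫ x, (l : ℝ) * (hermiteFun (l - 1) (A x) * hermiteFun m (B x)) ∂μ) +
      (∫ x, (m : ℝ) * (hermiteFun l (A x) * hermiteFun (m - 1) (B x)) ∂μ) *
        ∫ x, A x * B x ∂μ := by
    have : ∀ p : E × E, A p.2 • Φ' p.1 p.2 =
        (l * (hermiteFun (l - 1) (A p.1) * hermiteFun m (B p.1))) * (A p.2 * A p.2) +
        (m * (hermiteFun l (A p.1) * hermiteFun (m - 1) (B p.1))) * (A p.2 * B p.2) := by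
      intro p
      simp [hΦ']
      ring
    simp_rw [this]
    rw [integral_add ((I g1 c1).mul_prod iAA) ((I g2 c2).mul_prod iAB),
      integral_prod_mul (fun x => (l : ℝ) * (hermiteFun (l - 1) (A x) * hermiteFun m (B x)))
        (fun x => A x * A x),
      integral_prod_mul (fun x => (m : ℝ) * (hermiteFun l (A x) * hermiteFun (m - 1) (B x)))
        (fun x => A x * B x), hA, mul_one]
  rw [e1] at key
  have e2 : ∀ x, hermiteFun (l + 1) (A x) * hermiteFun m (B x) =
      A x • (hermiteFun l (A x) * hermiteFun m (B x)) -
        l * (hermiteFun (l - 1) (A x) * hermiteFun m (B x)) := by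
    intro x
    rw [hermiteFun_succ, smul_eq_mul]
    ring
  simp_rw [e2]
  simp only [smul_eq_mul] at key ⊢
  rw [integral_sub (I ((HasPolyGrowth.clm A).mul ((gA l).mul (gB m)))
    (A.continuous.mul ((cA l).mul (cB m)))) (I g1 c1), key, integral_const_mul (m : ℝ)]
  ring

/-- Orthogonality relations for Hermite polynomials of jointly Gaussian variables. -/
theorem integral_hermiteFun_mul (hμ : ∫ x, x ∂μ = 0) (A B : E →L[ℝ] ℝ)
    (hA : ∫ x, A x * A x ∂μ = 1) (hB : ∫ x, B x * B x ∂μ = 1) (l m : ℕ) :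
    ∫ x, hermiteFun l (A x) * hermiteFun m (B x) ∂μ =
      if l = m then (l.factorial : ℝ) * (∫ x, A x * B x ∂μ) ^ l else 0 := by
  induction l generalizing m with
  | zero =>
    cases m with
    | zero => simp
    | succ m =>
      simp_rw [mul_comm (hermiteFun 0 _)]
      rw [integral_hermiteFun_succ_mul hμ B A hB]
      simp
  | succ l ih =>
    rw [integral_hermiteFun_succ_mul hμ A B hA]
    cases m with
    | zero => simp
    | succ m =>
      rw [Nat.add_sub_cancel, ih]
      by_cases h : l = m
      · subst h
        simp [Nat.factorial_succ, pow_succ]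
        ring
      · simp [h]

end Hermite

/-! ### Completeness of the Hermite system and expansion of covariances. -/

section HermiteBasis

lemma integral_id_gaussianReal_zero : ∫ x : ℝ, x ∂(gaussianReal 0 1) = 0 :=
  integral_id_gaussianReal

lemma integral_mul_self_gaussianReal : ∫ x : ℝ, x * x ∂(gaussianReal 0 1) = 1 := by
  have h := variance_fun_id_gaussianReal (μ := 0) (v := 1)
  rw [variance_of_integral_eq_zero aemeasurable_id' integral_id_gaussianReal_zero] at h
  simpa [pow_two] using h

lemma integral_hermiteFun_mul_gaussianReal (l m : ℕ) :
    ∫ x, hermiteFun l x * hermiteFun m x ∂(gaussianReal 0 1) =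
      if l = m then (l.factorial : ℝ) else 0 := by
  have h := integral_hermiteFun_mul (μ := gaussianReal 0 1) integral_id_gaussianReal_zero
    (ContinuousLinearMap.id ℝ ℝ) (ContinuousLinearMap.id ℝ ℝ)
    (by simpa using integral_mul_self_gaussianReal)
    (by simpa using integral_mul_self_gaussianReal) l m
  simpa [integral_mul_self_gaussianReal] using h

lemma HasPolyGrowth.memLp_gaussianReal {f : ℝ → ℝ} (hf : HasPolyGrowth f) (hc : Continuous f) :
    MemLp f 2 (gaussianReal 0 1) :=
  hf.memLp_two hc.aestronglyMeasurable

lemma hasPolyGrowth_id : HasPolyGrowth fun x : ℝ => x :=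
  HasPolyGrowth.clm (ContinuousLinearMap.id ℝ ℝ)

lemma hasPolyGrowth_pow (k : ℕ) : HasPolyGrowth fun x : ℝ => x ^ k := by
  induction k with
  | zero => simpa using HasPolyGrowth.const (E := ℝ) (1 : ℝ)
  | succ k ih => simpa [pow_succ] using ih.mul hasPolyGrowth_id

lemma memLp_hermiteFun (n : ℕ) : MemLp (hermiteFun n) 2 (gaussianReal 0 1) :=
  (hasPolyGrowth_hermiteFun n).memLp_gaussianReal (continuous_hermiteFun n)

/-- From `x H_n = H_{n+1} + n H_{n-1}`, vanishing of the integrals against `x^k H_n` for all `n`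
passes from `k` to `k + 1`; this forces the induction to be uniform in `n`. -/
lemma integral_pow_mul_eq_zero {f : ℝ → ℝ} (hf : MemLp f 2 (gaussianReal 0 1))
    (h0 : ∀ n, hermiteCoeff f n = 0) (k : ℕ) :
    ∫ x, x ^ k * f x ∂(gaussianReal 0 1) = 0 := by
  suffices h : ∀ k n, ∫ x, f x * (x ^ k * hermiteFun n x) ∂(gaussianReal 0 1) = 0 by
    have := h k 0
    simp only [hermiteFun_zero, mul_one] at this
    simpa only [mul_comm] using this
  have I : ∀ k n, Integrable (fun x => f x * (x ^ k * hermiteFun n x)) (gaussianReal 0 1) :=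
    fun k n => hf.integrable_mul (((hasPolyGrowth_pow k).mul
      (hasPolyGrowth_hermiteFun n)).memLp_gaussianReal
        ((continuous_pow k).mul (continuous_hermiteFun n)))
  intro k
  induction k with
  | zero =>
    intro n
    simp only [pow_zero, one_mul]
    exact h0 n
  | succ k ih =>
    intro n
    have : ∀ x, f x * (x ^ (k + 1) * hermiteFun n x) = f x * (x ^ k * hermiteFun (n + 1) x) +
        n * (f x * (x ^ k * hermiteFun (n - 1) x)) := by
      intro x
      rw [hermiteFun_succ]
      ring
    simp_rw [this]
    rw [integral_add (I _ _) ((I _ _).const_mul _), integral_const_mul, ih, ih]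
    simp

/-- Vanishing moments kill each partial sum of the exponential series. Those sums are dominated by
`exp(|t| |x|) |f|`, integrable as a product of two functions in `L²`. -/
lemma integral_cexp_mul_eq_zero {f : ℝ → ℝ} (hf : MemLp f 2 (gaussianReal 0 1))
    (h0 : ∀ n, hermiteCoeff f n = 0) (t : ℝ) :
    ∫ x, Complex.exp (t * x * Complex.I) * f x ∂(gaussianReal 0 1) = 0 := by
  set F : ℕ → ℝ → ℂ := fun N x =>
    (∑ k ∈ Finset.range N, (t * x * Complex.I) ^ k / (k.factorial : ℂ)) * f x with hF
  have hexp : MemLp (fun x : ℝ => Real.exp (|t| * |x|)) 2 (gaussianReal 0 1) := by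
    rw [memLp_two_iff_integrable_sq (by fun_prop)]
    have := integrable_exp_mul_abs (μ := gaussianReal 0 1) (X := fun x : ℝ => x) (t := 2 * |t|)
      (integrable_exp_mul_gaussianReal _) (by
        have := integrable_exp_mul_gaussianReal (μ := 0) (v := 1) (-(2 * |t|))
        simpa using this)
    refine this.congr (ae_of_all _ fun x => ?_)
    simp only
    rw [← Real.exp_nat_mul]
    push_cast
    ring_nf
  have hlim : Tendsto (fun N => ∫ x, F N x ∂(gaussianReal 0 1)) atTop
      (𝓝 (∫ x, Complex.exp (t * x * Complex.I) * f x ∂(gaussianReal 0 1))) := by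
    refine tendsto_integral_of_dominated_convergence
      (fun x => Real.exp (|t| * |x|) * |f x|) (fun N => ?_) (hexp.integrable_mul hf.abs)
      (fun N => ae_of_all _ fun x => ?_) (ae_of_all _ fun x => ?_)
    · refine AEStronglyMeasurable.mul ?_
        (Complex.continuous_ofReal.comp_aestronglyMeasurable hf.1)
      refine Continuous.aestronglyMeasurable ?_
      fun_prop
    · simp only [hF, norm_mul, Complex.norm_real, Real.norm_eq_abs]
      gcongr
      refine (norm_sum_le _ _).trans ?_
      have : ∀ k, ‖(t * x * Complex.I) ^ k / (k.factorial : ℂ)‖ =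
          (|t| * |x|) ^ k / (k.factorial : ℝ) := by
        intro k
        simp [norm_pow]
      simp_rw [this]
      exact Real.sum_le_exp_of_nonneg (by positivity) N
    · simp only [hF]
      refine Tendsto.mul_const _ ?_
      rw [Complex.exp_eq_exp_ℂ]
      exact (NormedSpace.expSeries_div_hasSum_exp (t * x * Complex.I : ℂ)).tendsto_sum_nat
  have hz : ∀ N, ∫ x, F N x ∂(gaussianReal 0 1) = 0 := by
    intro N
    simp only [hF, Finset.sum_mul]
    have e : ∀ (k : ℕ) (x : ℝ), (t * x * Complex.I) ^ k / (k.factorial : ℂ) * (f x : ℂ) =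
        ((t * Complex.I) ^ k / (k.factorial : ℂ)) * ((x ^ k * f x : ℝ) : ℂ) := by
      intro k x
      push_cast
      ring
    simp_rw [e]
    rw [integral_finsetSum]
    · refine Finset.sum_eq_zero fun k _ => ?_
      rw [integral_const_mul, integral_complex_ofReal, integral_pow_mul_eq_zero hf h0]
      simp
    · intro k _
      refine Integrable.const_mul ?_ _
      exact (((hasPolyGrowth_pow k).memLp_gaussianReal (continuous_pow k)).integrable_mul hf).ofReal
  simp_rw [hz] at hlim
  exact (tendsto_nhds_unique hlim tendsto_const_nhds)

/-- Completeness of the Hermite polynomials in `L²` of the Gaussian measure. -/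
theorem ae_eq_zero_of_hermiteCoeff_eq_zero {f : ℝ → ℝ} (hf : MemLp f 2 (gaussianReal 0 1))
    (h0 : ∀ n, hermiteCoeff f n = 0) : f =ᵐ[gaussianReal 0 1] 0 := by
  set γ := gaussianReal 0 1 with hγ
  have hfi : Integrable f γ := hf.integrable (by norm_num)
  set g := hfi.1.mk f with hg
  have hgm : Measurable g := hfi.1.stronglyMeasurable_mk.measurable
  have hfg : f =ᵐ[γ] g := hfi.1.ae_eq_mk
  have hgi : Integrable g γ := hfi.congr hfg
  set p : ℝ → NNReal := fun x => (g x).toNNReal with hp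
  set n : ℝ → NNReal := fun x => (-g x).toNNReal with hn
  have hpm : Measurable p := hgm.real_toNNReal
  have hnm : Measurable n := hgm.neg.real_toNNReal
  have hpi : Integrable (fun x => (p x : ℝ)) γ := hgi.real_toNNReal
  have hni : Integrable (fun x => (n x : ℝ)) γ := hgi.neg.real_toNNReal
  have hpn : ∀ x, g x = (p x : ℝ) - (n x : ℝ) := fun x => by
    simp only [hp, hn, Real.coe_toNNReal']
    rcases le_total 0 (g x) with h | h <;> simp [h]
  have fin : ∀ {q : ℝ → NNReal}, Integrable (fun x => (q x : ℝ)) γ →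
      IsFiniteMeasure (γ.withDensity fun x => (q x : ENNReal)) := by
    intro q hq
    refine isFiniteMeasure_withDensity ?_
    have := hq.2
    simp only [hasFiniteIntegral_iff_enorm] at this
    simpa using this.ne
  have := fin hpi
  have := fin hni
  -- The positive and negative parts of `f` are densities of finite measures with equal
  -- characteristic functions, hence these measures coincide.
  have heq : (γ.withDensity fun x => (p x : ENNReal)) = γ.withDensity fun x => (n x : ENNReal) := by
    apply Measure.ext_of_charFun
    funext t
    rw [charFun_apply_real, charFun_apply_real, integral_withDensity_eq_integral_smul hpm,
      integral_withDensity_eq_integral_smul hnm, ← sub_eq_zero]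
    have hb : ∀ {q : ℝ → NNReal}, Measurable q → Integrable (fun x => (q x : ℝ)) γ →
        Integrable (fun x => q x • Complex.exp (t * x * Complex.I)) γ := by
      intro q hqm hq
      refine hq.mono (by fun_prop) (ae_of_all _ fun x => ?_)
      rw [NNReal.smul_def, norm_smul]
      have : ‖Complex.exp (t * x * Complex.I)‖ = 1 := by
        have := Complex.norm_exp_ofReal_mul_I (t * x)
        simpa using this
      rw [this, mul_one]
    rw [← integral_sub (hb hpm hpi) (hb hnm hni), ← integral_cexp_mul_eq_zero hf h0 t]
    refine integral_congr_ae ?_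
    filter_upwards [hfg] with x hx
    rw [hx, hpn, NNReal.smul_def, NNReal.smul_def]
    simp only [Complex.real_smul]
    push_cast
    ring
  rw [withDensity_eq_iff_of_sigmaFinite (by fun_prop) (by fun_prop)] at heq
  filter_upwards [hfg, heq] with x hx hx'
  rw [hx, hpn]
  simp only [ENNReal.coe_inj] at hx'
  simp [hx']

/-- The `L²`-normalised Hermite polynomials. -/
noncomputable def hermiteLp (n : ℕ) : Lp ℝ 2 (gaussianReal 0 1) :=
  (Real.sqrt (n.factorial : ℝ))⁻¹ • (memLp_hermiteFun n).toLp

lemma inner_toLp {α : Type*} [MeasurableSpace α] {μ : Measure α} {f g : α → ℝ} (hf : MemLp f 2 μ)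
    (hg : MemLp g 2 μ) : inner ℝ (hf.toLp) (hg.toLp) = ∫ x, f x * g x ∂μ := by
  rw [L2.inner_def]
  refine integral_congr_ae ?_
  filter_upwards [hf.coeFn_toLp, hg.coeFn_toLp] with x h1 h2
  rw [h1, h2]
  simp [mul_comm]

lemma orthonormal_hermiteLp : Orthonormal ℝ hermiteLp := by
  rw [orthonormal_iff_ite]
  intro l m
  rw [hermiteLp, hermiteLp, inner_smul_left, inner_smul_right, inner_toLp,
    integral_hermiteFun_mul_gaussianReal]
  split_ifs with h
  · subst h
    have : (0 : ℝ) < l.factorial := by positivity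
    simp only [conj_trivial]
    rw [← mul_assoc, ← mul_inv, Real.mul_self_sqrt this.le, inv_mul_cancel₀ this.ne']
  · simp

lemma inner_hermiteLp {f : ℝ → ℝ} (hf : MemLp f 2 (gaussianReal 0 1)) (n : ℕ) :
    inner ℝ (hermiteLp n) hf.toLp = (Real.sqrt (n.factorial : ℝ))⁻¹ * hermiteCoeff f n := by
  rw [hermiteLp, inner_smul_left, inner_toLp, hermiteCoeff]
  simp_rw [mul_comm (f _)]
  simp

/-- The Hilbert basis of normalised Hermite polynomials. -/
noncomputable def hermiteBasis : HilbertBasis ℕ ℝ (Lp ℝ 2 (gaussianReal 0 1)) :=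
  HilbertBasis.mkOfOrthogonalEqBot orthonormal_hermiteLp (by
    rw [Submodule.eq_bot_iff]
    intro f hf
    have hm : MemLp f 2 (gaussianReal 0 1) := Lp.memLp f
    have hf' : hm.toLp = f := Lp.toLp_coeFn f hm
    have h0 : ∀ n, hermiteCoeff f n = 0 := by
      intro n
      have h1 : inner ℝ (hermiteLp n) f = 0 :=
        (Submodule.mem_orthogonal _ _).1 hf _ (Submodule.subset_span ⟨n, rfl⟩)
      rw [← hf', inner_hermiteLp] at h1
      have : (Real.sqrt (n.factorial : ℝ))⁻¹ ≠ 0 := by positivity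
      rcases mul_eq_zero.1 h1 with h | h
      · exact absurd h this
      · exact h
    have := ae_eq_zero_of_hermiteCoeff_eq_zero hm h0
    exact (Lp.eq_zero_iff_ae_eq_zero).2 this)

lemma hermiteBasis_apply (n : ℕ) : hermiteBasis n = hermiteLp n := by
  rw [hermiteBasis, HilbertBasis.coe_mkOfOrthogonalEqBot]

lemma hermiteBasis_repr {f : ℝ → ℝ} (hf : MemLp f 2 (gaussianReal 0 1)) (n : ℕ) :
    hermiteBasis.repr hf.toLp n = (Real.sqrt (n.factorial : ℝ))⁻¹ * hermiteCoeff f n := by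
  rw [HilbertBasis.repr_apply_apply, hermiteBasis_apply, inner_hermiteLp]

variable {E : Type*} [NormedAddCommGroup E] [NormedSpace ℝ E] [MeasurableSpace E] [BorelSpace E]
  [CompleteSpace E] [SecondCountableTopology E] {μ : Measure E} [IsGaussian μ]

lemma measurePreserving_of_integral_mul_self (hμ : ∫ x, x ∂μ = 0) (A : E →L[ℝ] ℝ)
    (hA : ∫ x, A x * A x ∂μ = 1) : MeasurePreserving A μ (gaussianReal 0 1) := by
  refine ⟨A.continuous.measurable, ?_⟩
  have h0 : ∫ x, A x ∂μ = 0 := by rw [IsGaussian.integral_dual, hμ, map_zero]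
  rw [IsGaussian.map_eq_gaussianReal A, h0,
    variance_of_integral_eq_zero A.continuous.measurable.aemeasurable h0]
  simp_rw [pow_two, hA]
  simp

/-- Hermite expansion of the covariance of a function of two jointly Gaussian variables. -/
theorem hasSum_integral_comp_mul_comp (hμ : ∫ x, x ∂μ = 0) (A B : E →L[ℝ] ℝ)
    (hA : ∫ x, A x * A x ∂μ = 1) (hB : ∫ x, B x * B x ∂μ = 1) {h : ℝ → ℝ}
    (hh : MemLp h 2 (gaussianReal 0 1)) :
    HasSum (fun l => hermiteCoeff h l ^ 2 / (l.factorial : ℝ) * (∫ x, A x * B x ∂μ) ^ l)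
      (∫ x, h (A x) * h (B x) ∂μ) := by
  have pA := measurePreserving_of_integral_mul_self hμ A hA
  have pB := measurePreserving_of_integral_mul_self hμ B hB
  -- Composition with `A` and with `B` embeds `L²` of the standard Gaussian isometrically in `L² μ`.
  -- The two images of the Hermite basis are biorthogonal with weights `ρ^l`, so only the diagonal
  -- survives when `h ∘ A` and `h ∘ B` are expanded.
  set TA : Lp ℝ 2 (gaussianReal 0 1) →L[ℝ] Lp ℝ 2 μ :=
    (Lp.compMeasurePreservingₗᵢ ℝ A pA).toContinuousLinearMap with hTA
  set TB : Lp ℝ 2 (gaussianReal 0 1) →L[ℝ] Lp ℝ 2 μ :=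
    (Lp.compMeasurePreservingₗᵢ ℝ B pB).toContinuousLinearMap with hTB
  have eA : ∀ {f : ℝ → ℝ} (hf : MemLp f 2 (gaussianReal 0 1)),
      TA hf.toLp = (hf.comp_measurePreserving pA).toLp := fun hf =>
    Lp.toLp_compMeasurePreserving hf pA
  have eB : ∀ {f : ℝ → ℝ} (hf : MemLp f 2 (gaussianReal 0 1)),
      TB hf.toLp = (hf.comp_measurePreserving pB).toLp := fun hf =>
    Lp.toLp_compMeasurePreserving hf pB
  have hAB : ∀ l m, inner ℝ (TA (hermiteLp l)) (TB (hermiteLp m)) =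
      if l = m then (∫ x, A x * B x ∂μ) ^ l else 0 := by
    intro l m
    rw [hermiteLp, hermiteLp, map_smul, map_smul, eA, eB, inner_smul_left, inner_smul_right,
      inner_toLp]
    simp only [Function.comp_apply]
    rw [integral_hermiteFun_mul hμ A B hA hB]
    split_ifs with hlm
    · subst hlm
      have : (0 : ℝ) < l.factorial := by positivity
      simp only [conj_trivial]
      rw [← mul_assoc, ← mul_assoc, ← mul_inv, Real.mul_self_sqrt this.le,
        inv_mul_cancel₀ this.ne', one_mul]
    · simp
  have hsum := hermiteBasis.hasSum_repr hh.toLp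
  simp only [hermiteBasis_repr, hermiteBasis_apply] at hsum
  have h1 : ∀ l, inner ℝ (TA (hermiteLp l)) (TB hh.toLp) =
      (Real.sqrt (l.factorial : ℝ))⁻¹ * hermiteCoeff h l * (∫ x, A x * B x ∂μ) ^ l := by
    intro l
    have := (hsum.mapL TB).mapL (innerSL ℝ (TA (hermiteLp l)))
    simp only [map_smul, innerSL_apply_apply, hAB, smul_eq_mul, mul_ite, mul_zero] at this
    refine this.unique ?_
    have hs := hasSum_ite_eq l
      ((Real.sqrt (l.factorial : ℝ))⁻¹ * hermiteCoeff h l * (∫ x, A x * B x ∂μ) ^ l)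
    refine hs.congr_fun fun m => ?_
    by_cases hm : l = m
    · subst hm; simp
    · simp [hm, Ne.symm hm]
  have h2 := (hsum.mapL TA).mapL (innerSL ℝ (TB hh.toLp))
  simp only [map_smul, innerSL_apply_apply, smul_eq_mul] at h2
  have h3 : inner ℝ (TB hh.toLp) (TA hh.toLp) = ∫ x, h (A x) * h (B x) ∂μ := by
    rw [real_inner_comm, eA hh, eB hh, inner_toLp]
    rfl
  rw [h3] at h2
  refine h2.congr_fun fun l => ?_
  rw [real_inner_comm, h1]
  have : (0 : ℝ) < l.factorial := by positivity
  have hs : (Real.sqrt (l.factorial : ℝ))⁻¹ * (Real.sqrt (l.factorial : ℝ))⁻¹ =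
      (l.factorial : ℝ)⁻¹ := by
    rw [← mul_inv, Real.mul_self_sqrt this.le]
  linear_combination (-hermiteCoeff h l ^ 2 * (∫ x, A x * B x ∂μ) ^ l) * hs

lemma hasSum_hermiteCoeff_sq {h : ℝ → ℝ} (hh : MemLp h 2 (gaussianReal 0 1)) :
    HasSum (fun l => hermiteCoeff h l ^ 2 / (l.factorial : ℝ))
      (∫ x, h x ^ 2 ∂(gaussianReal 0 1)) := by
  have := hasSum_integral_comp_mul_comp (μ := gaussianReal 0 1) integral_id_gaussianReal_zero
    (ContinuousLinearMap.id ℝ ℝ) (ContinuousLinearMap.id ℝ ℝ)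
    (by simpa using integral_mul_self_gaussianReal)
    (by simpa using integral_mul_self_gaussianReal) hh
  simpa [integral_mul_self_gaussianReal, pow_two] using this

end HermiteBasis

/-! ### Approximating centred functions by functions of the form `x q - q'`. -/

section SteinApproximation

open scoped ContDiff

lemma hermiteCoeff_sub_sum {h : ℝ → ℝ} (hh : MemLp h 2 (gaussianReal 0 1)) (N l : ℕ) :
    hermiteCoeff (fun x => h x - ∑ m ∈ Finset.range N,
      hermiteCoeff h m / (m.factorial : ℝ) * hermiteFun m x) l =
      if l < N then 0 else hermiteCoeff h l := by
  rw [hermiteCoeff]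
  simp_rw [sub_mul, Finset.sum_mul, mul_assoc]
  have I : ∀ m, Integrable (fun x => hermiteFun m x * hermiteFun l x) (gaussianReal 0 1) :=
    fun m => (memLp_hermiteFun m).integrable_mul (memLp_hermiteFun l)
  have hI : Integrable (fun x => h x * hermiteFun l x) (gaussianReal 0 1) :=
    hh.integrable_mul (memLp_hermiteFun l)
  rw [integral_sub hI (integrable_finsetSum _ fun m _ => (I m).const_mul _),
    integral_finsetSum _ fun m _ => (I m).const_mul _]
  simp_rw [integral_const_mul, integral_hermiteFun_mul_gaussianReal]
  change hermiteCoeff h l - _ = _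
  simp only [mul_ite, mul_zero, Finset.sum_ite_eq', Finset.mem_range]
  split_ifs
  · have : (l.factorial : ℝ) ≠ 0 := by positivity
    field_simp
    ring
  · ring

lemma tendsto_integral_sub_hermite_sum {h : ℝ → ℝ} (hh : MemLp h 2 (gaussianReal 0 1)) :
    Tendsto (fun N => ∫ x, (h x - ∑ m ∈ Finset.range N,
      hermiteCoeff h m / (m.factorial : ℝ) * hermiteFun m x) ^ 2 ∂(gaussianReal 0 1)) atTop
      (𝓝 0) := by
  set a : ℕ → ℝ := fun l => hermiteCoeff h l ^ 2 / (l.factorial : ℝ) with ha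
  set T := ∫ x, h x ^ 2 ∂(gaussianReal 0 1) with hT
  have hsum : HasSum a T := hasSum_hermiteCoeff_sq hh
  have key : ∀ N, ∫ x, (h x - ∑ m ∈ Finset.range N,
      hermiteCoeff h m / (m.factorial : ℝ) * hermiteFun m x) ^ 2 ∂(gaussianReal 0 1) =
      T - ∑ l ∈ Finset.range N, a l := by
    intro N
    have hS : MemLp (fun x => ∑ m ∈ Finset.range N,
        hermiteCoeff h m / (m.factorial : ℝ) * hermiteFun m x) 2 (gaussianReal 0 1) :=
      memLp_finsetSum _ fun m _ => (memLp_hermiteFun m).const_mul _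
    have h1 := hasSum_hermiteCoeff_sq (hh.sub hS)
    have h2 : HasSum (fun l => if l ∈ Finset.range N then a l else 0)
        (∑ l ∈ Finset.range N, a l) := by
      rw [← Finset.sum_congr rfl fun l hl => if_pos hl]
      exact hasSum_sum_of_ne_finset_zero fun l hl => if_neg hl
    refine h1.unique ((hsum.sub h2).congr_fun fun l => ?_)
    have := hermiteCoeff_sub_sum hh N l
    simp only [Pi.sub_def, this, Finset.mem_range, ha]
    split_ifs <;> simp
  simp_rw [key]
  have := hsum.tendsto_sum_nat.const_sub T
  simpa using this

/-- Each `H_{l+1}` equals `x H_l - H_l'`, so a truncated Hermite expansion without constant term has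
the form `x p - p'`, with `p` the sum of `c_{l+1}/(l+1)! H_l`. The constant term is the only
obstruction, hence `h0`. -/
lemma exists_polyGrowth_stein_approx {h : ℝ → ℝ} (hh : MemLp h 2 (gaussianReal 0 1))
    (h0 : hermiteCoeff h 0 = 0) {ε : ℝ} (hε : 0 < ε) :
    ∃ p : ℝ → ℝ, ContDiff ℝ ∞ p ∧ HasPolyGrowth p ∧ HasPolyGrowth (deriv p) ∧
      ∫ x, (h x - (x * p x - deriv p x)) ^ 2 ∂(gaussianReal 0 1) < ε := by
  obtain ⟨N, hN⟩ := (((tendsto_integral_sub_hermite_sum hh).comp (tendsto_add_atTop_nat 1)).eventually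
    (gt_mem_nhds hε)).exists
  set b : ℕ → ℝ := fun l => hermiteCoeff h (l + 1) / ((l + 1).factorial : ℝ) with hb
  have hd : ∀ x, HasDerivAt (fun x => ∑ l ∈ Finset.range N, b l * hermiteFun l x)
      (∑ l ∈ Finset.range N, b l * (l * hermiteFun (l - 1) x)) x := fun x =>
    HasDerivAt.fun_sum fun l _ => (hasDerivAt_hermiteFun l x).const_mul _
  have hd' : deriv (fun x => ∑ l ∈ Finset.range N, b l * hermiteFun l x) =
      fun x => ∑ l ∈ Finset.range N, b l * (l * hermiteFun (l - 1) x) :=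
    funext fun x => (hd x).deriv
  refine ⟨fun x => ∑ l ∈ Finset.range N, b l * hermiteFun l x,
    ContDiff.sum fun l _ => contDiff_const.mul (contDiff_hermiteFun l),
    HasPolyGrowth.sum _ fun l _ => (HasPolyGrowth.const _).mul (hasPolyGrowth_hermiteFun l), ?_, ?_⟩
  · rw [hd']
    exact HasPolyGrowth.sum _ fun l _ => (HasPolyGrowth.const _).mul
      ((HasPolyGrowth.const _).mul (hasPolyGrowth_hermiteFun _))
  · rw [hd']
    refine lt_of_eq_of_lt ?_ hN
    rw [Function.comp_apply]
    refine integral_congr_ae (ae_of_all _ fun x => ?_)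
    beta_reduce
    rw [Finset.sum_range_succ', h0, Finset.mul_sum, ← Finset.sum_sub_distrib]
    simp only [zero_div, zero_mul, add_zero]
    congr 2
    refine Finset.sum_congr rfl fun l _ => ?_
    rw [hermiteFun_succ]
    ring

/-- Smooth compactly supported `q` yield a dense family of centred functions `x q - q'`. -/
theorem exists_compactSupport_stein_approx {h : ℝ → ℝ} (hh : MemLp h 2 (gaussianReal 0 1))
    (h0 : hermiteCoeff h 0 = 0) {ε : ℝ} (hε : 0 < ε) :
    ∃ q : ℝ → ℝ, ContDiff ℝ ∞ q ∧ HasCompactSupport q ∧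
      ∫ x, (h x - (x * q x - deriv q x)) ^ 2 ∂(gaussianReal 0 1) < ε := by
  obtain ⟨p, hp, gp, gp', hlt⟩ := exists_polyGrowth_stein_approx hh h0 hε
  let χ : ContDiffBump (0 : ℝ) := ⟨1, 2, one_pos, one_lt_two⟩
  have hχ : ContDiff ℝ ∞ χ := χ.contDiff
  have hχd : ∀ x, HasDerivAt χ (deriv χ x) x := fun x =>
    (hχ.differentiable (by simp) x).hasDerivAt
  have hpd : ∀ x, HasDerivAt p (deriv p x) x := fun x =>
    (hp.differentiable (by simp) x).hasDerivAt
  have hχc' : Continuous (deriv χ) := hχ.continuous_deriv (by simp)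
  have hpc' : Continuous (deriv p) := hp.continuous_deriv (by simp)
  have hpc : Continuous p := hp.continuous
  have hχc : Continuous χ := hχ.continuous
  obtain ⟨M, hM⟩ := χ.hasCompactSupport.deriv.exists_bound_of_continuous hχc'
  have hM0 : 0 ≤ M := (norm_nonneg _).trans (hM 0)
  set r : ℕ → ℝ := fun n => ((n : ℝ) + 1)⁻¹ with hr
  have hr0 : ∀ n, 0 < r n := fun n => by positivity
  have hr1 : ∀ n, r n ≤ 1 := fun n => inv_le_one_of_one_le₀ (by linarith [n.cast_nonneg (α := ℝ)])
  have hrt : Tendsto r atTop (𝓝 0) := by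
    simpa [hr, one_div] using tendsto_one_div_add_atTop_nhds_zero_nat (𝕜 := ℝ)
  -- Cut `p` off at scale `1 / r n`: differentiating the cutoff costs only a factor `r n`, which
  -- tends to `0`.
  set q : ℕ → ℝ → ℝ := fun n x => p x * χ (r n * x) with hq
  have hqd : ∀ n x, HasDerivAt (q n)
      (deriv p x * χ (r n * x) + p x * (r n * deriv χ (r n * x))) x := by
    intro n x
    have h1 : HasDerivAt (fun x => r n * x) (r n) x := by
      simpa using (hasDerivAt_id x).const_mul (r n)
    have h2 := (hχd (r n * x)).comp x h1
    refine ((hpd x).mul h2).congr_deriv ?_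
    simp only [Function.comp_apply]
    ring
  have hqd' : ∀ n, deriv (q n) = fun x =>
      deriv p x * χ (r n * x) + p x * (r n * deriv χ (r n * x)) :=
    fun n => funext fun x => (hqd n x).deriv
  have hlim : Tendsto (fun n => ∫ x, (h x - (x * q n x - deriv (q n) x)) ^ 2 ∂(gaussianReal 0 1))
      atTop (𝓝 (∫ x, (h x - (x * p x - deriv p x)) ^ 2 ∂(gaussianReal 0 1))) := by
    have G : HasPolyGrowth fun x => |x * p x| + |deriv p x| + |p x| * M := by
      have a : ∀ {f : ℝ → ℝ}, HasPolyGrowth f → HasPolyGrowth fun x => |f x| := by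
        rintro f ⟨K, k, hK, hf⟩
        exact ⟨K, k, hK, fun x => by simpa using hf x⟩
      exact ((a (hasPolyGrowth_id.mul gp)).add (a gp')).add ((a gp).mul (.const M))
    have hG : MemLp (fun x => |h x| + (|x * p x| + |deriv p x| + |p x| * M)) 2
        (gaussianReal 0 1) :=
      hh.abs.add (G.memLp_gaussianReal (by fun_prop))
    refine tendsto_integral_of_dominated_convergence
      (fun x => (|h x| + (|x * p x| + |deriv p x| + |p x| * M)) ^ 2) (fun n => ?_) hG.integrable_sq
      (fun n => ae_of_all _ fun x => ?_) (ae_of_all _ fun x => ?_)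
    · rw [hqd']
      refine (hh.1.sub (Continuous.aestronglyMeasurable ?_)).pow 2
      simp only [hq]
      fun_prop
    · rw [norm_pow, Real.norm_eq_abs, hqd']
      simp only [hq]
      have hc : |χ (r n * x)| ≤ 1 := by rw [abs_of_nonneg χ.nonneg]; exact χ.le_one
      have hM' : |r n * deriv χ (r n * x)| ≤ M := by
        rw [abs_mul, abs_of_pos (hr0 n)]
        have := hM (r n * x)
        rw [Real.norm_eq_abs] at this
        calc r n * _ ≤ 1 * M := by gcongr; exact hr1 n
          _ = M := one_mul M
      gcongr
      refine (abs_sub _ _).trans ?_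
      gcongr
      have t1 : |x * (p x * χ (r n * x))| ≤ |x * p x| := by
        rw [← mul_assoc, abs_mul (x * p x)]
        exact mul_le_of_le_one_right (abs_nonneg _) hc
      have t2 : |deriv p x * χ (r n * x)| ≤ |deriv p x| := by
        rw [abs_mul]
        exact mul_le_of_le_one_right (abs_nonneg _) hc
      have t3 : |p x * (r n * deriv χ (r n * x))| ≤ |p x| * M := by
        rw [abs_mul]
        gcongr
      calc _ ≤ |x * (p x * χ (r n * x))| +
            |deriv p x * χ (r n * x) + p x * (r n * deriv χ (r n * x))| := abs_sub _ _
        _ ≤ |x * (p x * χ (r n * x))| +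
            (|deriv p x * χ (r n * x)| + |p x * (r n * deriv χ (r n * x))|) := by
              gcongr
              exact abs_add_le _ _
        _ ≤ _ := by linarith
    · rw [show (fun n => (h x - (x * q n x - deriv (q n) x)) ^ 2) = fun n => (h x - (x * q n x -
        (deriv p x * χ (r n * x) + p x * (r n * deriv χ (r n * x))))) ^ 2 from
        funext fun n => by rw [hqd']]
      simp only [hq]
      have h1 : Tendsto (fun n => r n * x) atTop (𝓝 0) := by simpa using hrt.mul_const x
      have h2 : Tendsto (fun n => χ (r n * x)) atTop (𝓝 1) := by
        have := (hχc.tendsto 0).comp h1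
        rwa [show χ 0 = 1 from χ.one_of_mem_closedBall (by simp [χ])] at this
      have h3 : Tendsto (fun n => r n * deriv χ (r n * x)) atTop (𝓝 0) := by
        have := hrt.mul ((hχc'.tendsto 0).comp h1)
        simpa using this
      have := (((h2.const_mul (p x)).const_mul x).sub ((h2.const_mul (deriv p x)).add
        (h3.const_mul (p x)))).const_sub (h x) |>.pow 2
      simpa using this
  obtain ⟨n, hn⟩ := (hlim.eventually (gt_mem_nhds hlt)).exists
  refine ⟨q n, hp.mul (hχ.comp (contDiff_const.mul contDiff_id)), ?_, hn⟩
  have : HasCompactSupport fun x => χ (r n * x) :=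
    χ.hasCompactSupport.comp_homeomorph (Homeomorph.mulLeft₀ (r n) (hr0 n).ne')
  exact this.mul_left

end SteinApproximation

/-! ### The Gaussian calculus in coordinates, with the covariance matrix explicit. -/

section GaussianVector

variable {α : Type*} [Fintype α] {μ : Measure (α → ℝ)} [IsGaussian μ]

/-- The matrix of second moments of a measure on `α → ℝ`. -/
noncomputable def secondMoment (μ : Measure (α → ℝ)) (a b : α) : ℝ := ∫ x, x a * x b ∂μ

omit [Fintype α] [IsGaussian μ] in
lemma secondMoment_comm (a b : α) : secondMoment μ a b = secondMoment μ b a := by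
  simp only [secondMoment, mul_comm]

lemma integrable_coord_mul_coord (a b : α) : Integrable (fun x : α → ℝ => x a * x b) μ := by
  have hc : Continuous fun x : α → ℝ => x a * x b := by fun_prop
  have hg : HasPolyGrowth fun x : α → ℝ => x a * x b :=
    (HasPolyGrowth.clm (ContinuousLinearMap.proj (R := ℝ) (φ := fun _ : α => ℝ) a)).mul
      (.clm (ContinuousLinearMap.proj (R := ℝ) (φ := fun _ : α => ℝ) b))
  exact hg.integrable hc.aestronglyMeasurable

/-- The linear map with partial derivatives `D`. -/
noncomputable def gradientMap {F : Type*} [NormedAddCommGroup F] [NormedSpace ℝ F] (D : α → F) :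
    (α → ℝ) →L[ℝ] F :=
  ∑ b, ContinuousLinearMap.smulRightL ℝ (α → ℝ) F (ContinuousLinearMap.proj b) (D b)

lemma gradientMap_apply {F : Type*} [NormedAddCommGroup F] [NormedSpace ℝ F] (D : α → F)
    (v : α → ℝ) : gradientMap D v = ∑ b, v b • D b := by
  simp [gradientMap]

lemma continuous_gradientMap {F X : Type*} [NormedAddCommGroup F] [NormedSpace ℝ F]
    [TopologicalSpace X] {D : X → α → F} (hD : ∀ b, Continuous fun x => D x b) :
    Continuous fun x => gradientMap (D x) :=
  continuous_finsetSum _ fun b _ => (ContinuousLinearMap.continuous _).comp (hD b)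

lemma exists_norm_gradientMap_le {F X : Type*} [NormedAddCommGroup F] [NormedSpace ℝ F]
    {D : X → α → F} {K : ℝ} (hD : ∀ x b, ‖D x b‖ ≤ K) : ∃ K', ∀ x, ‖gradientMap (D x)‖ ≤ K' := by
  refine ⟨∑ b, ‖ContinuousLinearMap.smulRightL ℝ (α → ℝ) F (ContinuousLinearMap.proj b)‖ * K,
    fun x => (norm_sum_le _ _).trans ?_⟩
  gcongr with b
  exact (ContinuousLinearMap.le_opNorm _ _).trans (by gcongr; exact hD x b)

/-- In the product formula the increment `y` is independent of `x`. Expanding the derivative along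
`y` in coordinates therefore separates `E[y_a y_b]`, a covariance entry, from the integral of the
`b`-th partial derivative. -/
lemma gaussian_integral_by_parts_pi {F : Type*} [NormedAddCommGroup F] [NormedSpace ℝ F]
    [SecondCountableTopology F] [CompleteSpace F] (hμ : ∫ x, x ∂μ = 0) {Φ : (α → ℝ) → F}
    {D : (α → ℝ) → α → F} {K : ℝ} (hΦ : ∀ x, HasFDerivAt Φ (gradientMap (D x)) x)
    (hD : ∀ b, Continuous fun x => D x b) (hb : ∀ x, ‖Φ x‖ ≤ K) (hb' : ∀ x b, ‖D x b‖ ≤ K) (a : α) :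
    ∫ x, x a • Φ x ∂μ = ∑ b, secondMoment μ a b • ∫ x, D x b ∂μ := by
  obtain ⟨K', hK'⟩ := exists_norm_gradientMap_le hb'
  have key := HasPolyGrowth.integral_by_parts hμ hΦ (continuous_gradientMap hD)
    (.of_bound hb) (.of_bound hK') (ContinuousLinearMap.proj a)
  simp only [ContinuousLinearMap.proj_apply] at key
  rw [key]
  have e : ∀ p : (α → ℝ) × (α → ℝ), p.2 a • gradientMap (D p.1) p.2 =
      ∑ b, (p.2 a * p.2 b) • D p.1 b := fun p => by
    rw [gradientMap_apply, Finset.smul_sum]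
    simp_rw [smul_smul]
  simp_rw [e]
  have I : ∀ b, Integrable (fun x => D x b) μ := fun b =>
    Integrable.of_bound (hD b).aestronglyMeasurable K (ae_of_all _ fun x => hb' x b)
  have J : ∀ b, Integrable (fun p : (α → ℝ) × (α → ℝ) => (p.2 a * p.2 b) • D p.1 b)
      (μ.prod μ) := fun b => by
    have := (integrable_coord_mul_coord (μ := μ) a b).smul_prod (I b)
    exact this.swap
  rw [integral_finsetSum _ fun b _ => J b]
  refine Finset.sum_congr rfl fun b _ => ?_
  rw [← integral_prod_swap]
  exact integral_prod_smul (𝕜 := ℝ) (fun x : α → ℝ => x a * x b) fun x => D x b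

lemma integral_sq_sum_coord (v : α → ℝ) :
    ∫ x, (∑ a, x a * v a) ^ 2 ∂μ = ∑ a, ∑ b, v a * v b * secondMoment μ a b := by
  have e : ∀ x : α → ℝ, (∑ a, x a * v a) ^ 2 = ∑ a, ∑ b, v a * v b * (x a * x b) := fun x => by
    rw [pow_two, Finset.sum_mul_sum]
    exact Finset.sum_congr rfl fun a _ => Finset.sum_congr rfl fun b _ => by ring
  simp_rw [e]
  rw [integral_finsetSum _ fun a _ => integrable_finsetSum _ fun b _ =>
    (integrable_coord_mul_coord a b).const_mul _]
  refine Finset.sum_congr rfl fun a _ => ?_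
  rw [integral_finsetSum _ fun b _ => (integrable_coord_mul_coord a b).const_mul _]
  exact Finset.sum_congr rfl fun b _ => integral_const_mul _ _

/-- For fixed `x`, averaging the squared derivative along `y` gives the covariance form evaluated at
the gradient of `f` at `x`; `Λ` bounds that form by `Λ` times the squared length of the gradient. -/
lemma gaussian_poincare_pi (hμ : ∫ x, x ∂μ = 0) {f : (α → ℝ) → ℝ}
    {D : (α → ℝ) → α → ℝ} {K Λ S : ℝ} (hf : ∀ x, HasFDerivAt f (gradientMap (D x)) x)
    (hD : ∀ b, Continuous fun x => D x b) (hb : ∀ x, |f x| ≤ K) (hb' : ∀ x b, ‖D x b‖ ≤ K)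
    (hΛ : ∀ v : α → ℝ, ∑ a, ∑ b, v a * v b * secondMoment μ a b ≤ Λ * ∑ a, v a ^ 2)
    (hΛ0 : 0 ≤ Λ) (hS : ∀ x, ∑ a, D x a ^ 2 ≤ S) :
    Var[f; μ] ≤ Real.pi ^ 2 / 8 * (Λ * S) := by
  obtain ⟨K', hK'⟩ := exists_norm_gradientMap_le hb'
  have hc := continuous_gradientMap hD
  have key := gaussian_poincare hμ hf hc (K := max K K')
    (fun x => (hb x).trans (le_max_left _ _)) (fun x => (hK' x).trans (le_max_right _ _))
  refine key.trans ?_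
  gcongr
  have hcont : Continuous fun p : (α → ℝ) × (α → ℝ) => (gradientMap (D p.1) p.2) ^ 2 :=
    ((hc.comp continuous_fst).clm_apply continuous_snd).pow 2
  have hI : Integrable (fun p : (α → ℝ) × (α → ℝ) => (gradientMap (D p.1) p.2) ^ 2)
      (μ.prod μ) := by
    have g : HasPolyGrowth fun p : (α → ℝ) × (α → ℝ) => gradientMap (D p.1) p.2 := by
      refine ⟨max K' 0, 1, le_max_right _ _, fun p => ?_⟩
      refine (ContinuousLinearMap.le_opNorm _ _).trans ?_
      rw [pow_one]
      have h1 := norm_snd_le p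
      have h2 := hK' p.1
      have h3 := le_max_left K' 0
      gcongr
      · linarith
      · linarith
    exact (by simpa [pow_two] using g.mul g : HasPolyGrowth
      fun p : (α → ℝ) × (α → ℝ) => (gradientMap (D p.1) p.2) ^ 2).integrable
        hcont.aestronglyMeasurable
  rw [integral_prod _ hI]
  have hpt : ∀ x, ∫ y, (gradientMap (D x) y) ^ 2 ∂μ ≤ Λ * S := fun x => by
    simp_rw [gradientMap_apply, smul_eq_mul]
    rw [integral_sq_sum_coord]
    exact (hΛ _).trans (by gcongr; exact hS x)
  calc ∫ x, ∫ y, (gradientMap (D x) y) ^ 2 ∂μ ∂μ ≤ ∫ _, Λ * S ∂μ :=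
        integral_mono hI.integral_prod_left (integrable_const _) hpt
    _ = Λ * S := by simp

/-- For positive semidefinite `C ≤ Λ` and `y = C z`, expand `0 ≤ ⟨C(Λz - y), Λz - y⟩` as `Λ²⟨Cz, z⟩
- 2Λ|y|² + ⟨Cy, y⟩` and bound both forms by `Λ`. This turns a bound on a quadratic form into an
operator norm bound without diagonalising. -/
lemma sum_sq_mulVec_le {Λ : ℝ} (hΛ0 : 0 < Λ)
    (hΛ : ∀ v : α → ℝ, ∑ a, ∑ b, v a * v b * secondMoment μ a b ≤ Λ * ∑ a, v a ^ 2)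
    (z : α → ℝ) :
    ∑ a, (∑ b, secondMoment μ a b * z b) ^ 2 ≤ Λ ^ 2 * ∑ a, z a ^ 2 := by
  set y : α → ℝ := fun a => ∑ b, secondMoment μ a b * z b with hy
  have h0 : 0 ≤ ∑ a, ∑ b, (Λ * z a - y a) * (Λ * z b - y b) * secondMoment μ a b := by
    rw [← integral_sq_sum_coord]
    exact integral_nonneg fun x => sq_nonneg _
  have e1 : ∑ a, ∑ b, y a * z b * secondMoment μ a b = ∑ a, y a ^ 2 := by
    refine Finset.sum_congr rfl fun a _ => ?_
    rw [pow_two]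
    nth_rewrite 3 [hy]
    rw [Finset.mul_sum]
    exact Finset.sum_congr rfl fun b _ => by ring
  have e2 : ∑ a, ∑ b, z a * y b * secondMoment μ a b = ∑ a, y a ^ 2 := by
    rw [← e1, Finset.sum_comm]
    refine Finset.sum_congr rfl fun a _ => Finset.sum_congr rfl fun b _ => ?_
    rw [secondMoment_comm]
    ring
  have e3 : ∑ a, ∑ b, (Λ * z a - y a) * (Λ * z b - y b) * secondMoment μ a b =
      Λ ^ 2 * (∑ a, ∑ b, z a * z b * secondMoment μ a b) -
        Λ * (∑ a, ∑ b, z a * y b * secondMoment μ a b) -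
        Λ * (∑ a, ∑ b, y a * z b * secondMoment μ a b) +
        ∑ a, ∑ b, y a * y b * secondMoment μ a b := by
    simp only [Finset.mul_sum, ← Finset.sum_sub_distrib, ← Finset.sum_add_distrib]
    exact Finset.sum_congr rfl fun a _ => Finset.sum_congr rfl fun b _ => by ring
  rw [e3, e1, e2] at h0
  have h1 := hΛ z
  have h2 := hΛ y
  have h3 : Λ * (∑ a, y a ^ 2) ≤ Λ * (Λ ^ 2 * ∑ a, z a ^ 2) := by
    have : Λ ^ 2 * (∑ a, ∑ b, z a * z b * secondMoment μ a b) ≤ Λ ^ 2 * (Λ * ∑ a, z a ^ 2) := by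
      gcongr
    nlinarith
  exact le_of_mul_le_mul_left h3 hΛ0

end GaussianVector

/-! ### Stein's identity for linear statistics. -/

section SteinMethod

/-- `h = x q - q'`, with `q, q', h, h', h''` continuous and bounded by `B`. -/
structure IsSteinRep (q q1 h h1 h2 : ℝ → ℝ) (B : ℝ) : Prop where
  deriv_q : ∀ x, HasDerivAt q (q1 x) x
  deriv_h : ∀ x, HasDerivAt h (h1 x) x
  deriv_h1 : ∀ x, HasDerivAt h1 (h2 x) x
  eq : ∀ x, h x = x * q x - q1 x
  cont_q1 : Continuous q1
  cont_h2 : Continuous h2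
  le_q : ∀ x, |q x| ≤ B
  le_q1 : ∀ x, |q1 x| ≤ B
  le_h : ∀ x, |h x| ≤ B
  le_h1 : ∀ x, |h1 x| ≤ B
  le_h2 : ∀ x, |h2 x| ≤ B

open scoped ContDiff in
lemma exists_isSteinRep {q : ℝ → ℝ} (hq : ContDiff ℝ ∞ q) (hc : HasCompactSupport q) :
    ∃ h1 h2 B, IsSteinRep q (deriv q) (fun x => x * q x - deriv q x) h1 h2 B := by
  set h : ℝ → ℝ := fun x => x * q x - deriv q x with hh
  have hq1 : ContDiff ℝ ∞ (deriv q) := contDiff_infty_iff_deriv.1 hq |>.2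
  have ch : ContDiff ℝ ∞ h := (contDiff_id.mul hq).sub hq1
  have ch1 : ContDiff ℝ ∞ (deriv h) := contDiff_infty_iff_deriv.1 ch |>.2
  have ch2 : ContDiff ℝ ∞ (deriv (deriv h)) := contDiff_infty_iff_deriv.1 ch1 |>.2
  have sh : HasCompactSupport h := (hc.mul_left (f := fun x => x)).sub hc.deriv
  obtain ⟨B0, hB0⟩ := hc.exists_bound_of_continuous hq.continuous
  obtain ⟨B1, hB1⟩ := hc.deriv.exists_bound_of_continuous hq1.continuous
  obtain ⟨B2, hB2⟩ := sh.exists_bound_of_continuous ch.continuous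
  obtain ⟨B3, hB3⟩ := sh.deriv.exists_bound_of_continuous ch1.continuous
  obtain ⟨B4, hB4⟩ := sh.deriv.deriv.exists_bound_of_continuous ch2.continuous
  have d : ∀ {f : ℝ → ℝ}, ContDiff ℝ ∞ f → ∀ x, HasDerivAt f (deriv f x) x := fun hf x =>
    (hf.differentiable (by simp) x).hasDerivAt
  have n0 := (norm_nonneg _).trans (hB0 0)
  have n1 := (norm_nonneg _).trans (hB1 0)
  have n2 := (norm_nonneg _).trans (hB2 0)
  have n3 := (norm_nonneg _).trans (hB3 0)
  have n4 := (norm_nonneg _).trans (hB4 0)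
  refine ⟨deriv h, deriv (deriv h), B0 + B1 + B2 + B3 + B4, d hq, d ch, d ch1, fun x => rfl,
    hq1.continuous, ch2.continuous, fun x => (hB0 x).trans ?_, fun x => (hB1 x).trans ?_,
    fun x => (hB2 x).trans ?_, fun x => (hB3 x).trans ?_, fun x => (hB4 x).trans ?_⟩ <;> linarith

variable {α : Type*} [Fintype α] {μ : Measure (α → ℝ)} [IsGaussian μ]

variable {q q1 h h1 h2 : ℝ → ℝ} {B : ℝ}

lemma hasFDerivAt_comp_coord {f : ℝ → ℝ} {f' : ℝ} {a : α} {x : α → ℝ}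
    (hf : HasDerivAt f f' (x a)) :
    HasFDerivAt (fun x : α → ℝ => f (x a)) (f' • ContinuousLinearMap.proj (R := ℝ) a) x :=
  hf.comp_hasFDerivAt x (ContinuousLinearMap.proj (R := ℝ) (φ := fun _ : α => ℝ) a).hasFDerivAt

namespace IsSteinRep

lemma nonneg (H : IsSteinRep q q1 h h1 h2 B) : 0 ≤ B := (abs_nonneg _).trans (H.le_q 0)

lemma cont_q (H : IsSteinRep q q1 h h1 h2 B) : Continuous q :=
  continuous_iff_continuousAt.2 fun x => (H.deriv_q x).continuousAt

lemma cont_h (H : IsSteinRep q q1 h h1 h2 B) : Continuous h :=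
  continuous_iff_continuousAt.2 fun x => (H.deriv_h x).continuousAt

lemma cont_h1 (H : IsSteinRep q q1 h h1 h2 B) : Continuous h1 :=
  continuous_iff_continuousAt.2 fun x => (H.deriv_h1 x).continuousAt

lemma abs_sum_le (H : IsSteinRep q q1 h h1 h2 B) (w : α → ℝ) (x : α → ℝ) :
    |∑ a, w a * h (x a)| ≤ ∑ a, |w a| * B := by
  refine (Finset.abs_sum_le_sum_abs _ _).trans ?_
  gcongr with a
  rw [abs_mul]
  gcongr
  exact H.le_h _

lemma continuous_sum (H : IsSteinRep q q1 h h1 h2 B) (w : α → ℝ) :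
    Continuous fun x : α → ℝ => ∑ a, w a * h (x a) := by
  have := H.cont_h
  fun_prop

lemma hasFDerivAt_sum (H : IsSteinRep q q1 h h1 h2 B) (w : α → ℝ) (x : α → ℝ) :
    HasFDerivAt (fun x : α → ℝ => ∑ a, w a * h (x a)) (gradientMap fun b => w b * h1 (x b)) x := by
  have := HasFDerivAt.fun_sum (u := Finset.univ) fun a _ =>
    (hasFDerivAt_comp_coord (a := a) (x := x) (H.deriv_h (x a))).const_mul (w a)
  refine this.congr_fderiv ?_
  ext v
  simp only [FunLike.coe_sum, Finset.sum_apply, smul_apply,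
    ContinuousLinearMap.proj_apply, smul_eq_mul, gradientMap_apply]
  exact Finset.sum_congr rfl fun a _ => by ring

/-- Stein's identity for a linear statistic `F = ∑ w_a h(x_a)` of a Gaussian vector. -/
theorem integral_mul_comp (H : IsSteinRep q q1 h h1 h2 B) (hμ : ∫ x, x ∂μ = 0)
    (hdiag : ∀ a, secondMoment μ a a = 1) (w : α → ℝ) {G G' : ℝ → ℂ}
    (hG : ∀ y, HasDerivAt G (G' y) y) (hG' : Continuous G') :
    ∫ x, ((∑ a, w a * h (x a) : ℝ) : ℂ) * G (∑ a, w a * h (x a)) ∂μ =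
      ∫ x, ((∑ a, ∑ b, w a * w b * secondMoment μ a b * (q (x a) * h1 (x b)) : ℝ) : ℂ) *
        G' (∑ a, w a * h (x a)) ∂μ := by
  classical
  set F : (α → ℝ) → ℝ := fun x => ∑ a, w a * h (x a) with hF
  have cF : Continuous F := H.continuous_sum w
  have cG : Continuous G := continuous_iff_continuousAt.2 fun y => (hG y).continuousAt
  have c1 := H.cont_h1
  have cq := H.cont_q
  have cq1 := H.cont_q1
  have ch := H.cont_h
  have hB := H.nonneg
  obtain ⟨M, hM⟩ := (isCompact_Icc (a := -∑ a, |w a| * B) (b := ∑ a, |w a| * B)).exists_bound_of_continuousOn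
    cG.continuousOn
  obtain ⟨M', hM'⟩ := (isCompact_Icc (a := -∑ a, |w a| * B) (b := ∑ a, |w a| * B)).exists_bound_of_continuousOn
    hG'.continuousOn
  have bG : ∀ x, ‖G (F x)‖ ≤ M := fun x => hM _ (abs_le.1 (H.abs_sum_le w x))
  have bG' : ∀ x, ‖G' (F x)‖ ≤ M' := fun x => hM' _ (abs_le.1 (H.abs_sum_le w x))
  have M0 : 0 ≤ M := (norm_nonneg _).trans (bG 0)
  have M0' : 0 ≤ M' := (norm_nonneg _).trans (bG' 0)
  set D : α → (α → ℝ) → α → ℂ := fun a x b =>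
    (if a = b then (q1 (x a) : ℂ) * G (F x) else 0) + (q (x a) * (w b * h1 (x b)) : ℝ) * G' (F x)
    with hD
  have cD : ∀ a b, Continuous fun x => D a x b := fun a b => by
    simp only [hD]
    split_ifs <;> fun_prop
  obtain ⟨W, hW⟩ : ∃ W, ∀ b, |w b| ≤ W := ⟨∑ b, |w b|, fun b =>
    Finset.single_le_sum (fun b _ => abs_nonneg (w b)) (Finset.mem_univ b)⟩
  have bD : ∀ a x b, ‖D a x b‖ ≤ B * M + B * (W * B) * M' := fun a x b => by
    refine (norm_add_le _ _).trans (add_le_add ?_ ?_)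
    · split_ifs
      · rw [norm_mul, Complex.norm_real]
        exact mul_le_mul (H.le_q1 _) (bG x) (norm_nonneg _) hB
      · simpa using by positivity
    · rw [norm_mul, Complex.norm_real, norm_mul, norm_mul]
      have := (abs_nonneg _).trans (hW b)
      exact mul_le_mul (mul_le_mul (H.le_q _) (mul_le_mul (hW b) (H.le_h1 _) (norm_nonneg _) this)
        (by positivity) hB) (bG' x) (norm_nonneg _) (by positivity)
  -- Integrate `x_a` by parts against `q(x_a) G(F)`. Since `C_{aa} = 1`, the term where the
  -- derivative hits `q` is exactly the `q1` subtracted in `h = x q - q1`, so only the terms hitting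
  -- `G(F)` remain.
  have key : ∀ a, ∫ x, x a • (q (x a) • G (F x)) ∂μ =
      ∑ b, secondMoment μ a b • ∫ x, D a x b ∂μ := fun a => by
    refine gaussian_integral_by_parts_pi hμ (K := B * M + (B * M + B * (W * B) * M'))
      (fun x => ?_) (cD a) (fun x => ?_) (fun x b => (bD a x b).trans ?_) a
    · have d1 := hasFDerivAt_comp_coord (a := a) (x := x) (H.deriv_q (x a))
      have d2 := (hG (F x)).hasFDerivAt.comp x (H.hasFDerivAt_sum w x)
      refine (d1.smul d2).congr_fderiv ?_
      ext v
      simp only [gradientMap_apply, hD, smul_add, Finset.sum_add_distrib, smul_ite, smul_zero,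
        Finset.sum_ite_eq, Finset.mem_univ, if_true, add_apply,
        smul_apply, ContinuousLinearMap.smulRight_apply,
        ContinuousLinearMap.comp_apply, ContinuousLinearMap.proj_apply, Function.comp_apply,
        ContinuousLinearMap.toSpanSingleton_apply, Complex.real_smul, smul_eq_mul]
      rw [add_comm]
      congr 1
      · push_cast
        ring
      · push_cast
        rw [Finset.sum_mul, Finset.mul_sum]
        exact Finset.sum_congr rfl fun b _ => by ring
    · rw [norm_smul]
      have : 0 ≤ B * (W * B) * M' := by
        have := (abs_nonneg _).trans (hW a)
        positivity
      have := mul_le_mul (H.le_q (x a)) (bG x) (norm_nonneg _) hB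
      rw [Real.norm_eq_abs]
      nlinarith
    · have : 0 ≤ B * M := by positivity
      linarith
  have ID : ∀ a b, Integrable (fun x => D a x b) μ := fun a b =>
    Integrable.of_bound (cD a b).aestronglyMeasurable _ (ae_of_all _ fun x => bD a x b)
  have Iq1 : ∀ a, Integrable (fun x => (q1 (x a) : ℂ) * G (F x)) μ := fun a =>
    Integrable.of_bound (C := B * M) (Continuous.aestronglyMeasurable (by fun_prop))
      (ae_of_all _ fun x => by
        rw [norm_mul, Complex.norm_real]
        exact mul_le_mul (H.le_q1 _) (bG x) (norm_nonneg _) hB)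
  have Ih : ∀ a, Integrable (fun x => (h (x a) : ℂ) * G (F x)) μ := fun a =>
    Integrable.of_bound (C := B * M) (Continuous.aestronglyMeasurable (by fun_prop))
      (ae_of_all _ fun x => by
        rw [norm_mul, Complex.norm_real]
        exact mul_le_mul (H.le_h _) (bG x) (norm_nonneg _) hB)
  set T : α → α → (α → ℝ) → ℂ := fun a b x => (q (x a) * (w b * h1 (x b)) : ℝ) * G' (F x) with hT
  have IT : ∀ a b, Integrable (T a b) μ := fun a b => by
    refine Integrable.of_bound (C := B * (W * B) * M')
      (Continuous.aestronglyMeasurable (by simp only [hT]; fun_prop)) (ae_of_all _ fun x => ?_)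
    simp only [hT]
    rw [norm_mul, Complex.norm_real, norm_mul, norm_mul]
    have := (abs_nonneg _).trans (hW b)
    exact mul_le_mul (mul_le_mul (H.le_q _) (mul_le_mul (hW b) (H.le_h1 _) (norm_nonneg _) this)
      (by positivity) hB) (bG' x) (norm_nonneg _) (by positivity)
  have step : ∀ a, ∫ x, (h (x a) : ℂ) * G (F x) ∂μ =
      ∑ b, (secondMoment μ a b : ℂ) * ∫ x, T a b x ∂μ := fun a => by
    have e : ∀ x : α → ℝ, x a • (q (x a) • G (F x)) =
        (h (x a) : ℂ) * G (F x) + (q1 (x a) : ℂ) * G (F x) := fun x => by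
      rw [H.eq]
      simp only [Complex.real_smul]
      push_cast
      ring
    have k := key a
    simp_rw [e] at k
    rw [integral_add (Ih a) (Iq1 a)] at k
    have e2 : ∀ b, ∫ x, D a x b ∂μ =
        (if a = b then ∫ x, (q1 (x a) : ℂ) * G (F x) ∂μ else 0) + ∫ x, T a b x ∂μ := fun b => by
      by_cases hab : a = b
      · simp only [hD, hab, if_true]
        rw [integral_add (Iq1 b) (IT b b)]
      · simp only [hD, hab, if_false, zero_add, hT]
    simp_rw [e2, smul_add, Finset.sum_add_distrib, smul_ite, smul_zero] at k
    rw [Finset.sum_ite_eq] at k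
    simp only [Finset.mem_univ, if_true, hdiag, one_smul, Complex.real_smul] at k
    linear_combination k
  have l1 : ∀ x, ((F x : ℝ) : ℂ) * G (F x) = ∑ a, (w a : ℂ) * ((h (x a) : ℂ) * G (F x)) :=
    fun x => by
      simp only [hF]
      push_cast
      rw [Finset.sum_mul]
      exact Finset.sum_congr rfl fun a _ => by ring
  have l2 : ∀ x, ((∑ a, ∑ b, w a * w b * secondMoment μ a b * (q (x a) * h1 (x b)) : ℝ) : ℂ) *
      G' (F x) = ∑ a, ∑ b, ((w a : ℂ) * secondMoment μ a b) * T a b x := fun x => by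
    push_cast
    rw [Finset.sum_mul]
    refine Finset.sum_congr rfl fun a _ => ?_
    rw [Finset.sum_mul]
    refine Finset.sum_congr rfl fun b _ => ?_
    simp only [hT]
    push_cast
    ring
  refine (integral_congr_ae (ae_of_all _ l1)).trans
    (Eq.trans ?_ (integral_congr_ae (ae_of_all _ l2)).symm)
  rw [integral_finsetSum _ fun a _ => (Ih a).const_mul _,
    integral_finsetSum _ fun a _ => integrable_finsetSum _ fun b _ => (IT a b).const_mul _]
  refine Finset.sum_congr rfl fun a _ => ?_
  rw [integral_const_mul, step, integral_finsetSum _ fun b _ => (IT a b).const_mul _,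
    Finset.mul_sum]
  refine Finset.sum_congr rfl fun b _ => ?_
  rw [integral_const_mul]
  ring

end IsSteinRep

end SteinMethod

/-! ### Normal approximation for Stein-representable functions. -/

section SteinBound

variable {α : Type*} [Fintype α] {μ : Measure (α → ℝ)} [IsGaussian μ]

variable {q q1 h h1 h2 : ℝ → ℝ} {B : ℝ}

namespace IsSteinRep

lemma sum_sq_le (w : α → ℝ) {W : ℝ} (hW : ∑ a, w a ^ 2 ≤ W) {f : ℝ → ℝ} (hf : ∀ x, |f x| ≤ B)
    (x : α → ℝ) : ∑ a, (w a * f (x a)) ^ 2 ≤ W * B ^ 2 := by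
  calc ∑ a, (w a * f (x a)) ^ 2 ≤ ∑ a, w a ^ 2 * B ^ 2 := by
        gcongr with a
        rw [mul_pow]
        gcongr ?_ * ?_
        exact sq_le_sq.2 ((hf _).trans (le_abs_self B))
    _ ≤ W * B ^ 2 := by
        rw [← Finset.sum_mul]
        gcongr

/-- Poincaré applied to the kernel `Y` of Stein's identity. Its `c`-th partial derivative is `w_c
(q1(x_c) u_c + h2(x_c) v_c)`, where `u` and `v` are `C` applied to the vectors `w h1(x)` and `w
q(x)`. These have squared length at most `Λ² W B²`, while the leading `w_c²` is bounded pointwise by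
`κ`; for normalised sums `κ` is of order `1/n`, and this is the source of smallness. -/
lemma variance_kernel_le (H : IsSteinRep q q1 h h1 h2 B) (hμ : ∫ x, x ∂μ = 0)
    {Λ : ℝ} (hΛ0 : 0 < Λ)
    (hΛ : ∀ v : α → ℝ, ∑ a, ∑ b, v a * v b * secondMoment μ a b ≤ Λ * ∑ a, v a ^ 2)
    (w : α → ℝ) {κ W : ℝ} (hκ0 : 0 ≤ κ) (hκ : ∀ a, w a ^ 2 ≤ κ) (hW : ∑ a, w a ^ 2 ≤ W) :
    Var[fun x => ∑ a, ∑ b, w a * w b * secondMoment μ a b * (q (x a) * h1 (x b)); μ] ≤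
      Real.pi ^ 2 / 2 * κ * W * B ^ 4 * Λ ^ 3 := by
  have c1 := H.cont_h1
  have c2 := H.cont_h2
  have cq := H.cont_q
  have cq1 := H.cont_q1
  have hB := H.nonneg
  set C := secondMoment μ with hC
  set u : (α → ℝ) → α → ℝ := fun x c => ∑ b, C c b * (w b * h1 (x b)) with hu
  set v : (α → ℝ) → α → ℝ := fun x c => ∑ b, C c b * (w b * q (x b)) with hv
  set D : (α → ℝ) → α → ℝ := fun x c => w c * (q1 (x c) * u x c + h2 (x c) * v x c) with hD
  have hu2 : ∀ x, ∑ c, u x c ^ 2 ≤ Λ ^ 2 * (W * B ^ 2) := fun x =>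
    (sum_sq_mulVec_le hΛ0 hΛ _).trans (by gcongr; exact sum_sq_le w hW H.le_h1 x)
  have hv2 : ∀ x, ∑ c, v x c ^ 2 ≤ Λ ^ 2 * (W * B ^ 2) := fun x =>
    (sum_sq_mulVec_le hΛ0 hΛ _).trans (by gcongr; exact sum_sq_le w hW H.le_q x)
  have hS : ∀ x, ∑ c, D x c ^ 2 ≤ κ * (4 * B ^ 2 * (Λ ^ 2 * (W * B ^ 2))) := fun x => by
    have hpt : ∀ c, D x c ^ 2 ≤ κ * (2 * B ^ 2 * (u x c ^ 2 + v x c ^ 2)) := fun c => by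
      simp only [hD]
      rw [mul_pow]
      have b1 : q1 (x c) ^ 2 ≤ B ^ 2 := sq_le_sq.2 ((H.le_q1 _).trans (le_abs_self B))
      have b2 : h2 (x c) ^ 2 ≤ B ^ 2 := sq_le_sq.2 ((H.le_h2 _).trans (le_abs_self B))
      refine mul_le_mul (hκ c) ?_ (sq_nonneg _) hκ0
      calc (q1 (x c) * u x c + h2 (x c) * v x c) ^ 2
          ≤ 2 * (q1 (x c) ^ 2 * u x c ^ 2 + h2 (x c) ^ 2 * v x c ^ 2) := by
            nlinarith [sq_nonneg (q1 (x c) * u x c - h2 (x c) * v x c)]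
        _ ≤ 2 * (B ^ 2 * u x c ^ 2 + B ^ 2 * v x c ^ 2) := by gcongr
        _ = _ := by ring
    calc ∑ c, D x c ^ 2 ≤ ∑ c, κ * (2 * B ^ 2 * (u x c ^ 2 + v x c ^ 2)) :=
          Finset.sum_le_sum fun c _ => hpt c
      _ = κ * (2 * B ^ 2 * (∑ c, u x c ^ 2 + ∑ c, v x c ^ 2)) := by
          rw [← Finset.mul_sum, ← Finset.mul_sum, Finset.sum_add_distrib]
      _ ≤ κ * (2 * B ^ 2 * (Λ ^ 2 * (W * B ^ 2) + Λ ^ 2 * (W * B ^ 2))) := by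
          gcongr
          · exact hu2 x
          · exact hv2 x
      _ = _ := by ring
  have hY : ∀ x, HasFDerivAt
      (fun x : α → ℝ => ∑ a, ∑ b, w a * w b * C a b * (q (x a) * h1 (x b)))
      (gradientMap (D x)) x := fun x => by
    have := HasFDerivAt.fun_sum (u := Finset.univ) fun a _ =>
      HasFDerivAt.fun_sum (u := Finset.univ) fun b _ =>
        ((hasFDerivAt_comp_coord (a := a) (x := x) (H.deriv_q (x a))).mul
          (hasFDerivAt_comp_coord (a := b) (x := x) (H.deriv_h1 (x b)))).const_mul
            (w a * w b * C a b)
    refine this.congr_fderiv ?_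
    ext z
    simp only [FunLike.coe_sum, Finset.sum_apply, smul_apply, add_apply,
      ContinuousLinearMap.proj_apply, smul_eq_mul, gradientMap_apply]
    have e1 : ∀ c, z c * D x c = (∑ b, w c * w b * C c b * (h1 (x b) * (q1 (x c) * z c))) +
        ∑ a, w a * w c * C a c * (q (x a) * (h2 (x c) * z c)) := fun c => by
      simp only [hD, hu, hv, mul_add, Finset.mul_sum]
      congr 1
      · exact Finset.sum_congr rfl fun b _ => by ring
      · refine Finset.sum_congr rfl fun b _ => ?_
        rw [hC, secondMoment_comm]
        ring
    simp_rw [e1, Finset.sum_add_distrib]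
    rw [Finset.sum_comm (f := fun c a => w a * w c * C a c * (q (x a) * (h2 (x c) * z c))),
      ← Finset.sum_add_distrib]
    refine Finset.sum_congr rfl fun a _ => ?_
    rw [← Finset.sum_add_distrib]
    exact Finset.sum_congr rfl fun b _ => by ring
  set S := κ * (4 * B ^ 2 * (Λ ^ 2 * (W * B ^ 2))) with hSdef
  have key := gaussian_poincare_pi (K := max (∑ a, ∑ b, |w a * w b * C a b| * (B * B)) (√S)) hμ hY
    (fun b => by simp only [hD, hu, hv]; fun_prop)
    (fun x => by
      refine le_trans ?_ (le_max_left _ _)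
      refine (Finset.abs_sum_le_sum_abs _ _).trans (Finset.sum_le_sum fun a _ => ?_)
      refine (Finset.abs_sum_le_sum_abs _ _).trans (Finset.sum_le_sum fun b _ => ?_)
      rw [abs_mul, abs_mul (q _)]
      gcongr
      · exact H.le_q _
      · exact H.le_h1 _)
    (fun x b => by
      refine le_trans ?_ (le_max_right _ _)
      refine Real.abs_le_sqrt (le_trans ?_ (hS x))
      exact Finset.single_le_sum (f := fun c => D x c ^ 2) (fun c _ => sq_nonneg _)
        (Finset.mem_univ b))
    hΛ hΛ0.le hS
  refine key.trans (le_of_eq ?_)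
  rw [hSdef]
  ring

/-- A quantitative central limit theorem for linear statistics of a Gaussian vector. -/
theorem norm_charFun_sub_le (H : IsSteinRep q q1 h h1 h2 B) (hμ : ∫ x, x ∂μ = 0)
    (hdiag : ∀ a, secondMoment μ a a = 1) {Λ : ℝ} (hΛ0 : 0 < Λ)
    (hΛ : ∀ v : α → ℝ, ∑ a, ∑ b, v a * v b * secondMoment μ a b ≤ Λ * ∑ a, v a ^ 2)
    (w : α → ℝ) {κ W : ℝ} (hκ0 : 0 ≤ κ) (hκ : ∀ a, w a ^ 2 ≤ κ) (hW : ∑ a, w a ^ 2 ≤ W) (t : ℝ) :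
    ‖(∫ x, Complex.exp (t * (∑ a, w a * h (x a) : ℝ) * Complex.I) ∂μ) -
      Complex.exp (-((∫ x, (∑ a, w a * h (x a)) ^ 2 ∂μ : ℝ) * t ^ 2 / 2))‖ ≤
      t ^ 2 * √(Real.pi ^ 2 / 2 * κ * W * B ^ 4 * Λ ^ 3) := by
  set F : (α → ℝ) → ℝ := fun x => ∑ a, w a * h (x a) with hF
  set Y : (α → ℝ) → ℝ := fun x =>
    ∑ a, ∑ b, w a * w b * secondMoment μ a b * (q (x a) * h1 (x b)) with hY
  set V := Real.pi ^ 2 / 2 * κ * W * B ^ 4 * Λ ^ 3 with hV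
  set s2 := ∫ x, F x ^ 2 ∂μ with hs2
  have hVar : Var[Y; μ] ≤ V := H.variance_kernel_le hμ hΛ0 hΛ w hκ0 hκ hW
  have c1 := H.cont_h1
  have cq := H.cont_q
  have hB := H.nonneg
  have cF : Continuous F := H.continuous_sum w
  have cY : Continuous Y := by simp only [hY]; fun_prop
  set MF := ∑ a, |w a| * B with hMF
  have bF : ∀ x, |F x| ≤ MF := H.abs_sum_le w
  have bY : ∀ x, |Y x| ≤ ∑ a, ∑ b, |w a * w b * secondMoment μ a b| * (B * B) := fun x => by
    refine (Finset.abs_sum_le_sum_abs _ _).trans (Finset.sum_le_sum fun a _ => ?_)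
    refine (Finset.abs_sum_le_sum_abs _ _).trans (Finset.sum_le_sum fun b _ => ?_)
    rw [abs_mul, abs_mul (q _)]
    gcongr
    · exact H.le_q _
    · exact H.le_h1 _
  have IY : Integrable Y μ := Integrable.of_bound cY.aestronglyMeasurable _ (ae_of_all _ bY)
  -- Stein's identity with `G` the identity identifies the mean of `Y` as the second moment of `F`.
  have hEY : ∫ x, Y x ∂μ = s2 := by
    have := H.integral_mul_comp hμ hdiag w (G := fun y => (y : ℂ)) (G' := fun _ => 1)
      (fun y => Complex.ofRealCLM.hasDerivAt) continuous_const
    simp only [mul_one, ← Complex.ofReal_mul] at this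
    rw [integral_complex_ofReal, integral_complex_ofReal, Complex.ofReal_inj] at this
    rw [hs2, ← this]
    simp only [pow_two, hF]
  have hdev : ∫ x, |Y x - s2| ∂μ ≤ √V := by
    have m2 : MemLp (fun x => |Y x - s2|) 2 μ :=
      (MemLp.of_bound (cY.sub continuous_const).aestronglyMeasurable
        ((∑ a, ∑ b, |w a * w b * secondMoment μ a b| * (B * B)) + |s2|)
        (ae_of_all _ fun x => (norm_sub_le _ _).trans (by
          rw [Real.norm_eq_abs, Real.norm_eq_abs]; linarith [bY x]))).abs
    have h0 := variance_nonneg (fun x => |Y x - s2|) μ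
    rw [variance_eq_sub m2] at h0
    refine Real.le_sqrt_of_sq_le (le_trans ?_ hVar)
    rw [variance_eq_integral cY.aemeasurable, hEY]
    have e : ∫ x, ((fun x => |Y x - s2|) ^ 2) x ∂μ = ∫ x, (Y x - s2) ^ 2 ∂μ := by simp
    rw [e] at h0
    linarith
  set φ : ℝ → ℂ := fun t => ∫ x, Complex.exp (t * (F x : ℝ) * Complex.I) ∂μ with hφ
  have nexp : ∀ (s : ℝ) (x : α → ℝ), ‖Complex.exp (s * (F x : ℝ) * Complex.I)‖ = 1 := fun s x => by
    rw [← Complex.ofReal_mul, Complex.norm_exp_ofReal_mul_I]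
  have cexp : ∀ s : ℝ, Continuous fun x => Complex.exp (s * (F x : ℝ) * Complex.I) :=
    fun s => by fun_prop
  have hφd : ∀ s : ℝ, HasDerivAt φ
      (∫ x, (F x : ℂ) * Complex.I * Complex.exp (s * (F x : ℝ) * Complex.I) ∂μ) s := fun s => by
    refine (hasDerivAt_integral_of_dominated_loc_of_deriv_le (μ := μ) (s := Set.univ)
      (bound := fun _ => MF) (F := fun (s : ℝ) x => Complex.exp (s * (F x : ℝ) * Complex.I))
      (F' := fun (s : ℝ) x => (F x : ℂ) * Complex.I * Complex.exp (s * (F x : ℝ) * Complex.I))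
      univ_mem
      (Eventually.of_forall fun s => (cexp s).aestronglyMeasurable)
      (Integrable.of_bound (cexp s).aestronglyMeasurable 1 (ae_of_all _ fun x => (nexp s x).le))
      (Continuous.aestronglyMeasurable (by fun_prop)) (ae_of_all _ fun x s _ => ?_)
      (integrable_const _) (ae_of_all _ fun x s _ => ?_)).2
    · rw [norm_mul, norm_mul, nexp, Complex.norm_I, Complex.norm_real, mul_one, mul_one]
      exact bF x
    · have h1 : HasDerivAt (fun s : ℝ => (s : ℂ) * (F x : ℝ) * Complex.I)
          (1 * (F x : ℝ) * Complex.I) s :=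
        ((Complex.ofRealCLM.hasDerivAt (x := s)).mul_const _).mul_const _
      refine h1.cexp.congr_deriv ?_
      ring
  -- Stein's identity with `G(y) = i e^{isy}` turns `φ'(s)` into `-s E[Y e^{isF}]`. Replacing `Y` by
  -- its mean costs at most `|s| E|Y - s2|`.
  have hode : ∀ s : ℝ, ‖(∫ x, (F x : ℂ) * Complex.I * Complex.exp (s * (F x : ℝ) * Complex.I) ∂μ) +
      s * s2 * φ s‖ ≤ |s| * √V := fun s => by
    have st := H.integral_mul_comp hμ hdiag w
      (G := fun y => Complex.I * Complex.exp (s * (y : ℝ) * Complex.I))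
      (G' := fun y => -(s * Complex.exp (s * (y : ℝ) * Complex.I)))
      (fun y => by
        have h1 : HasDerivAt (fun y : ℝ => (s : ℂ) * (y : ℝ) * Complex.I)
            (s * 1 * Complex.I) y :=
          ((Complex.ofRealCLM.hasDerivAt (x := y)).const_mul _).mul_const _
        refine (h1.cexp.const_mul Complex.I).congr_deriv ?_
        linear_combination (s : ℂ) * Complex.exp (s * y * Complex.I) * Complex.I_mul_I)
      (by fun_prop)
    have e1 : ∫ x, (F x : ℂ) * Complex.I * Complex.exp (s * (F x : ℝ) * Complex.I) ∂μ =
        ∫ x, (Y x : ℂ) * -(s * Complex.exp (s * (F x : ℝ) * Complex.I)) ∂μ := by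
      rw [← st]
      refine integral_congr_ae (ae_of_all _ fun x => ?_)
      simp only [hF]
      ring
    have I1 : Integrable (fun x => (Y x : ℂ) * -(s * Complex.exp (s * (F x : ℝ) * Complex.I))) μ := by
      refine Integrable.mono' ((IY.abs).mul_const |s|) (Continuous.aestronglyMeasurable
        (by fun_prop)) (ae_of_all _ fun x => ?_)
      rw [norm_mul, norm_neg, norm_mul, nexp, Complex.norm_real, Complex.norm_real, mul_one]
      rfl
    have I2 : Integrable (fun x => s * s2 * Complex.exp (s * (F x : ℝ) * Complex.I)) μ :=
      (Integrable.of_bound (cexp s).aestronglyMeasurable 1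
        (ae_of_all _ fun x => (nexp s x).le)).const_mul _
    rw [e1, hφ, ← integral_const_mul, ← integral_add I1 I2]
    calc _ ≤ ∫ x, ‖(Y x : ℂ) * -(s * Complex.exp (s * (F x : ℝ) * Complex.I)) +
          s * s2 * Complex.exp (s * (F x : ℝ) * Complex.I)‖ ∂μ := norm_integral_le_integral_norm _
      _ = ∫ x, |s| * |Y x - s2| ∂μ := by
          refine integral_congr_ae (ae_of_all _ fun x => ?_)
          have : (Y x : ℂ) * -(s * Complex.exp (s * (F x : ℝ) * Complex.I)) +
              s * s2 * Complex.exp (s * (F x : ℝ) * Complex.I) =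
              -((s * (Y x - s2) : ℝ) * Complex.exp (s * (F x : ℝ) * Complex.I)) := by
            push_cast
            ring
          beta_reduce
          rw [this, norm_neg, norm_mul, nexp, Complex.norm_real, Real.norm_eq_abs, abs_mul, mul_one]
      _ = |s| * ∫ x, |Y x - s2| ∂μ := integral_const_mul _ _
      _ ≤ |s| * √V := by gcongr
  have hs0 : 0 ≤ s2 := integral_nonneg fun x => sq_nonneg _
  -- Integrating factor: `ψ` would be constant if `φ` solved the Gaussian equation exactly. Its
  -- derivative is bounded on the segment from `0` to `t`, and the mean value inequality supplies
  -- the second factor `|t|`.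
  set ψ : ℝ → ℂ := fun s => φ s * Complex.exp ((s2 * s ^ 2 / 2 : ℝ)) with hψ
  have hψd : ∀ s : ℝ, HasDerivAt ψ
      (((∫ x, (F x : ℂ) * Complex.I * Complex.exp (s * (F x : ℝ) * Complex.I) ∂μ) +
      s * s2 * φ s) * Complex.exp ((s2 * s ^ 2 / 2 : ℝ))) s := fun s => by
    have h1 : HasDerivAt (fun s : ℝ => s2 * s ^ 2 / 2) (s2 * s) s := by
      refine (((hasDerivAt_pow 2 s).const_mul s2).div_const 2).congr_deriv ?_
      simp
      ring
    have h2 := h1.ofReal_comp.cexp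
    refine ((hφd s).mul h2).congr_deriv ?_
    push_cast
    ring
  have hmv : ‖ψ t - ψ 0‖ ≤ (|t| * √V * Real.exp (s2 * t ^ 2 / 2)) * ‖t - 0‖ := by
    refine (convex_uIcc (0 : ℝ) t).norm_image_sub_le_of_norm_hasDerivWithin_le
      (fun s _ => (hψd s).hasDerivWithinAt) (fun s hs => ?_) Set.left_mem_uIcc Set.right_mem_uIcc
    have hst : |s| ≤ |t| := by
      have := Set.abs_sub_left_of_mem_uIcc hs
      simpa using this
    rw [norm_mul, ← Complex.ofReal_exp, Complex.norm_real, Real.norm_eq_abs, Real.abs_exp]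
    refine mul_le_mul ((hode s).trans (by gcongr)) ?_ (Real.exp_pos _).le (by positivity)
    have : s ^ 2 ≤ t ^ 2 := sq_le_sq.2 hst
    gcongr
  have hψ0 : ψ 0 = 1 := by simp [hψ, hφ]
  have hfin : φ t - Complex.exp (-((s2 : ℝ) * t ^ 2 / 2)) =
      (ψ t - ψ 0) * Complex.exp (-((s2 * t ^ 2 / 2 : ℝ) : ℂ)) := by
    rw [hψ0, sub_mul, one_mul]
    simp only [hψ]
    rw [mul_assoc, ← Complex.exp_add]
    push_cast
    simp
  rw [hfin, norm_mul, ← Complex.ofReal_neg, ← Complex.ofReal_exp, Complex.norm_real,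
    Real.norm_eq_abs, Real.abs_exp]
  calc _ ≤ (|t| * √V * Real.exp (s2 * t ^ 2 / 2)) * ‖t - 0‖ * Real.exp (-(s2 * t ^ 2 / 2)) := by
        gcongr
    _ = (|t| * |t|) * √V * (Real.exp (s2 * t ^ 2 / 2) * Real.exp (-(s2 * t ^ 2 / 2))) := by
        rw [sub_zero, Real.norm_eq_abs]
        ring
    _ = t ^ 2 * √V := by
        rw [← Real.exp_add, add_neg_cancel, Real.exp_zero, mul_one, abs_mul_abs_self, pow_two]

end IsSteinRep

end SteinBound

/-! ### Trigonometric polynomials and Toeplitz forms. -/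

section FourierCoefficients

/-- The coefficient `∫_{-π}^{π} e^{i k t} b(t) dt`. -/
noncomputable def trigCoeff (b : ℝ → ℂ) (k : ℤ) : ℂ :=
  ∫ t in (-Real.pi)..Real.pi, Complex.exp (Complex.I * (k : ℂ) * (t : ℂ)) * b t

/-- The trigonometric polynomial `∑_{k ∈ s} v_k e^{i k t}`. -/
noncomputable def trigPoly (s : Finset ℕ) (v : ℕ → ℝ) (t : ℝ) : ℂ :=
  ∑ k ∈ s, (v k : ℂ) * Complex.exp (Complex.I * (k : ℂ) * (t : ℂ))

lemma neg_pi_lt_pi : -Real.pi < Real.pi := by linarith [Real.pi_pos]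

lemma continuous_trigPoly (s : Finset ℕ) (v : ℕ → ℝ) : Continuous (trigPoly s v) := by
  unfold trigPoly
  fun_prop

lemma norm_cexp_I_mul_int (k : ℤ) (t : ℝ) :
    ‖Complex.exp (Complex.I * (k : ℂ) * (t : ℂ))‖ = 1 := by
  have := Complex.norm_exp_ofReal_mul_I (k * t)
  rw [← this]
  congr 2
  push_cast
  ring

lemma intervalIntegrable_cexp_mul {b : ℝ → ℂ} {x y : ℝ} (hb : IntervalIntegrable b volume x y)
    (k : ℤ) : IntervalIntegrable (fun t : ℝ => Complex.exp (Complex.I * (k : ℂ) * (t : ℂ)) * b t)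
      volume x y :=
  hb.continuousOn_mul (Continuous.continuousOn (by fun_prop))

lemma conj_trigPoly_mul_trigPoly (s : Finset ℕ) (v z : ℕ → ℝ) (t : ℝ) :
    (starRingEnd ℂ) (trigPoly s v t) * trigPoly s z t =
      ∑ i ∈ s, ∑ k ∈ s, ((v i * z k : ℝ) : ℂ) *
        Complex.exp (Complex.I * (((k : ℤ) - (i : ℤ) : ℤ) : ℂ) * (t : ℂ)) := by
  unfold trigPoly
  rw [map_sum, Finset.sum_mul_sum]
  refine Finset.sum_congr rfl fun i _ => Finset.sum_congr rfl fun k _ => ?_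
  rw [map_mul, ← Complex.exp_conj]
  simp only [map_mul, Complex.conj_ofReal, Complex.conj_I, Complex.conj_natCast]
  rw [show (Complex.I * (((k : ℤ) - (i : ℤ) : ℤ) : ℂ) * (t : ℂ)) =
    (-Complex.I * (i : ℂ) * (t : ℂ)) + (Complex.I * (k : ℂ) * (t : ℂ)) by push_cast; ring,
    Complex.exp_add]
  push_cast
  ring

/-- A Toeplitz form with symbol `b` is an integral against `b`. Both the operator norm bound on
covariances and the Fejér limit start from this identity. -/
lemma integral_conj_trigPoly_mul_trigPoly_mul (s : Finset ℕ) (v z : ℕ → ℝ) {b : ℝ → ℂ}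
    (hb : IntervalIntegrable b volume (-Real.pi) Real.pi) :
    ∫ t in (-Real.pi)..Real.pi, (starRingEnd ℂ) (trigPoly s v t) * trigPoly s z t * b t =
      ∑ i ∈ s, ∑ k ∈ s, ((v i * z k : ℝ) : ℂ) * trigCoeff b ((k : ℤ) - (i : ℤ)) := by
  simp_rw [conj_trigPoly_mul_trigPoly, Finset.sum_mul, mul_assoc]
  rw [intervalIntegral.integral_finsetSum]
  · refine Finset.sum_congr rfl fun i _ => ?_
    rw [intervalIntegral.integral_finsetSum]
    · refine Finset.sum_congr rfl fun k _ => ?_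
      rw [intervalIntegral.integral_const_mul, trigCoeff]
      simp_rw [mul_assoc]
    · intro k _
      simpa only [mul_assoc] using (intervalIntegrable_cexp_mul hb ((k : ℤ) - i)).const_mul _
  · intro i _
    have := IntervalIntegrable.sum s fun k (_ : k ∈ s) =>
      (intervalIntegrable_cexp_mul hb ((k : ℤ) - i)).const_mul ((v i * z k : ℝ) : ℂ)
    simpa only [mul_assoc, Finset.sum_fn] using this

lemma trigCoeff_one (k : ℤ) :
    trigCoeff (fun _ => 1) k = if k = 0 then ((2 * Real.pi : ℝ) : ℂ) else 0 := by
  unfold trigCoeff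
  split_ifs with h
  · subst h
    simp
    ring
  · simp only [mul_one]
    have hk : Complex.I * (k : ℂ) ≠ 0 := mul_ne_zero Complex.I_ne_zero (by exact_mod_cast h)
    rw [integral_exp_mul_complex hk, div_eq_zero_iff]
    left
    rw [sub_eq_zero, Complex.exp_eq_exp_iff_exists_int]
    refine ⟨k, ?_⟩
    push_cast
    ring

lemma integral_norm_trigPoly_sq (s : Finset ℕ) (v : ℕ → ℝ) :
    ∫ t in (-Real.pi)..Real.pi, ‖trigPoly s v t‖ ^ 2 = 2 * Real.pi * ∑ i ∈ s, v i ^ 2 := by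
  have h := integral_conj_trigPoly_mul_trigPoly_mul s v v (b := fun _ => 1)
    intervalIntegrable_const
  simp only [mul_one, trigCoeff_one, Complex.conj_mul'] at h
  rw [← Complex.ofReal_inj, ← intervalIntegral.integral_ofReal]
  push_cast
  rw [h, Finset.mul_sum]
  refine Finset.sum_congr rfl fun i hi => ?_
  rw [Finset.sum_eq_single i]
  · simp
    ring
  · intro k _ hk
    rw [if_neg (by omega), mul_zero]
  · exact fun h => absurd hi h

/-- A bounded spectral density induces a bounded bilinear form. -/
lemma norm_sum_sum_mul_trigCoeff_le (s : Finset ℕ) (v z : ℕ → ℝ) {b : ℝ → ℂ} {M : ℝ}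
    (hb : IntervalIntegrable b volume (-Real.pi) Real.pi)
    (hM : ∀ t ∈ Set.Ioo (-Real.pi) Real.pi, ‖b t‖ ≤ M) :
    ‖∑ i ∈ s, ∑ k ∈ s, ((v i * z k : ℝ) : ℂ) * trigCoeff b ((k : ℤ) - (i : ℤ))‖ ≤
      Real.pi * M * (∑ i ∈ s, v i ^ 2 + ∑ i ∈ s, z i ^ 2) := by
  rw [← integral_conj_trigPoly_mul_trigPoly_mul s v z hb]
  have hM0 : 0 ≤ M := (norm_nonneg _).trans (hM 0 ⟨by linarith [Real.pi_pos], Real.pi_pos⟩)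
  have cv := continuous_trigPoly s v
  have cz := continuous_trigPoly s z
  have hle : ∀ t ∈ Set.Ioo (-Real.pi) Real.pi,
      ‖(starRingEnd ℂ) (trigPoly s v t) * trigPoly s z t * b t‖ ≤
        M / 2 * (‖trigPoly s v t‖ ^ 2 + ‖trigPoly s z t‖ ^ 2) := fun t ht => by
    rw [norm_mul, norm_mul, RCLike.norm_conj]
    calc _ ≤ ‖trigPoly s v t‖ * ‖trigPoly s z t‖ * M := by gcongr; exact hM t ht
      _ ≤ _ := by nlinarith [sq_nonneg (‖trigPoly s v t‖ - ‖trigPoly s z t‖)]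
  have hI : IntervalIntegrable (fun t => M / 2 * (‖trigPoly s v t‖ ^ 2 + ‖trigPoly s z t‖ ^ 2))
      volume (-Real.pi) Real.pi := Continuous.intervalIntegrable (by fun_prop) _ _
  calc _ ≤ ∫ t in (-Real.pi)..Real.pi, M / 2 * (‖trigPoly s v t‖ ^ 2 + ‖trigPoly s z t‖ ^ 2) := by
        refine intervalIntegral.norm_integral_le_of_norm_le neg_pi_lt_pi.le ?_ hI
        -- Densities are controlled only on the open interval, while interval integrals include the
        -- right endpoint; that point is null.
        have hae : ∀ᵐ t : ℝ, t ≠ Real.pi := Measure.ae_ne volume Real.pi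
        filter_upwards [hae] with t ht ht'
        exact hle t ⟨ht'.1, lt_of_le_of_ne ht'.2 ht⟩
    _ = _ := by
        rw [intervalIntegral.integral_const_mul, intervalIntegral.integral_add,
          integral_norm_trigPoly_sq, integral_norm_trigPoly_sq]
        · ring
        · exact Continuous.intervalIntegrable (by fun_prop) _ _
        · exact Continuous.intervalIntegrable (by fun_prop) _ _

end FourierCoefficients

/-! ### Fejér means at the origin. -/

section Fejer

/-- With `z = e^{it}`, the geometric sum times `z - 1` has modulus at most `2`, and `|z - 1| =
2|sin(t/2)| ≥ 2|t|/π` for `|t| ≤ π`. -/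
lemma norm_trigPoly_one_le (n : ℕ) {t : ℝ} (ht : t ≠ 0) (ht' : |t| ≤ Real.pi) :
    ‖trigPoly (Finset.Icc 1 n) (fun _ => 1) t‖ ≤ Real.pi / |t| := by
  set z := Complex.exp (Complex.I * (t : ℂ)) with hz
  have hz1 : ‖z‖ = 1 := by
    rw [hz, mul_comm]
    exact Complex.norm_exp_ofReal_mul_I t
  have e : trigPoly (Finset.Icc 1 n) (fun _ => 1) t = ∑ k ∈ Finset.range n, z ^ (k + 1) := by
    rw [Finset.range_eq_Ico, Finset.sum_Ico_add' (fun k => z ^ k) 0 n 1]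
    unfold trigPoly
    refine Finset.sum_congr (by ext; grind) fun k _ => ?_
    rw [hz, ← Complex.exp_nat_mul]
    simp only [Complex.ofReal_one, one_mul]
    congr 1
    ring
  have hg : trigPoly (Finset.Icc 1 n) (fun _ => 1) t * (z - 1) = z * (z ^ n - 1) := by
    rw [e]
    simp_rw [pow_succ']
    rw [← Finset.mul_sum, mul_assoc, geom_sum_mul]
  have hn : ‖z * (z ^ n - 1)‖ ≤ 2 := by
    rw [norm_mul, hz1, one_mul]
    refine (norm_sub_le _ _).trans ?_
    rw [norm_pow, hz1]
    norm_num
  have ht0 : 0 < |t| := abs_pos.2 ht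
  have hl : 2 * |t| / Real.pi ≤ ‖z - 1‖ := by
    rw [hz, Complex.norm_exp_I_mul_ofReal_sub_one, norm_mul, Real.norm_eq_abs, Real.norm_eq_abs]
    have h2 : |t / 2| = |t| / 2 := by rw [abs_div, abs_two]
    have := Real.mul_abs_le_abs_sin (x := t / 2) (by rw [h2]; linarith)
    rw [h2] at this
    rw [abs_two]
    calc 2 * |t| / Real.pi = 2 * (2 / Real.pi * (|t| / 2)) := by ring
      _ ≤ _ := by gcongr
  rw [← hg, norm_mul] at hn
  rw [le_div_iff₀ ht0]
  have hpi := Real.pi_pos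
  have h3 : ‖trigPoly (Finset.Icc 1 n) (fun _ => 1) t‖ * (2 * |t| / Real.pi) ≤ 2 :=
    (mul_le_mul_of_nonneg_left hl (norm_nonneg _)).trans hn
  rw [← mul_div_assoc, div_le_iff₀ hpi] at h3
  linarith

/-- Fejér summation at a point of continuity. -/
lemma tendsto_fejer {g : ℝ → ℂ} (hg : IntervalIntegrable g volume (-Real.pi) Real.pi) {C : ℝ}
    (hC : ∀ t ∈ Set.Ioo (-Real.pi) Real.pi, ‖g t‖ ≤ C) (hc : ContinuousAt g 0) :
    Tendsto (fun n : ℕ => (n : ℂ)⁻¹ * ∑ i ∈ Finset.Icc 1 n, ∑ k ∈ Finset.Icc 1 n,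
      trigCoeff g ((k : ℤ) - (i : ℤ))) atTop (𝓝 (((2 * Real.pi : ℝ) : ℂ) * g 0)) := by
  have hpi := Real.pi_pos
  have h0 : (0 : ℝ) ∈ Set.Ioo (-Real.pi) Real.pi := ⟨by linarith, hpi⟩
  have hC0 : 0 ≤ C := (norm_nonneg _).trans (hC 0 h0)
  set A : ℕ → ℝ → ℂ := fun n => trigPoly (Finset.Icc 1 n) (fun _ => 1) with hA
  have cA : ∀ n, Continuous (A n) := fun n => continuous_trigPoly _ _
  have hS : ∀ {b : ℝ → ℂ}, IntervalIntegrable b volume (-Real.pi) Real.pi → ∀ n : ℕ,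
      ∑ i ∈ Finset.Icc 1 n, ∑ k ∈ Finset.Icc 1 n, trigCoeff b ((k : ℤ) - (i : ℤ)) =
        ∫ t in (-Real.pi)..Real.pi, ((‖A n t‖ ^ 2 : ℝ) : ℂ) * b t := by
    intro b hb n
    have := integral_conj_trigPoly_mul_trigPoly_mul (Finset.Icc 1 n) (fun _ => 1) (fun _ => 1) hb
    simp only [Complex.conj_mul', mul_one, Complex.ofReal_one, one_mul] at this
    rw [← this]
    push_cast
    rfl
  have hA2 : ∀ n, ∫ t in (-Real.pi)..Real.pi, ‖A n t‖ ^ 2 = 2 * Real.pi * n := fun n => by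
    rw [hA, integral_norm_trigPoly_sq]
    simp
  rw [Metric.tendsto_atTop]
  intro ε hε
  -- Since `‖A n‖²` has integral `2πn`, the part near `0` contributes at most `ε n / 2` with this
  -- tolerance. Away from `0` the integrand is at most `K`, contributing `2πK`, which is below `ε n
  -- / 2` once `n ≥ N`.
  obtain ⟨δ, hδ, hδg⟩ := Metric.continuousAt_iff.1 hc (ε / (4 * Real.pi)) (by positivity)
  set K := 2 * C * (Real.pi / δ) ^ 2 with hK
  obtain ⟨N, hN⟩ := exists_nat_gt (2 * Real.pi * K / (ε / 2))
  refine ⟨max N 1, fun n hn => ?_⟩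
  have hn1 : 1 ≤ n := (le_max_right _ _).trans hn
  have hnN : (N : ℝ) ≤ n := by exact_mod_cast (le_max_left _ _).trans hn
  have hn0 : (0 : ℝ) < n := by exact_mod_cast hn1
  have hnc : (n : ℂ) ≠ 0 := by exact_mod_cast hn0.ne'
  have hIc : IntervalIntegrable (fun _ : ℝ => g 0) volume (-Real.pi) Real.pi :=
    intervalIntegrable_const
  have hId : IntervalIntegrable (fun t => g t - g 0) volume (-Real.pi) Real.pi := hg.sub hIc
  have e1 : (n : ℂ)⁻¹ * ∑ i ∈ Finset.Icc 1 n, ∑ k ∈ Finset.Icc 1 n,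
      trigCoeff g ((k : ℤ) - (i : ℤ)) - ((2 * Real.pi : ℝ) : ℂ) * g 0 =
      (n : ℂ)⁻¹ * ∫ t in (-Real.pi)..Real.pi, ((‖A n t‖ ^ 2 : ℝ) : ℂ) * (g t - g 0) := by
    rw [hS hg]
    have hcont : ContinuousOn (fun t => ((‖A n t‖ ^ 2 : ℝ) : ℂ)) (Set.uIcc (-Real.pi) Real.pi) :=
      Continuous.continuousOn (by have := cA n; fun_prop)
    simp_rw [mul_sub]
    rw [intervalIntegral.integral_sub (hg.continuousOn_mul hcont) (hIc.continuousOn_mul hcont),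
      intervalIntegral.integral_mul_const, intervalIntegral.integral_ofReal, hA2]
    push_cast
    field_simp
  rw [dist_eq_norm, e1, norm_mul, norm_inv, Complex.norm_natCast]
  have hle : ∀ t ∈ Set.Ioo (-Real.pi) Real.pi,
      ‖((‖A n t‖ ^ 2 : ℝ) : ℂ) * (g t - g 0)‖ ≤ ε / (4 * Real.pi) * ‖A n t‖ ^ 2 + K := fun t ht => by
    rw [norm_mul, Complex.norm_real, Real.norm_of_nonneg (sq_nonneg _)]
    have hK0 : 0 ≤ K := by positivity
    by_cases htδ : |t| < δ
    · have := (hδg (x := t) (by simpa using htδ)).le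
      rw [dist_eq_norm] at this
      have := mul_le_mul_of_nonneg_left this (sq_nonneg ‖A n t‖)
      linarith
    · push Not at htδ
      have ht0 : t ≠ 0 := by
        rintro rfl
        simp at htδ
        linarith
      have h1 := norm_trigPoly_one_le n ht0 (abs_le.2 ⟨ht.1.le, ht.2.le⟩)
      have h2 : ‖A n t‖ ≤ Real.pi / δ := h1.trans (by gcongr)
      have h3 : ‖g t - g 0‖ ≤ 2 * C := (norm_sub_le _ _).trans (by linarith [hC t ht, hC 0 h0])
      calc ‖A n t‖ ^ 2 * ‖g t - g 0‖ ≤ (Real.pi / δ) ^ 2 * (2 * C) := by gcongr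
        _ = K := by rw [hK]; ring
        _ ≤ _ := by
          have : 0 ≤ ε / (4 * Real.pi) * ‖A n t‖ ^ 2 := by positivity
          linarith
  have hI : IntervalIntegrable (fun t => ε / (4 * Real.pi) * ‖A n t‖ ^ 2 + K)
      volume (-Real.pi) Real.pi :=
    Continuous.intervalIntegrable (by have := cA n; fun_prop) _ _
  have hbd : ‖∫ t in (-Real.pi)..Real.pi, ((‖A n t‖ ^ 2 : ℝ) : ℂ) * (g t - g 0)‖ ≤
      ε / 2 * n + 2 * Real.pi * K := by
    calc _ ≤ ∫ t in (-Real.pi)..Real.pi, (ε / (4 * Real.pi) * ‖A n t‖ ^ 2 + K) := by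
          refine intervalIntegral.norm_integral_le_of_norm_le neg_pi_lt_pi.le ?_ hI
          have hae : ∀ᵐ t : ℝ, t ≠ Real.pi := Measure.ae_ne volume Real.pi
          filter_upwards [hae] with t ht ht'
          exact hle t ⟨ht'.1, lt_of_le_of_ne ht'.2 ht⟩
      _ = _ := by
          rw [intervalIntegral.integral_add, intervalIntegral.integral_const_mul, hA2]
          · simp
            field_simp
            ring
          · exact Continuous.intervalIntegrable (by have := cA n; fun_prop) _ _
          · exact intervalIntegrable_const
  have hfin : 2 * Real.pi * K < ε / 2 * n := by
    rw [div_lt_iff₀ (by positivity)] at hN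
    nlinarith
  rw [inv_mul_lt_iff₀ hn0]
  nlinarith

end Fejer

/-! ### Parseval's identity and Fourier series of self-convolutions. -/

section Parseval

/-- Spectral densities are paired with `e^{ikt}` and Fourier coefficients with `e^{-ikt}`, hence the
sign; the factor `2π` undoes the normalisation. -/
lemma trigCoeff_eq_fourierCoeffOn (b : ℝ → ℂ) (k : ℤ) :
    trigCoeff b k = ((2 * Real.pi : ℝ) : ℂ) * fourierCoeffOn neg_pi_lt_pi b (-k) := by
  have hpi : (Real.pi : ℂ) ≠ 0 := by exact_mod_cast Real.pi_pos.ne'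
  rw [fourierCoeffOn_eq_integral, trigCoeff]
  have e : ∀ t : ℝ, (fourier (-(-k)) : C(AddCircle (Real.pi - -Real.pi), ℂ)) (t : AddCircle _) • b t =
      Complex.exp (Complex.I * (k : ℂ) * (t : ℂ)) * b t := fun t => by
    rw [fourier_coe_apply, smul_eq_mul]
    congr 2
    push_cast
    field_simp
    ring
  simp_rw [e]
  rw [Complex.real_smul, ← mul_assoc]
  have : ((2 * Real.pi : ℝ) : ℂ) * ((1 / (Real.pi - -Real.pi) : ℝ) : ℂ) = 1 := by
    push_cast
    field_simp
    ring
  rw [this, one_mul]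

lemma fourierCoeffOn_eq_trigCoeff (b : ℝ → ℂ) (k : ℤ) :
    fourierCoeffOn neg_pi_lt_pi b k = ((2 * Real.pi : ℝ) : ℂ)⁻¹ * trigCoeff b (-k) := by
  have hpi : ((2 * Real.pi : ℝ) : ℂ) ≠ 0 := by
    have := Real.pi_pos
    exact_mod_cast (by positivity : (2 * Real.pi : ℝ) ≠ 0)
  rw [trigCoeff_eq_fourierCoeffOn, neg_neg, inv_mul_cancel_left₀ hpi]

lemma ae_norm_le_of_Ioo {b : ℝ → ℂ} {M : ℝ} (hM : ∀ t ∈ Set.Ioo (-Real.pi) Real.pi, ‖b t‖ ≤ M) :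
    ∀ᵐ t ∂(volume.restrict (Set.Ioc (-Real.pi) Real.pi)), ‖b t‖ ≤ M := by
  rw [ae_restrict_iff' measurableSet_Ioc]
  filter_upwards [Measure.ae_ne volume Real.pi] with t ht ht'
  exact hM t ⟨ht'.1, lt_of_le_of_ne ht'.2 ht⟩

lemma memLp_two_of_bound_Ioo {b : ℝ → ℂ} {M : ℝ}
    (hb : IntervalIntegrable b volume (-Real.pi) Real.pi)
    (hM : ∀ t ∈ Set.Ioo (-Real.pi) Real.pi, ‖b t‖ ≤ M) :
    MemLp b 2 (volume.restrict (Set.Ioc (-Real.pi) Real.pi)) :=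
  MemLp.of_bound hb.1.1 M (ae_norm_le_of_Ioo hM)

/-- Parseval for a bounded function. Applied to a difference of densities, it converts a uniform
bound into an `ℓ²` bound on the difference of correlations. -/
lemma summable_norm_trigCoeff_sq {b : ℝ → ℂ} {M : ℝ}
    (hb : IntervalIntegrable b volume (-Real.pi) Real.pi)
    (hM : ∀ t ∈ Set.Ioo (-Real.pi) Real.pi, ‖b t‖ ≤ M) :
    Summable (fun k => ‖trigCoeff b k‖ ^ 2) ∧
      ∑' k, ‖trigCoeff b k‖ ^ 2 ≤ (2 * Real.pi * M) ^ 2 := by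
  have hpi := Real.pi_pos
  have h := hasSum_sq_fourierCoeffOn neg_pi_lt_pi (memLp_two_of_bound_Ioo hb hM)
  have h2 := ((Equiv.neg ℤ).hasSum_iff.2 h).mul_left ((2 * Real.pi) ^ 2)
  have e : ∀ k, (2 * Real.pi) ^ 2 * ((fun i => ‖fourierCoeffOn neg_pi_lt_pi b i‖ ^ 2) ∘
      (Equiv.neg ℤ)) k = ‖trigCoeff b k‖ ^ 2 := fun k => by
    rw [trigCoeff_eq_fourierCoeffOn, norm_mul, Complex.norm_real, Real.norm_of_nonneg (by positivity)]
    simp [mul_pow]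
  simp_rw [e] at h2
  refine ⟨h2.summable, h2.tsum_eq.trans_le ?_⟩
  have h3 : ∫ x in (-Real.pi)..Real.pi, ‖b x‖ ^ 2 ≤ M ^ 2 * |Real.pi - -Real.pi| := by
    refine (le_abs_self _).trans ?_
    rw [← Real.norm_eq_abs]
    refine intervalIntegral.norm_integral_le_of_norm_le_const_ae ?_
    filter_upwards [Measure.ae_ne volume Real.pi] with t ht ht'
    rw [Set.uIoc_of_le neg_pi_lt_pi.le] at ht'
    rw [norm_pow, norm_norm]
    gcongr
    exact hM t ⟨ht'.1, lt_of_le_of_ne ht'.2 ht⟩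
  rw [abs_of_pos (by linarith)] at h3
  rw [smul_eq_mul, show Real.pi - -Real.pi = 2 * Real.pi by ring] at *
  calc (2 * Real.pi) ^ 2 * ((2 * Real.pi)⁻¹ * ∫ x in (-Real.pi)..Real.pi, ‖b x‖ ^ 2)
      = (2 * Real.pi) * ∫ x in (-Real.pi)..Real.pi, ‖b x‖ ^ 2 := by field_simp
    _ ≤ (2 * Real.pi) * (M ^ 2 * (2 * Real.pi)) := by gcongr
    _ = _ := by ring

/-- Parseval's identity for a pair of square integrable functions. -/
lemma hasSum_conj_fourierCoeffOn_mul {a b : ℝ} {f g : ℝ → ℂ} (hab : a < b)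
    (hf : MemLp f 2 (volume.restrict (Set.Ioc a b)))
    (hg : MemLp g 2 (volume.restrict (Set.Ioc a b))) :
    HasSum (fun i => (starRingEnd ℂ) (fourierCoeffOn hab f i) * fourierCoeffOn hab g i)
      ((b - a)⁻¹ • ∫ x in a..b, (starRingEnd ℂ) (f x) * g x) := by
  have := Fact.mk (by linarith : 0 < b - a)
  rw [← add_sub_cancel a b] at hf hg
  have hf' := hf.memLp_liftIoc.haarAddCircle
  have hg' := hg.memLp_liftIoc.haarAddCircle
  have h := fourierBasis.hasSum_inner_mul_inner hf'.toLp hg'.toLp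
  have hval : (b - a)⁻¹ • ∫ x in a..b, (starRingEnd ℂ) (f x) * g x =
      inner ℂ hf'.toLp hg'.toLp := by
    rw [L2.inner_def]
    nth_rw 2 [← add_sub_cancel a b]
    rw [← AddCircle.integral_liftIoc_eq_intervalIntegral, ← AddCircle.integral_haarAddCircle]
    apply integral_congr_ae
    filter_upwards [hf'.coeFn_toLp, hg'.coeFn_toLp] with x h1 h2
    rw [h1, h2, RCLike.inner_apply']
    rfl
  have hcoef : ∀ {u : ℝ → ℂ} (hu : MemLp (AddCircle.liftIoc (b - a) a u) 2
      (AddCircle.haarAddCircle (T := b - a))) (i : ℤ),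
      inner ℂ (fourierBasis i) hu.toLp = fourierCoeffOn hab u i := fun {u} hu i => by
    rw [← fourierBasis.repr_apply_apply, fourierBasis_repr, fourierCoeff_congr_ae hu.coeFn_toLp,
      fourierCoeff_liftIoc_eq]
    simp
  rw [hval]
  refine h.congr_fun fun i => ?_
  rw [hcoef hg' i, ← hcoef hf' i, inner_conj_symm]

lemma intervalIntegral_conj (f : ℝ → ℂ) (a b : ℝ) :
    ∫ x in a..b, (starRingEnd ℂ) (f x) = (starRingEnd ℂ) (∫ x in a..b, f x) := by
  rw [intervalIntegral, intervalIntegral, map_sub, integral_conj, integral_conj]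

variable {g : ℝ → ℂ} {C : ℝ}

lemma intervalIntegrable_of_periodic (hp : Function.Periodic g (2 * Real.pi))
    (hg : IntervalIntegrable g volume (-Real.pi) Real.pi) (x y : ℝ) :
    IntervalIntegrable g volume x y := by
  refine hp.intervalIntegrable (by have := Real.pi_pos; positivity) (t := -Real.pi) ?_ x y
  convert hg using 1
  ring

/-- The bound `C` is known only on the open period, so the value at the endpoint `π` enters
separately. -/
lemma norm_le_of_periodic (hp : Function.Periodic g (2 * Real.pi))
    (hC : ∀ t ∈ Set.Ioo (-Real.pi) Real.pi, ‖g t‖ ≤ C) (t : ℝ) : ‖g t‖ ≤ max C ‖g Real.pi‖ := by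
  obtain ⟨y, hy, hyt⟩ := hp.exists_mem_Ioc (by have := Real.pi_pos; positivity) t (-Real.pi)
  rw [hyt]
  rcases eq_or_ne y Real.pi with h | h
  · rw [h]
    exact le_max_right _ _
  · refine (hC y ⟨hy.1, lt_of_le_of_ne ?_ h⟩).trans (le_max_left _ _)
    have := hy.2
    linarith

lemma integral_cexp_mul_comp_sub (hp : Function.Periodic g (2 * Real.pi)) (n : ℤ) (t : ℝ) :
    ∫ s in (-Real.pi)..Real.pi, Complex.exp (Complex.I * (n : ℂ) * (s : ℂ)) * g (t - s) =
      Complex.exp (Complex.I * (n : ℂ) * (t : ℂ)) * trigCoeff g (-n) := by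
  have e : ∀ s : ℝ, Complex.exp (Complex.I * (n : ℂ) * (s : ℂ)) * g (t - s) =
      (fun r : ℝ => Complex.exp (Complex.I * (n : ℂ) * (t : ℂ)) *
        (Complex.exp (Complex.I * ((-n : ℤ) : ℂ) * (r : ℂ)) * g r)) (t - s) := fun s => by
    beta_reduce
    rw [← mul_assoc, ← Complex.exp_add]
    congr 2
    push_cast
    ring
  simp_rw [e]
  rw [intervalIntegral.integral_comp_sub_left (fun r : ℝ =>
    Complex.exp (Complex.I * (n : ℂ) * (t : ℂ)) *
        (Complex.exp (Complex.I * ((-n : ℤ) : ℂ) * (r : ℂ)) * g r)) t,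
    intervalIntegral.integral_const_mul, trigCoeff]
  congr 1
  have hper : Function.Periodic (fun r : ℝ => Complex.exp (Complex.I * ((-n : ℤ) : ℂ) * (r : ℂ)) * g r)
      (2 * Real.pi) := fun r => by
    beta_reduce
    rw [hp r]
    congr 1
    rw [Complex.exp_eq_exp_iff_exists_int]
    refine ⟨-n, ?_⟩
    push_cast
    ring
  have := hper.intervalIntegral_add_eq (t - Real.pi) (-Real.pi)
  rw [show t - -Real.pi = t - Real.pi + 2 * Real.pi by ring, this]
  congr 1
  ring

/-- Parseval for the pair `s ↦ conj (g (t - s))` and `g`. The expansion holds at every point `t`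
with no regularity of `g`, whereas the Fourier series of `g` itself need not converge; hence the
separate treatment of `l = 1`. -/
lemma hasSum_selfConv_two (hp : Function.Periodic g (2 * Real.pi))
    (hg : IntervalIntegrable g volume (-Real.pi) Real.pi) (hC : ∀ t, ‖g t‖ ≤ C) (t : ℝ) :
    HasSum (fun k : ℤ => ((2 * Real.pi : ℝ) : ℂ)⁻¹ * trigCoeff g k ^ 2 *
      Complex.exp (-(Complex.I * (k : ℂ) * (t : ℂ)))) (selfConv g 2 t) := by
  have hpi := Real.pi_pos
  have hpi0 : ((2 * Real.pi : ℝ) : ℂ) ≠ 0 := by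
    exact_mod_cast (by positivity : (2 * Real.pi : ℝ) ≠ 0)
  have hint : IntervalIntegrable (fun s => (starRingEnd ℂ) (g (t - s))) volume
      (-Real.pi) Real.pi := by
    have h1 := (intervalIntegrable_of_periodic hp hg (t - -Real.pi) (t - Real.pi)).comp_sub_left t
    simp only [sub_sub_cancel] at h1
    exact ⟨Complex.conjCLE.toContinuousLinearMap.integrable_comp h1.1,
      Complex.conjCLE.toContinuousLinearMap.integrable_comp h1.2⟩
  have hF := memLp_two_of_bound_Ioo (M := C) hint fun s _ => by
    rw [RCLike.norm_conj]; exact hC _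
  have hG := memLp_two_of_bound_Ioo (M := C) hg fun s _ => hC s
  have h := hasSum_conj_fourierCoeffOn_mul neg_pi_lt_pi hF hG
  have hcoef : ∀ n : ℤ, (starRingEnd ℂ) (fourierCoeffOn neg_pi_lt_pi
      (fun s => (starRingEnd ℂ) (g (t - s))) n) = ((2 * Real.pi : ℝ) : ℂ)⁻¹ *
        (Complex.exp (Complex.I * (n : ℂ) * (t : ℂ)) * trigCoeff g (-n)) := fun n => by
    rw [fourierCoeffOn_eq_trigCoeff, map_mul, map_inv₀, Complex.conj_ofReal, trigCoeff,
      ← intervalIntegral_conj, ← integral_cexp_mul_comp_sub hp]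
    congr 1
    refine intervalIntegral.integral_congr fun s _ => ?_
    simp only [map_mul, ← Complex.exp_conj, Complex.conj_conj, Complex.conj_I, Complex.conj_ofReal]
    congr 2
    push_cast
    simp
  simp_rw [hcoef, fourierCoeffOn_eq_trigCoeff] at h
  have h2 := ((Equiv.neg ℤ).hasSum_iff.2 h).mul_left ((2 * Real.pi : ℝ) : ℂ)
  have hval : ((2 * Real.pi : ℝ) : ℂ) * ((Real.pi - -Real.pi)⁻¹ •
      ∫ s in (-Real.pi)..Real.pi, (starRingEnd ℂ) ((starRingEnd ℂ) (g (t - s))) * g s) =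
      selfConv g 2 t := by
    rw [Complex.real_smul, ← mul_assoc, show Real.pi - -Real.pi = 2 * Real.pi by ring,
      Complex.ofReal_inv, mul_inv_cancel₀ hpi0, one_mul]
    simp only [Complex.conj_conj]
    rfl
  rw [hval] at h2
  refine h2.congr_fun fun k => ?_
  simp only [Function.comp_apply, Equiv.neg_apply, neg_neg]
  push_cast
  rw [show Complex.I * -(k : ℂ) * (t : ℂ) = -(Complex.I * (k : ℂ) * (t : ℂ)) by ring]
  push_cast at hpi0
  field_simp

lemma norm_trigCoeff_le (hC : ∀ t, ‖g t‖ ≤ C) (k : ℤ) : ‖trigCoeff g k‖ ≤ C * (2 * Real.pi) := by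
  have := intervalIntegral.norm_integral_le_of_norm_le_const (a := -Real.pi) (b := Real.pi) (C := C)
    (f := fun t => Complex.exp (Complex.I * (k : ℂ) * (t : ℂ)) * g t) fun t _ => by
      rw [norm_mul, norm_cexp_I_mul_int, one_mul]
      exact hC t
  have hpi := Real.pi_pos
  rwa [show Real.pi - -Real.pi = 2 * Real.pi by ring, abs_of_pos (by positivity)] at this

lemma summable_norm_trigCoeff_pow (hg : IntervalIntegrable g volume (-Real.pi) Real.pi)
    (hC : ∀ t, ‖g t‖ ≤ C) (l : ℕ) : Summable fun k => ‖trigCoeff g k‖ ^ (l + 2) := by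
  have h := (summable_norm_trigCoeff_sq hg fun t _ => hC t).1.mul_left ((C * (2 * Real.pi)) ^ l)
  refine Summable.of_nonneg_of_le (fun k => by positivity) (fun k => ?_) h
  rw [pow_add]
  gcongr
  exact norm_trigCoeff_le hC k

/-- Fourier expansion of iterated self-convolutions. -/
theorem hasSum_selfConv (hp : Function.Periodic g (2 * Real.pi))
    (hg : IntervalIntegrable g volume (-Real.pi) Real.pi) (hC : ∀ t, ‖g t‖ ≤ C) (l : ℕ) (t : ℝ) :
    HasSum (fun k : ℤ => ((2 * Real.pi : ℝ) : ℂ)⁻¹ * trigCoeff g k ^ (l + 2) *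
      Complex.exp (-(Complex.I * (k : ℂ) * (t : ℂ)))) (selfConv g (l + 2) t) := by
  induction l generalizing t with
  | zero => exact hasSum_selfConv_two hp hg hC t
  | succ l ih =>
    have hpi := Real.pi_pos
    have hC0 : 0 ≤ C := (norm_nonneg _).trans (hC 0)
    set T : ℤ → ℝ → ℂ := fun k s => ((2 * Real.pi : ℝ) : ℂ)⁻¹ * trigCoeff g k ^ (l + 2) *
      Complex.exp (-(Complex.I * (k : ℂ) * ((t - s : ℝ) : ℂ))) * g s with hT
    have hT' : ∀ k s, T k s = (((2 * Real.pi : ℝ) : ℂ)⁻¹ * trigCoeff g k ^ (l + 2) *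
        Complex.exp (-(Complex.I * (k : ℂ) * (t : ℂ)))) *
          (Complex.exp (Complex.I * (k : ℂ) * (s : ℂ)) * g s) := fun k s => by
      simp only [hT]
      rw [show -(Complex.I * (k : ℂ) * ((t - s : ℝ) : ℂ)) =
        -(Complex.I * (k : ℂ) * (t : ℂ)) + Complex.I * (k : ℂ) * (s : ℂ) by push_cast; ring,
        Complex.exp_add]
      ring
    have nexp : ∀ (k : ℤ) (s : ℝ), ‖Complex.exp (-(Complex.I * (k : ℂ) * (s : ℂ)))‖ = 1 :=
      fun k s => by
        have := norm_cexp_I_mul_int (-k) s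
        rw [← this]
        congr 2
        push_cast
        ring
    have key : HasSum (fun k => ∫ s in (-Real.pi)..Real.pi, T k s)
        (∫ s in (-Real.pi)..Real.pi, selfConv g (l + 2) (t - s) * g s) := by
      refine intervalIntegral.hasSum_integral_of_dominated_convergence
        (fun k _ => (2 * Real.pi)⁻¹ * ‖trigCoeff g k‖ ^ (l + 2) * C) (fun k => ?_) (fun k => ?_) ?_ ?_ ?_
      · simp_rw [funext (hT' k)]
        exact (intervalIntegrable_iff.1 ((intervalIntegrable_cexp_mul hg k).const_mul _)).1
      · refine ae_of_all _ fun s _ => ?_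
        simp only [hT]
        rw [norm_mul, norm_mul, norm_mul, norm_pow, norm_inv, Complex.norm_real, nexp, mul_one,
          Real.norm_of_nonneg (by positivity)]
        gcongr
        exact hC s
      · exact ae_of_all _ fun s _ =>
          ((summable_norm_trigCoeff_pow hg hC l).mul_left _).mul_right _
      · exact intervalIntegrable_const
      · exact ae_of_all _ fun s _ => (ih (t - s)).mul_right (g s)
    refine key.congr_fun fun k => ?_
    simp_rw [hT']
    rw [intervalIntegral.integral_const_mul, ← trigCoeff]
    ring

lemma hasSum_trigCoeff_pow (hp : Function.Periodic g (2 * Real.pi))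
    (hg : IntervalIntegrable g volume (-Real.pi) Real.pi) (hC : ∀ t, ‖g t‖ ≤ C) (l : ℕ) :
    HasSum (fun k : ℤ => trigCoeff g k ^ (l + 2))
      (((2 * Real.pi : ℝ) : ℂ) * selfConv g (l + 2) 0) := by
  have hpi := Real.pi_pos
  have hpi0 : ((2 * Real.pi : ℝ) : ℂ) ≠ 0 := by
    exact_mod_cast (by positivity : (2 * Real.pi : ℝ) ≠ 0)
  refine ((hasSum_selfConv hp hg hC l 0).mul_left ((2 * Real.pi : ℝ) : ℂ)).congr_fun fun k => ?_
  rw [Complex.ofReal_zero, mul_zero, neg_zero, Complex.exp_zero, mul_one, ← mul_assoc,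
    mul_inv_cancel₀ hpi0, one_mul]

end Parseval

/-! ### Averages over pairs of times of powers of the correlations. -/

section LagAverage

/-- The normalised sum `n⁻¹ ∑_{1 ≤ i, k ≤ n} x (k - i)`. -/
noncomputable def lagAverage (x : ℤ → ℂ) (n : ℕ) : ℂ :=
  (n : ℂ)⁻¹ * ∑ i ∈ Finset.Icc 1 n, ∑ k ∈ Finset.Icc 1 n, x ((k : ℤ) - (i : ℤ))

lemma lagAverage_sub (x y : ℤ → ℂ) (n : ℕ) :
    lagAverage x n - lagAverage y n = lagAverage (fun k => x k - y k) n := by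
  simp only [lagAverage, Finset.sum_sub_distrib, mul_sub]

lemma norm_lagAverage_le_tsum {x : ℤ → ℂ} {p : ℤ → ℝ} (hx : ∀ k, ‖x k‖ ≤ p k) (hp : Summable p)
    (n : ℕ) : ‖lagAverage x n‖ ≤ ∑' k, p k := by
  have hp0 : ∀ k, 0 ≤ p k := fun k => (norm_nonneg _).trans (hx k)
  have hinj : ∀ i : ℕ, Function.Injective fun k : ℕ => (k : ℤ) - (i : ℤ) := fun i a b hab => by
    simpa using hab
  have h1 : ‖∑ i ∈ Finset.Icc 1 n, ∑ k ∈ Finset.Icc 1 n, x ((k : ℤ) - (i : ℤ))‖ ≤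
      ∑ i ∈ Finset.Icc 1 n, ∑' k, p k := by
    refine norm_sum_le_of_le _ fun i _ => ?_
    calc ‖∑ k ∈ Finset.Icc 1 n, x ((k : ℤ) - (i : ℤ))‖
        ≤ ∑ k ∈ Finset.Icc 1 n, p ((k : ℤ) - (i : ℤ)) := norm_sum_le_of_le _ fun k _ => hx _
      _ ≤ ∑' k : ℕ, p ((k : ℤ) - (i : ℤ)) :=
          (hp.comp_injective (hinj i)).sum_le_tsum _ fun k _ => hp0 _
      _ ≤ ∑' k, p k := tsum_comp_le_tsum_of_inj hp hp0 (hinj i)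
  rw [Finset.sum_const, Nat.card_Icc, Nat.add_sub_cancel, nsmul_eq_mul] at h1
  rw [lagAverage, norm_mul, norm_inv, Complex.norm_natCast]
  rcases n.eq_zero_or_pos with rfl | hn
  · simpa using tsum_nonneg hp0
  · have hn' : (0 : ℝ) < n := by exact_mod_cast hn
    rw [inv_mul_le_iff₀ hn']
    exact h1

/-- Averages over all pairs of a summable function of the lag converge to its sum. -/
lemma tendsto_lagAverage_of_summable {x : ℤ → ℂ} (hx : Summable fun k => ‖x k‖) :
    Tendsto (lagAverage x) atTop (𝓝 (∑' k, x k)) := by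
  have hpi := Real.pi_pos
  have hpi0 : ((2 * Real.pi : ℝ) : ℂ) ≠ 0 := by
    exact_mod_cast (by positivity : (2 * Real.pi : ℝ) ≠ 0)
  -- Realise `x` as the coefficients of the continuous function `G = ∑' m, T m`. The lag averages of
  -- `x` are then Fejér means of `G`, and `2π G(0)` is the sum of `x`.
  set T : ℤ → ℝ → ℂ := fun m t =>
    ((2 * Real.pi : ℝ) : ℂ)⁻¹ * x m * Complex.exp (Complex.I * ((-m : ℤ) : ℂ) * (t : ℂ)) with hT
  have nT : ∀ m t, ‖T m t‖ = (2 * Real.pi)⁻¹ * ‖x m‖ := fun m t => by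
    simp only [hT]
    rw [norm_mul, norm_cexp_I_mul_int, mul_one, norm_mul, norm_inv, Complex.norm_real,
      Real.norm_of_nonneg (by positivity)]
  have cT : ∀ m, Continuous (T m) := fun m => by fun_prop
  have hs := hx.mul_left (2 * Real.pi)⁻¹
  have hsT : ∀ t, Summable fun m => T m t := fun t => by
    refine Summable.of_norm ?_
    simpa only [nT] using hs
  set G : ℝ → ℂ := fun t => ∑' m, T m t with hG
  have cG : Continuous G := continuous_tsum cT hs fun m t => (nT m t).le
  have bG : ∀ t, ‖G t‖ ≤ ∑' m, (2 * Real.pi)⁻¹ * ‖x m‖ := fun t =>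
    tsum_of_norm_bounded hs.hasSum fun m => (nT m t).le
  have hcoef : ∀ k, trigCoeff G k = x k := fun k => by
    have key : HasSum (fun m => ∫ t in (-Real.pi)..Real.pi,
        Complex.exp (Complex.I * (k : ℂ) * (t : ℂ)) * T m t)
        (∫ t in (-Real.pi)..Real.pi, Complex.exp (Complex.I * (k : ℂ) * (t : ℂ)) * G t) := by
      refine intervalIntegral.hasSum_integral_of_dominated_convergence
        (fun m _ => (2 * Real.pi)⁻¹ * ‖x m‖) (fun m => ?_) (fun m => ?_) ?_ ?_ ?_
      · exact Continuous.aestronglyMeasurable (by fun_prop)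
      · refine ae_of_all _ fun t _ => ?_
        rw [norm_mul, norm_cexp_I_mul_int, one_mul, nT]
      · exact ae_of_all _ fun t _ => hs
      · exact intervalIntegrable_const
      · exact ae_of_all _ fun t _ => (hsT t).hasSum.mul_left _
    have e : ∀ m, ∫ t in (-Real.pi)..Real.pi,
        Complex.exp (Complex.I * (k : ℂ) * (t : ℂ)) * T m t = if m = k then x k else 0 := fun m => by
      have e1 : ∀ t : ℝ, Complex.exp (Complex.I * (k : ℂ) * (t : ℂ)) * T m t =
          ((2 * Real.pi : ℝ) : ℂ)⁻¹ * x m *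
            (Complex.exp (Complex.I * ((k - m : ℤ) : ℂ) * (t : ℂ)) * 1) := fun t => by
        simp only [hT]
        rw [show Complex.I * ((k - m : ℤ) : ℂ) * (t : ℂ) = Complex.I * (k : ℂ) * (t : ℂ) +
          Complex.I * ((-m : ℤ) : ℂ) * (t : ℂ) by push_cast; ring, Complex.exp_add]
        ring
      simp_rw [e1]
      rw [intervalIntegral.integral_const_mul]
      have := trigCoeff_one (k - m)
      rw [trigCoeff] at this
      rw [this]
      by_cases hmk : m = k
      · subst hmk
        rw [sub_self, if_pos rfl, if_pos rfl]
        field_simp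
      · rw [if_neg (by omega), if_neg hmk, mul_zero]
    simp_rw [e] at key
    exact key.unique (hasSum_ite_eq k (x k))
  have hG0 : ((2 * Real.pi : ℝ) : ℂ) * G 0 = ∑' k, x k := by
    simp only [hG, hT]
    rw [← tsum_mul_left]
    refine tsum_congr fun k => ?_
    rw [Complex.ofReal_zero, mul_zero, Complex.exp_zero, mul_one, mul_inv_cancel_left₀ hpi0]
  have := tendsto_fejer (cG.intervalIntegrable _ _) (fun t _ => bG t) cG.continuousAt
  simp_rw [hcoef] at this
  rwa [hG0] at this

/-- The factor `‖x‖ + ‖y‖` is kept instead of being absorbed in `R`: the resulting product of two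
square summable quantities can be summed over all lags. -/
lemma norm_pow_sub_pow_le_mul {x y : ℂ} {R : ℝ} (hx : ‖x‖ ≤ R) (hy : ‖y‖ ≤ R) (l : ℕ) :
    ‖x ^ (l + 2) - y ^ (l + 2)‖ ≤ (l + 2) * R ^ l * (‖x - y‖ * (‖x‖ + ‖y‖)) := by
  have hR : 0 ≤ R := (norm_nonneg _).trans hx
  induction l with
  | zero =>
    rw [show x ^ (0 + 2) - y ^ (0 + 2) = (x - y) * (x + y) by ring, norm_mul]
    have h1 := mul_le_mul_of_nonneg_left (norm_add_le x y) (norm_nonneg (x - y))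
    have h2 : 0 ≤ ‖x - y‖ * (‖x‖ + ‖y‖) := by positivity
    simp only [Nat.cast_zero, zero_add, pow_zero, mul_one]
    linarith
  | succ l ih =>
    have e : x ^ (l + 1 + 2) - y ^ (l + 1 + 2) =
        x * (x ^ (l + 2) - y ^ (l + 2)) + (x - y) * (y ^ (l + 1) * y) := by ring
    rw [e]
    refine (norm_add_le _ _).trans ?_
    rw [norm_mul, norm_mul (x - y), norm_mul (y ^ (l + 1)), norm_pow y]
    calc _ ≤ R * ((l + 2) * R ^ l * (‖x - y‖ * (‖x‖ + ‖y‖))) +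
          ‖x - y‖ * (R ^ (l + 1) * (‖x‖ + ‖y‖)) := by
          gcongr
          linarith [norm_nonneg x]
      _ = _ := by
          push_cast
          ring

/-- The product `‖x - y‖ (‖x‖ + ‖y‖)` is split by Young's inequality with weight `δ`. As the squared
`ℓ²` distance is at most `D δ²`, both halves are of order `δ` after summation. -/
lemma norm_lagAverage_pow_sub_le {x y : ℤ → ℂ} {R : ℝ} (hx : ∀ k, ‖x k‖ ≤ R)
    (hy : ∀ k, ‖y k‖ ≤ R) {A D δ : ℝ} (hδ : 0 < δ)
    (hxs : Summable fun k => ‖x k‖ ^ 2) (hys : Summable fun k => ‖y k‖ ^ 2)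
    (hds : Summable fun k => ‖x k - y k‖ ^ 2)
    (hxA : ∑' k, ‖x k‖ ^ 2 ≤ A) (hyA : ∑' k, ‖y k‖ ^ 2 ≤ A)
    (hD : ∑' k, ‖x k - y k‖ ^ 2 ≤ D * δ ^ 2) (l n : ℕ) :
    ‖lagAverage (fun k => x k ^ (l + 2)) n - lagAverage (fun k => y k ^ (l + 2)) n‖ ≤
      (l + 2) * R ^ l * ((D + 2 * A) * δ) := by
  have hR : 0 ≤ R := (norm_nonneg _).trans (hx 0)
  have hb : ∀ k, ‖x k ^ (l + 2) - y k ^ (l + 2)‖ ≤ (l + 2) * R ^ l *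
      (δ⁻¹ * ‖x k - y k‖ ^ 2 + δ * (‖x k‖ ^ 2 + ‖y k‖ ^ 2)) := fun k => by
    refine (norm_pow_sub_pow_le_mul (hx k) (hy k) l).trans ?_
    gcongr
    have h1 := sq_nonneg (2 * ‖x k - y k‖ - δ * (‖x k‖ + ‖y k‖))
    have h2 := sq_nonneg (‖x k‖ - ‖y k‖)
    have h3 := sq_nonneg ‖x k - y k‖
    rw [← sub_nonneg]
    have : δ⁻¹ * ‖x k - y k‖ ^ 2 + δ * (‖x k‖ ^ 2 + ‖y k‖ ^ 2) - ‖x k - y k‖ * (‖x k‖ + ‖y k‖) =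
        δ⁻¹ * ((2 * ‖x k - y k‖ - δ * (‖x k‖ + ‖y k‖)) ^ 2 / 4) +
          δ * ((‖x k‖ - ‖y k‖) ^ 2 / 4 + (‖x k‖ ^ 2 + ‖y k‖ ^ 2) / 2) := by
      field_simp
      ring
    rw [this]
    positivity
  have hs : Summable fun k => (l + 2 : ℝ) * R ^ l *
      (δ⁻¹ * ‖x k - y k‖ ^ 2 + δ * (‖x k‖ ^ 2 + ‖y k‖ ^ 2)) :=
    ((hds.mul_left _).add ((hxs.add hys).mul_left _)).mul_left _
  rw [lagAverage_sub]
  refine (norm_lagAverage_le_tsum hb hs n).trans ?_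
  rw [tsum_mul_left, (hds.mul_left _).tsum_add ((hxs.add hys).mul_left _), tsum_mul_left,
    tsum_mul_left, hxs.tsum_add hys]
  gcongr
  calc δ⁻¹ * ∑' k, ‖x k - y k‖ ^ 2 + δ * (∑' k, ‖x k‖ ^ 2 + ∑' k, ‖y k‖ ^ 2)
      ≤ δ⁻¹ * (D * δ ^ 2) + δ * (A + A) := by gcongr
    _ = _ := by field_simp; ring

/-- A second-order bound for the averaged powers of Fourier coefficients of modulus at most one. -/
lemma norm_lagAverage_trigCoeff_pow_le {b : ℝ → ℂ} {M : ℝ}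
    (hb : IntervalIntegrable b volume (-Real.pi) Real.pi)
    (hM : ∀ t ∈ Set.Ioo (-Real.pi) Real.pi, ‖b t‖ ≤ M) (h1 : ∀ k, ‖trigCoeff b k‖ ≤ 1)
    {l : ℕ} (hl : 1 ≤ l) (n : ℕ) :
    ‖lagAverage (fun k => trigCoeff b k ^ l) n‖ ≤ 2 * Real.pi * M + (2 * Real.pi * M) ^ 2 := by
  have hpi := Real.pi_pos
  have hM0 : 0 ≤ M := (norm_nonneg _).trans (hM 0 ⟨by linarith, hpi⟩)
  -- For `l = 1` the coefficients need not be summable and the bounded Toeplitz form is used; for `l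
  -- ≥ 2` moduli at most one give `|b̂|^l ≤ |b̂|²`. The resulting bound is free of `l` and `n`.
  rcases hl.eq_or_lt with rfl | hl
  · simp only [pow_one]
    have h := norm_sum_sum_mul_trigCoeff_le (Finset.Icc 1 n) (fun _ => 1) (fun _ => 1) hb hM
    simp only [mul_one, Complex.ofReal_one, one_mul, one_pow, Finset.sum_const, Nat.card_Icc,
      Nat.add_sub_cancel, nsmul_eq_mul] at h
    have h2 : ‖lagAverage (trigCoeff b) n‖ ≤ 2 * Real.pi * M := by
      rw [lagAverage, norm_mul, norm_inv, Complex.norm_natCast]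
      rcases n.eq_zero_or_pos with rfl | hn
      · simp only [CharP.cast_eq_zero, inv_zero, zero_mul]
        positivity
      · have hn' : (0 : ℝ) < n := by exact_mod_cast hn
        rw [inv_mul_le_iff₀ hn']
        linarith
    have : 0 ≤ (2 * Real.pi * M) ^ 2 := sq_nonneg _
    exact h2.trans (by linarith)
  · obtain ⟨hs, hle⟩ := summable_norm_trigCoeff_sq hb hM
    refine (norm_lagAverage_le_tsum (fun k => ?_) hs n).trans (hle.trans ?_)
    · rw [norm_pow]
      exact pow_le_pow_of_le_one (norm_nonneg _) (h1 k) hl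
    · have : 0 ≤ 2 * Real.pi * M := by positivity
      linarith

variable {f : ℕ → ℝ → ℂ} {g : ℝ → ℂ} {u : ℕ → ℝ} {C : ℝ}

/-- Measurability of `g` is not given; it is inherited almost everywhere from the densities
converging to it. -/
lemma intervalIntegrable_of_uniform_limit
    (hf : ∀ J, IntervalIntegrable (f J) volume (-Real.pi) Real.pi)
    (hu : Tendsto u atTop (𝓝 0))
    (hfg : ∀ J, ∀ t ∈ Set.Ioo (-Real.pi) Real.pi, ‖f J t - g t‖ ≤ u J)
    (hC : ∀ t ∈ Set.Ioo (-Real.pi) Real.pi, ‖g t‖ ≤ C) :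
    IntervalIntegrable g volume (-Real.pi) Real.pi := by
  rw [intervalIntegrable_iff_integrableOn_Ioc_of_le neg_pi_lt_pi.le]
  refine Integrable.of_bound ?_ C (ae_norm_le_of_Ioo hC)
  refine aestronglyMeasurable_of_tendsto_ae atTop (f := f) (fun J => (hf J).1.1) ?_
  rw [ae_restrict_iff' measurableSet_Ioc]
  filter_upwards [Measure.ae_ne volume Real.pi] with t ht ht'
  have hmem : t ∈ Set.Ioo (-Real.pi) Real.pi := ⟨ht'.1, lt_of_le_of_ne ht'.2 ht⟩
  rw [tendsto_iff_norm_sub_tendsto_zero]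
  exact squeeze_zero (fun _ => norm_nonneg _) (fun J => hfg J t hmem) hu

lemma trigCoeff_sub {a b : ℝ → ℂ} (ha : IntervalIntegrable a volume (-Real.pi) Real.pi)
    (hb : IntervalIntegrable b volume (-Real.pi) Real.pi) (k : ℤ) :
    trigCoeff a k - trigCoeff b k = trigCoeff (fun t => a t - b t) k := by
  unfold trigCoeff
  rw [← intervalIntegral.integral_sub (intervalIntegrable_cexp_mul ha k)
    (intervalIntegrable_cexp_mul hb k)]
  simp only [mul_sub]

/-- Averaged powers of correlations converge to the values at the origin of the iterated
self-convolutions of the limiting spectral density. -/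
theorem tendsto_lagAverage_trigCoeff_pow
    (hf : ∀ J, IntervalIntegrable (f J) volume (-Real.pi) Real.pi)
    (hp : Function.Periodic g (2 * Real.pi))
    (hC : ∀ t ∈ Set.Ioo (-Real.pi) Real.pi, ‖g t‖ ≤ C) (hc : ContinuousAt g 0)
    (hua : Antitone u) (hu : Tendsto u atTop (𝓝 0))
    (hfg : ∀ J, ∀ t ∈ Set.Ioo (-Real.pi) Real.pi, ‖f J t - g t‖ ≤ u J)
    (h1 : ∀ J k, ‖trigCoeff (f J) k‖ ≤ 1)
    {n : ℕ → ℕ} (hn : Tendsto n atTop atTop) {l : ℕ} (hl : 1 ≤ l) :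
    Tendsto (fun J => lagAverage (fun k => trigCoeff (f J) k ^ l) (n J)) atTop
      (𝓝 (((2 * Real.pi : ℝ) : ℂ) * selfConv g l 0)) := by
  have hpi := Real.pi_pos
  have h0mem : (0 : ℝ) ∈ Set.Ioo (-Real.pi) Real.pi := ⟨by linarith, hpi⟩
  have hu0 : ∀ J, 0 ≤ u J := fun J => (norm_nonneg _).trans (hfg J 0 h0mem)
  have hgi := intervalIntegrable_of_uniform_limit hf hu hfg hC
  suffices hlim : Tendsto (lagAverage fun k => trigCoeff g k ^ l) atTop
      (𝓝 (((2 * Real.pi : ℝ) : ℂ) * selfConv g l 0)) ∧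
      Tendsto (fun J => lagAverage (fun k => trigCoeff (f J) k ^ l) (n J) -
        lagAverage (fun k => trigCoeff g k ^ l) (n J)) atTop (𝓝 0) by
    have := hlim.2.add (hlim.1.comp hn)
    simpa using this
  -- First order: Fejér at the continuity point `0`, with the Toeplitz bound for `f J - g`. Higher
  -- orders: absolute summability, with the `ℓ²` comparison.
  rcases hl.eq_or_lt with rfl | hl
  · refine ⟨by simp only [pow_one]; exact tendsto_fejer hgi hC hc, ?_⟩
    refine squeeze_zero_norm (a := fun J => 2 * Real.pi * u J) (fun J => ?_)
      (by simpa using hu.const_mul (2 * Real.pi))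
    simp only [pow_one]
    rw [lagAverage_sub]
    simp_rw [trigCoeff_sub (hf J) hgi]
    have h := norm_sum_sum_mul_trigCoeff_le (Finset.Icc 1 (n J)) (fun _ => 1) (fun _ => 1)
      ((hf J).sub hgi) (hfg J)
    simp only [mul_one, Complex.ofReal_one, one_mul, one_pow, Finset.sum_const, Nat.card_Icc,
      Nat.add_sub_cancel, nsmul_eq_mul] at h
    rw [lagAverage, norm_mul, norm_inv, Complex.norm_natCast]
    rcases (n J).eq_zero_or_pos with h0 | hn
    · rw [h0]
      simp only [CharP.cast_eq_zero, inv_zero, zero_mul]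
      have := hu0 J
      positivity
    · have hn' : (0 : ℝ) < n J := by exact_mod_cast hn
      rw [inv_mul_le_iff₀ hn']
      linarith
  · obtain ⟨m, rfl⟩ : ∃ m, l = m + 2 := ⟨l - 2, by omega⟩
    have hgC := norm_le_of_periodic hp hC
    set C' := max C ‖g Real.pi‖ with hC'
    have hsum := hasSum_trigCoeff_pow hp hgi hgC m
    constructor
    · rw [← hsum.tsum_eq]
      refine tendsto_lagAverage_of_summable ?_
      simpa only [norm_pow] using summable_norm_trigCoeff_pow hgi hgC m
    · set M := C' + u 0
      have hC0 : 0 ≤ C' := (norm_nonneg _).trans (hgC 0)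
      have hfM : ∀ J, ∀ t ∈ Set.Ioo (-Real.pi) Real.pi, ‖f J t‖ ≤ M := fun J t ht => by
        calc ‖f J t‖ = ‖g t + (f J t - g t)‖ := by rw [add_sub_cancel]
          _ ≤ ‖g t‖ + ‖f J t - g t‖ := norm_add_le _ _
          _ ≤ M := add_le_add (hgC t) ((hfg J t ht).trans (hua (Nat.zero_le J)))
      have hgM : ∀ t ∈ Set.Ioo (-Real.pi) Real.pi, ‖g t‖ ≤ M := fun t _ =>
        (hgC t).trans (le_add_of_nonneg_right (hu0 0))
      set R := max 1 (C' * (2 * Real.pi))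
      -- The comparison needs `δ > 0`, but `u J` may vanish; hence the added null sequence.
      set δ : ℕ → ℝ := fun J => u J + 1 / ((J : ℝ) + 1)
      have hδ0 : ∀ J, 0 < δ J := fun J => add_pos_of_nonneg_of_pos (hu0 J) (by positivity)
      have hδ : Tendsto δ atTop (𝓝 0) := by
        have := hu.add (tendsto_one_div_add_atTop_nhds_zero_nat (𝕜 := ℝ))
        rwa [add_zero] at this
      refine squeeze_zero_norm (a := fun J => (m + 2) * R ^ m *
        (((2 * Real.pi) ^ 2 + 2 * (2 * Real.pi * M) ^ 2) * δ J)) (fun J => ?_)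
        (by simpa using (hδ.const_mul _).const_mul _)
      obtain ⟨hfs, hft⟩ := summable_norm_trigCoeff_sq (hf J) (hfM J)
      obtain ⟨hgs, hgt⟩ := summable_norm_trigCoeff_sq hgi hgM
      obtain ⟨hds, hdt⟩ := summable_norm_trigCoeff_sq ((hf J).sub hgi) (hfg J)
      have e : ∀ k, trigCoeff (fun t => f J t - g t) k = trigCoeff (f J) k - trigCoeff g k := fun k =>
        (trigCoeff_sub (hf J) hgi k).symm
      simp_rw [e] at hds hdt
      refine norm_lagAverage_pow_sub_le (fun k => (h1 J k).trans (le_max_left _ _))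
        (fun k => (norm_trigCoeff_le hgC k).trans (le_max_right _ _)) (hδ0 J) hfs hgs hds hft hgt
        (hdt.trans ?_) m (n J)
      rw [mul_pow]
      have := hu0 J
      gcongr
      exact le_add_of_nonneg_right (by positivity)

end LagAverage

/-! ### Second moments of linear statistics and stability under approximation of `h`. -/

section LinearStatistic

/-- Integration by parts gives `E[X q(X)] = E[q'(X)]`, so functions of the form `x q - q'` are
centred. -/
lemma IsSteinRep.hermiteCoeff_zero {q q1 h h1 h2 : ℝ → ℝ} {B : ℝ}
    (H : IsSteinRep q q1 h h1 h2 B) : hermiteCoeff h 0 = 0 := by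
  have cq := H.cont_q
  have cq1 := H.cont_q1
  have gq : HasPolyGrowth q := .of_bound H.le_q
  have gq1 : HasPolyGrowth q1 := .of_bound H.le_q1
  have key := HasPolyGrowth.integral_by_parts (μ := gaussianReal 0 1) integral_id_gaussianReal_zero
    (Φ := q) (Φ' := fun x => q1 x • ContinuousLinearMap.id ℝ ℝ)
    (fun x => by
      refine (H.deriv_q x).hasFDerivAt.congr_fderiv ?_
      ext
      simp)
    (by fun_prop) gq (gq1.smul (.const _)) (ContinuousLinearMap.id ℝ ℝ)
  have e : ∀ p : ℝ × ℝ, (ContinuousLinearMap.id ℝ ℝ) p.2 • (q1 p.1 • ContinuousLinearMap.id ℝ ℝ) p.2 =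
      q1 p.1 * (p.2 * p.2) := fun p => by
    simp
    ring
  simp_rw [e] at key
  rw [integral_prod_mul q1 fun y : ℝ => y * y, integral_mul_self_gaussianReal, mul_one] at key
  have i1 : Integrable (fun x => x * q x) (gaussianReal 0 1) :=
    (hasPolyGrowth_id.mul gq).integrable (by fun_prop)
  have i2 : Integrable q1 (gaussianReal 0 1) := gq1.integrable cq1.aestronglyMeasurable
  simp only [hermiteCoeff, hermiteFun_zero, mul_one, H.eq]
  rw [integral_sub i1 i2, ← key, sub_eq_zero]
  rfl

lemma IsSteinRep.memLp {q q1 h h1 h2 : ℝ → ℝ} {B : ℝ}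
    (H : IsSteinRep q q1 h h1 h2 B) : MemLp h 2 (gaussianReal 0 1) :=
  MemLp.of_bound H.cont_h.aestronglyMeasurable B (ae_of_all _ H.le_h)

variable {α : Type*} [Fintype α] {μ : Measure (α → ℝ)} [IsGaussian μ] {h : ℝ → ℝ}

lemma measurePreserving_coord (hμ : ∫ x, x ∂μ = 0) (hdiag : ∀ a, secondMoment μ a a = 1) (a : α) :
    MeasurePreserving (fun x : α → ℝ => x a) μ (gaussianReal 0 1) :=
  measurePreserving_of_integral_mul_self hμ
    (ContinuousLinearMap.proj (R := ℝ) (φ := fun _ : α => ℝ) a) (hdiag a)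

lemma memLp_linearStatistic (hμ : ∫ x, x ∂μ = 0) (hdiag : ∀ a, secondMoment μ a a = 1)
    (hh : MemLp h 2 (gaussianReal 0 1)) (w : α → ℝ) :
    MemLp (fun x : α → ℝ => ∑ a, w a * h (x a)) 2 μ :=
  memLp_finsetSum _ fun a _ =>
    (hh.comp_measurePreserving (measurePreserving_coord hμ hdiag a)).const_mul (w a)

/-- Hermite expansion of the second moment of a linear statistic of a Gaussian vector. -/
theorem hasSum_integral_linearStatistic_sq (hμ : ∫ x, x ∂μ = 0)
    (hdiag : ∀ a, secondMoment μ a a = 1) (hh : MemLp h 2 (gaussianReal 0 1)) (w : α → ℝ) :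
    HasSum (fun l => hermiteCoeff h l ^ 2 / (l.factorial : ℝ) *
      ∑ a, ∑ b, w a * w b * secondMoment μ a b ^ l) (∫ x, (∑ a, w a * h (x a)) ^ 2 ∂μ) := by
  have hm : ∀ a, MemLp (fun x : α → ℝ => h (x a)) 2 μ := fun a =>
    hh.comp_measurePreserving (measurePreserving_coord hμ hdiag a)
  have hi : ∀ a b, Integrable (fun x : α → ℝ => w a * w b * (h (x a) * h (x b))) μ := fun a b =>
    ((hm a).integrable_mul (hm b)).const_mul _
  have e : ∀ x : α → ℝ, (∑ a, w a * h (x a)) ^ 2 =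
      ∑ a, ∑ b, w a * w b * (h (x a) * h (x b)) := fun x => by
    rw [pow_two, Finset.sum_mul_sum]
    exact Finset.sum_congr rfl fun a _ => Finset.sum_congr rfl fun b _ => by ring
  simp_rw [e]
  rw [integral_finsetSum _ fun a _ => integrable_finsetSum _ fun b _ => hi a b]
  simp_rw [integral_finsetSum _ fun b _ => hi _ b, integral_const_mul]
  have key := hasSum_sum (s := Finset.univ) fun a (_ : a ∈ Finset.univ) =>
    hasSum_sum (s := Finset.univ) fun b (_ : b ∈ Finset.univ) =>
      (hasSum_integral_comp_mul_comp (μ := μ) hμ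
        (ContinuousLinearMap.proj (R := ℝ) (φ := fun _ : α => ℝ) a)
        (ContinuousLinearMap.proj (R := ℝ) (φ := fun _ : α => ℝ) b)
        (hdiag a) (hdiag b) hh).mul_left (w a * w b)
  refine key.congr_fun fun l => ?_
  rw [Finset.mul_sum]
  refine Finset.sum_congr rfl fun a _ => ?_
  rw [Finset.mul_sum]
  refine Finset.sum_congr rfl fun b _ => ?_
  simp only [ContinuousLinearMap.proj_apply, secondMoment]
  ring

/-- Compare the Hermite expansions of both sides term by term; `h0` removes `l = 0`, where no bound
by `K` is available. It controls the error of replacing `h` by an approximation, whatever the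
dimension. -/
lemma integral_linearStatistic_sq_le (hμ : ∫ x, x ∂μ = 0)
    (hdiag : ∀ a, secondMoment μ a a = 1) (hh : MemLp h 2 (gaussianReal 0 1))
    (h0 : hermiteCoeff h 0 = 0) {w : α → ℝ} {K : ℝ}
    (hK : ∀ l : ℕ, 1 ≤ l → ∑ a, ∑ b, w a * w b * secondMoment μ a b ^ l ≤ K) :
    ∫ x, (∑ a, w a * h (x a)) ^ 2 ∂μ ≤ K * ∫ x, h x ^ 2 ∂(gaussianReal 0 1) := by
  refine hasSum_le (fun l => ?_) (hasSum_integral_linearStatistic_sq hμ hdiag hh w)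
    ((hasSum_hermiteCoeff_sq hh).mul_left K)
  rcases l.eq_zero_or_pos with rfl | hl
  · simp [h0]
  · rw [mul_comm K]
    exact mul_le_mul_of_nonneg_left (hK l hl) (by positivity)

lemma norm_cexp_mul_I_sub_le (t x y : ℝ) :
    ‖Complex.exp (t * (x : ℂ) * Complex.I) - Complex.exp (t * (y : ℂ) * Complex.I)‖ ≤
      |t| * |x - y| := by
  have h := Real.norm_exp_I_mul_ofReal_sub_one_le (x := t * (x - y))
  have e : Complex.exp (t * (x : ℂ) * Complex.I) - Complex.exp (t * (y : ℂ) * Complex.I) =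
      Complex.exp ((t * y : ℝ) * Complex.I) *
        (Complex.exp (Complex.I * (t * (x - y) : ℝ)) - 1) := by
    rw [mul_sub, ← Complex.exp_add, mul_one]
    congr 2
    · push_cast; ring
    · push_cast; ring
  rw [e, norm_mul, Complex.norm_exp_ofReal_mul_I, one_mul]
  refine h.trans (le_of_eq ?_)
  rw [Real.norm_eq_abs, abs_mul]

lemma abs_exp_neg_sub_exp_neg_le {x y : ℝ} (hx : 0 ≤ x) (hy : 0 ≤ y) :
    |Real.exp (-x) - Real.exp (-y)| ≤ |x - y| := by
  wlog hxy : x ≤ y generalizing x y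
  · rw [abs_sub_comm, abs_sub_comm x]
    exact this hy hx (le_of_not_ge hxy)
  have h1 : Real.exp (-y) ≤ Real.exp (-x) := Real.exp_le_exp.2 (by linarith)
  rw [abs_of_nonneg (by linarith), abs_of_nonpos (by linarith)]
  have h2 := Real.add_one_le_exp (x - y)
  have h3 : Real.exp (-y) = Real.exp (-x) * Real.exp (x - y) := by
    rw [← Real.exp_add]
    congr 1
    ring
  have h4 : Real.exp (-x) ≤ 1 := Real.exp_le_one_iff.2 (by linarith)
  rw [h3]
  nlinarith [Real.exp_pos (-x)]

/-- Comparison of the characteristic functions, and of their Gaussian counterparts, of two square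
integrable random variables. -/
lemma norm_charFun_sub_gaussian_le {Ω : Type*} [MeasurableSpace Ω] {μ : Measure Ω}
    [IsProbabilityMeasure μ] {F G : Ω → ℝ} (hF : MemLp F 2 μ) (hG : MemLp G 2 μ) {ε S T r : ℝ}
    (hε : 0 < ε) (hS : ∫ x, F x ^ 2 ∂μ ≤ S) (hT : ∫ x, (F x - G x) ^ 2 ∂μ ≤ T * ε ^ 2) (t : ℝ)
    (hr : ‖(∫ x, Complex.exp (t * (G x : ℂ) * Complex.I) ∂μ) -
      Complex.exp (-((∫ x, G x ^ 2 ∂μ : ℝ) * t ^ 2 / 2))‖ ≤ r) :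
    ‖(∫ x, Complex.exp (t * (F x : ℂ) * Complex.I) ∂μ) -
      Complex.exp (-((∫ x, F x ^ 2 ∂μ : ℝ) * t ^ 2 / 2))‖ ≤
      r + ε * (|t| * ((1 + T) / 2)) + ε * ((S + T + ε * T) * t ^ 2 / 2) := by
  have hD : MemLp (fun x => F x - G x) 2 μ := hF.sub hG
  have iF2 := hF.integrable_sq
  have iG2 := hG.integrable_sq
  have iD2 := hD.integrable_sq
  have iexp : ∀ {Z : Ω → ℝ}, MemLp Z 2 μ →
      Integrable (fun x => Complex.exp (t * (Z x : ℂ) * Complex.I)) μ := fun {Z} hZ => by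
    refine Integrable.of_bound ?_ 1 (ae_of_all _ fun x => ?_)
    · have := hZ.aestronglyMeasurable
      have c : Continuous fun z : ℝ => Complex.exp (t * (z : ℂ) * Complex.I) := by fun_prop
      exact c.comp_aestronglyMeasurable this
    · rw [← Complex.ofReal_mul, Complex.norm_exp_ofReal_mul_I]
  have b1 : ‖(∫ x, Complex.exp (t * (F x : ℂ) * Complex.I) ∂μ) -
      ∫ x, Complex.exp (t * (G x : ℂ) * Complex.I) ∂μ‖ ≤ ε * (|t| * ((1 + T) / 2)) := by
    rw [← integral_sub (iexp hF) (iexp hG)]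
    have hb : ∀ x, ‖Complex.exp (t * (F x : ℂ) * Complex.I) -
        Complex.exp (t * (G x : ℂ) * Complex.I)‖ ≤ |t| * (ε / 2 + (2 * ε)⁻¹ * (F x - G x) ^ 2) :=
      fun x => by
        refine (norm_cexp_mul_I_sub_le t _ _).trans ?_
        gcongr
        have h1 := sq_nonneg (ε - |F x - G x|)
        have h2 : ε / 2 + (2 * ε)⁻¹ * (F x - G x) ^ 2 - |F x - G x| =
            (2 * ε)⁻¹ * (ε - |F x - G x|) ^ 2 := by
          rw [← sq_abs (F x - G x)]
          field_simp
          ring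
        rw [← sub_nonneg, h2]
        positivity
    refine (norm_integral_le_of_norm_le (((integrable_const _).add (iD2.const_mul _)).const_mul _)
      (ae_of_all _ hb)).trans ?_
    rw [integral_const_mul, integral_add' (integrable_const _) (iD2.const_mul _), integral_const_mul]
    simp only [integral_const, probReal_univ, one_smul]
    calc |t| * (ε / 2 + (2 * ε)⁻¹ * ∫ x, (F x - G x) ^ 2 ∂μ)
        ≤ |t| * (ε / 2 + (2 * ε)⁻¹ * (T * ε ^ 2)) := by gcongr
      _ = _ := by field_simp
  -- Write `G² - F² = -2F(F - G) + (F - G)²` and use Young's inequality with weight `ε` on the cross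
  -- term.
  have b2 : |∫ x, G x ^ 2 ∂μ - ∫ x, F x ^ 2 ∂μ| ≤ ε * (S + T + ε * T) := by
    rw [← integral_sub iG2 iF2]
    have hb : ∀ x, ‖G x ^ 2 - F x ^ 2‖ ≤ ε * F x ^ 2 + (ε⁻¹ + 1) * (F x - G x) ^ 2 := fun x => by
      have h1 : 0 ≤ ε⁻¹ * (ε * F x - (F x - G x)) ^ 2 := by positivity
      have h2 : 0 ≤ ε⁻¹ * (ε * F x + (F x - G x)) ^ 2 := by positivity
      have e1 : ε⁻¹ * (ε * F x - (F x - G x)) ^ 2 =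
          ε * F x ^ 2 - 2 * F x * (F x - G x) + ε⁻¹ * (F x - G x) ^ 2 := by field_simp; ring
      have e2 : ε⁻¹ * (ε * F x + (F x - G x)) ^ 2 =
          ε * F x ^ 2 + 2 * F x * (F x - G x) + ε⁻¹ * (F x - G x) ^ 2 := by field_simp; ring
      rw [e1] at h1
      rw [e2] at h2
      have h3 := sq_nonneg (F x - G x)
      rw [Real.norm_eq_abs, abs_le]
      constructor <;> nlinarith
    refine (norm_integral_le_of_norm_le ((iF2.const_mul _).add (iD2.const_mul _))
      (ae_of_all _ hb)).trans ?_
    rw [integral_add' (iF2.const_mul _) (iD2.const_mul _), integral_const_mul, integral_const_mul]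
    calc ε * ∫ x, F x ^ 2 ∂μ + (ε⁻¹ + 1) * ∫ x, (F x - G x) ^ 2 ∂μ
        ≤ ε * S + (ε⁻¹ + 1) * (T * ε ^ 2) := by gcongr
      _ = _ := by field_simp; ring
  have b3 : ‖Complex.exp (-((∫ x, G x ^ 2 ∂μ : ℝ) * t ^ 2 / 2)) -
      Complex.exp (-((∫ x, F x ^ 2 ∂μ : ℝ) * t ^ 2 / 2))‖ ≤
        ε * ((S + T + ε * T) * t ^ 2 / 2) := by
    have e : ∀ z : ℝ, Complex.exp (-((z : ℂ) * t ^ 2 / 2)) = (Real.exp (-(z * t ^ 2 / 2)) : ℝ) :=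
      fun z => by push_cast; rfl
    rw [e, e, ← Complex.ofReal_sub, Complex.norm_real, Real.norm_eq_abs]
    have hG0 : 0 ≤ ∫ x, G x ^ 2 ∂μ := integral_nonneg fun x => sq_nonneg _
    have hF0 : 0 ≤ ∫ x, F x ^ 2 ∂μ := integral_nonneg fun x => sq_nonneg _
    refine (abs_exp_neg_sub_exp_neg_le (by positivity) (by positivity)).trans ?_
    rw [← sub_div, ← sub_mul, abs_div, abs_mul, abs_of_nonneg (sq_nonneg t), abs_two]
    calc _ ≤ ε * (S + T + ε * T) * t ^ 2 / 2 := by gcongr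
      _ = _ := by ring
  calc _ = ‖((∫ x, Complex.exp (t * (F x : ℂ) * Complex.I) ∂μ) -
          ∫ x, Complex.exp (t * (G x : ℂ) * Complex.I) ∂μ) +
        ((∫ x, Complex.exp (t * (G x : ℂ) * Complex.I) ∂μ) -
          Complex.exp (-((∫ x, G x ^ 2 ∂μ : ℝ) * t ^ 2 / 2))) +
        (Complex.exp (-((∫ x, G x ^ 2 ∂μ : ℝ) * t ^ 2 / 2)) -
          Complex.exp (-((∫ x, F x ^ 2 ∂μ : ℝ) * t ^ 2 / 2)))‖ := by
        congr 1
        ring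
    _ ≤ _ := norm_add₃_le
    _ ≤ ε * (|t| * ((1 + T) / 2)) + r + ε * ((S + T + ε * T) * t ^ 2 / 2) := by gcongr
    _ = _ := by ring

end LinearStatistic

/-! ### The central limit theorem for triangular arrays. -/

section Asymptotic

/-- A central limit theorem for triangular arrays of linear statistics of Gaussian vectors whose
covariance matrices have bounded operator norm. -/
theorem tendsto_charFun_linearStatistic {α : ℕ → Type*} [∀ J, Fintype (α J)]
    {μ : ∀ J, Measure (α J → ℝ)} [∀ J, IsGaussian (μ J)] (hμ : ∀ J, ∫ x, x ∂(μ J) = 0)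
    (hdiag : ∀ J a, secondMoment (μ J) a a = 1) {Λ : ℝ} (hΛ0 : 0 < Λ)
    (hΛ : ∀ J, ∀ v : α J → ℝ, ∑ a, ∑ b, v a * v b * secondMoment (μ J) a b ≤ Λ * ∑ a, v a ^ 2)
    {w : ∀ J, α J → ℝ} {κ : ℕ → ℝ} (hκ0 : ∀ J, 0 ≤ κ J) (hκ : ∀ J a, w J a ^ 2 ≤ κ J)
    (hκ_lim : Tendsto κ atTop (𝓝 0)) {W : ℝ} (hW : ∀ J, ∑ a, w J a ^ 2 ≤ W) {K : ℝ}
    (hK : ∀ J (l : ℕ), 1 ≤ l → ∑ a, ∑ b, w J a * w J b * secondMoment (μ J) a b ^ l ≤ K)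
    {h : ℝ → ℝ} (hh : MemLp h 2 (gaussianReal 0 1)) (h0 : hermiteCoeff h 0 = 0) {s : ℝ}
    (hs : Tendsto (fun J => ∫ x, (∑ a, w J a * h (x a)) ^ 2 ∂(μ J)) atTop (𝓝 s)) (t : ℝ) :
    Tendsto (fun J => ∫ x, Complex.exp (t * (∑ a, w J a * h (x a) : ℝ) * Complex.I) ∂(μ J)) atTop
      (𝓝 (Complex.exp (-((s : ℂ) * t ^ 2 / 2)))) := by
  have hgauss : Tendsto (fun J => Complex.exp
      (-((∫ x, (∑ a, w J a * h (x a)) ^ 2 ∂(μ J) : ℝ) * t ^ 2 / 2))) atTop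
      (𝓝 (Complex.exp (-((s : ℂ) * t ^ 2 / 2)))) := by
    have c : Continuous fun z : ℝ => Complex.exp (-((z : ℂ) * t ^ 2 / 2)) := by fun_prop
    exact (c.tendsto s).comp hs
  suffices hdiff : Tendsto (fun J =>
      (∫ x, Complex.exp (t * (∑ a, w J a * h (x a) : ℝ) * Complex.I) ∂(μ J)) - Complex.exp
        (-((∫ x, (∑ a, w J a * h (x a)) ^ 2 ∂(μ J) : ℝ) * t ^ 2 / 2))) atTop (𝓝 0) by
    simpa using hdiff.add hgauss
  have hK0 : 0 ≤ |K| := abs_nonneg K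
  set I := ∫ x, h x ^ 2 ∂(gaussianReal 0 1) with hI
  -- `D` depends on `ε` through the bound `B` of the approximating function, but not on `J`. So `ε`
  -- is fixed first, then `κ J → 0` removes the Stein error.
  have hbound : ∀ ε : ℝ, 0 < ε → ∃ D : ℝ, ∀ J,
      ‖(∫ x, Complex.exp (t * (∑ a, w J a * h (x a) : ℝ) * Complex.I) ∂(μ J)) - Complex.exp
        (-((∫ x, (∑ a, w J a * h (x a)) ^ 2 ∂(μ J) : ℝ) * t ^ 2 / 2))‖ ≤
      t ^ 2 * √(D * κ J) + ε * (|t| * ((1 + |K|) / 2)) +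
        ε * ((|K| * I + |K| + ε * |K|) * t ^ 2 / 2) := by
    intro ε hε
    obtain ⟨q, hq, hc, hlt⟩ := exists_compactSupport_stein_approx hh h0 (pow_pos hε 2)
    obtain ⟨h1, h2, B, H⟩ := exists_isSteinRep hq hc
    refine ⟨Real.pi ^ 2 / 2 * W * B ^ 4 * Λ ^ 3, fun J => ?_⟩
    have hF := memLp_linearStatistic (hμ J) (hdiag J) hh (w J)
    have hG := memLp_linearStatistic (hμ J) (hdiag J) H.memLp (w J)
    have hcoef : hermiteCoeff (fun x => h x - (x * q x - deriv q x)) 0 = 0 := by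
      have hz := H.hermiteCoeff_zero
      simp only [hermiteCoeff, hermiteFun_zero, mul_one] at h0 hz ⊢
      rw [integral_sub (hh.integrable one_le_two) (H.memLp.integrable one_le_two), h0, hz, sub_zero]
    have hK' : ∀ l : ℕ, 1 ≤ l →
        ∑ a, ∑ b, w J a * w J b * secondMoment (μ J) a b ^ l ≤ |K| := fun l hl =>
      (hK J l hl).trans (le_abs_self K)
    refine norm_charFun_sub_gaussian_le hF hG hε
      (integral_linearStatistic_sq_le (hμ J) (hdiag J) hh h0 hK') ?_ t ?_
    · have := integral_linearStatistic_sq_le (hμ J) (hdiag J) (hh.sub H.memLp) hcoef hK'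
      have e : ∀ x : α J → ℝ, (∑ a, w J a * h (x a) -
          ∑ a, w J a * (x a * q (x a) - deriv q (x a))) =
          ∑ a, w J a * (h - fun x => x * q x - deriv q x) (x a) := fun x => by
        rw [← Finset.sum_sub_distrib]
        exact Finset.sum_congr rfl fun a _ => by simp [mul_sub]
      simp_rw [e]
      refine this.trans ?_
      gcongr
      exact hlt.le
    · refine (H.norm_charFun_sub_le (hμ J) (hdiag J) hΛ0 (hΛ J) (w J) (hκ0 J) (hκ J) (hW J)
        t).trans (le_of_eq ?_)
      congr 2
      ring
  rw [tendsto_zero_iff_norm_tendsto_zero]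
  refine tendsto_order.2 ⟨fun a ha => Eventually.of_forall fun J => ha.trans_le (norm_nonneg _),
    fun a ha => ?_⟩
  have hlim : Tendsto (fun ε : ℝ => ε * (|t| * ((1 + |K|) / 2)) +
      ε * ((|K| * I + |K| + ε * |K|) * t ^ 2 / 2)) (𝓝[>] 0) (𝓝 0) := by
    have c : Continuous fun ε : ℝ => ε * (|t| * ((1 + |K|) / 2)) +
      ε * ((|K| * I + |K| + ε * |K|) * t ^ 2 / 2) := by fun_prop
    have := (c.tendsto 0).mono_left (nhdsWithin_le_nhds (s := Set.Ioi 0))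
    simpa using this
  obtain ⟨ε, hεa, hε⟩ := ((hlim.eventually_lt_const ha).and self_mem_nhdsWithin).exists
  obtain ⟨D, hD⟩ := hbound ε hε
  have hlim2 : Tendsto (fun J => t ^ 2 * √(D * κ J) + (ε * (|t| * ((1 + |K|) / 2)) +
      ε * ((|K| * I + |K| + ε * |K|) * t ^ 2 / 2))) atTop
      (𝓝 (t ^ 2 * √(D * 0) + (ε * (|t| * ((1 + |K|) / 2)) +
      ε * ((|K| * I + |K| + ε * |K|) * t ^ 2 / 2)))) :=
    (((hκ_lim.const_mul D).sqrt).const_mul _).add_const _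
  rw [mul_zero, Real.sqrt_zero, mul_zero, zero_add] at hlim2
  filter_upwards [hlim2.eventually_lt_const hεa] with J hJ
  refine (hD J).trans_lt ?_
  rwa [add_assoc]

end Asymptotic

/-! ### Correlations and finite-dimensional laws of the process. -/

namespace IsStandardStationaryGaussian

variable {Ω ι : Type*} [MeasurableSpace Ω] {X : ι → ℕ → Ω → ℝ} {P : Measure Ω}

lemma memLp_two (hX : IsStandardStationaryGaussian X P) (j : ι) (i : ℕ) : MemLp (X j i) 2 P :=
  (hX.gaussian.hasGaussianLaw_eval (j, i)).memLp_two

lemma integral_mul_self (hX : IsStandardStationaryGaussian X P) (j : ι) (i : ℕ) :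
    ∫ ω, X j i ω * X j i ω ∂P = 1 := by
  have h := hX.variance_one j i
  rw [variance_of_integral_eq_zero (hX.gaussian.aemeasurable (j, i)) (hX.mean_zero j i)] at h
  simpa only [pow_two] using h

/-- Shift time back by `min i k`; the remaining indices are the truncated differences `i - k` and `k
- i`, exactly those in `crossCorr`. -/
lemma integral_mul_eq_crossCorr (hX : IsStandardStationaryGaussian X P) (j j' : ι) (i k : ℕ) :
    ∫ ω, X j i ω * X j' k ω ∂P = crossCorr (X j) (X j') P ((k : ℤ) - (i : ℤ)) := by
  have h := (hX.stationary (min i k)).comp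
    (u := fun y : ι → ℕ → ℝ => y j (i - k) * y j' (k - i)) (by fun_prop)
  have h2 := h.integral_eq
  simp only [Function.comp_apply] at h2
  rw [crossCorr, show (-((k : ℤ) - (i : ℤ))).toNat = i - k by omega,
    show ((k : ℤ) - (i : ℤ)).toNat = k - i by omega, ← h2, show i - k + min i k = i by omega,
    show k - i + min i k = k by omega]

lemma abs_crossCorr_le (hX : IsStandardStationaryGaussian X P) (j j' : ι) (k : ℤ) :
    |crossCorr (X j) (X j') P k| ≤ 1 := by
  have hA := hX.memLp_two j (-k).toNat
  have hB := hX.memLp_two j' k.toNat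
  have iA : Integrable (fun ω => X j (-k).toNat ω * X j (-k).toNat ω) P := hA.integrable_mul hA
  have iB : Integrable (fun ω => X j' k.toNat ω * X j' k.toNat ω) P := hB.integrable_mul hB
  have h := norm_integral_le_of_norm_le (f := fun ω => X j (-k).toNat ω * X j' k.toNat ω)
    ((iA.add iB).div_const 2) (ae_of_all _ fun ω => by
      rw [Real.norm_eq_abs, abs_le, Pi.add_apply]
      constructor
      · nlinarith [sq_nonneg (X j (-k).toNat ω + X j' k.toNat ω)]
      · nlinarith [sq_nonneg (X j (-k).toNat ω - X j' k.toNat ω)])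
  rw [integral_div, integral_add' iA iB, hX.integral_mul_self, hX.integral_mul_self] at h
  rw [crossCorr, ← Real.norm_eq_abs]
  exact h.trans (by norm_num)

/-- The law of finitely many variables of a process. -/
noncomputable def _root_.sampleLaw (X : ι → ℕ → Ω → ℝ) (P : Measure Ω) (I : Finset (ι × ℕ)) :
    Measure (I → ℝ) :=
  P.map fun ω => I.restrict fun p => X p.1 p.2 ω

variable (I : Finset (ι × ℕ))

lemma aemeasurable_restrict (hX : IsStandardStationaryGaussian X P) :
    AEMeasurable (fun ω => I.restrict fun p : ι × ℕ => X p.1 p.2 ω) P :=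
  (hX.gaussian.hasGaussianLaw I).aemeasurable

lemma isGaussian_sampleLaw (hX : IsStandardStationaryGaussian X P) : IsGaussian (sampleLaw X P I) :=
  (hX.gaussian.hasGaussianLaw I).isGaussian_map

lemma integral_sampleLaw (hX : IsStandardStationaryGaussian X P) {E : Type*}
    [NormedAddCommGroup E] [NormedSpace ℝ E] {φ : (I → ℝ) → E}
    (hφ : AEStronglyMeasurable φ (sampleLaw X P I)) :
    ∫ x, φ x ∂(sampleLaw X P I) = ∫ ω, φ (fun a => X a.1.1 a.1.2 ω) ∂P :=
  integral_map (hX.aemeasurable_restrict I) hφ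

lemma integral_id_sampleLaw (hX : IsStandardStationaryGaussian X P) :
    ∫ x, x ∂(sampleLaw X P I) = 0 := by
  have := hX.isGaussian_sampleLaw I
  funext a
  have h := IsGaussian.integral_dual (μ := sampleLaw X P I)
    (ContinuousLinearMap.proj (R := ℝ) (φ := fun _ : I => ℝ) a)
  simp only [ContinuousLinearMap.proj_apply] at h
  rw [← h, hX.integral_sampleLaw I (measurable_pi_apply a).aestronglyMeasurable]
  exact hX.mean_zero _ _

lemma secondMoment_sampleLaw (hX : IsStandardStationaryGaussian X P) (a b : I) :
    secondMoment (sampleLaw X P I) a b =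
      crossCorr (X a.1.1) (X b.1.1) P ((b.1.2 : ℤ) - (a.1.2 : ℤ)) := by
  rw [secondMoment, hX.integral_sampleLaw I (by fun_prop), hX.integral_mul_eq_crossCorr]

lemma secondMoment_sampleLaw_self (hX : IsStandardStationaryGaussian X P) (a : I) :
    secondMoment (sampleLaw X P I) a a = 1 := by
  rw [secondMoment, hX.integral_sampleLaw I (by fun_prop), hX.integral_mul_self]

end IsStandardStationaryGaussian

/-! ### The Gaussian vector of a window and its spectral bounds. -/

section Window

variable {d : ℕ} {Ω : Type*} [MeasurableSpace Ω] {X : Fin (d + 1) → ℕ → Ω → ℝ} {P : Measure Ω}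

/-- The index set of the variables with times in `{1, ..., n}`. -/
def window (d n : ℕ) : Finset (Fin (d + 1) × ℕ) := Finset.univ ×ˢ Finset.Icc 1 n

/-- The weights of a normalised sum over a window. -/
noncomputable def windowWeight (β : Fin (d + 1) → ℝ) (n : ℕ) (a : window d n) : ℝ :=
  (√(n : ℝ))⁻¹ * β a.1.1

lemma sum_window {M : Type*} [AddCommMonoid M] (n : ℕ) (F : Fin (d + 1) → ℕ → M) :
    ∑ a : window d n, F a.1.1 a.1.2 = ∑ j, ∑ i ∈ Finset.Icc 1 n, F j i := by
  rw [Finset.sum_coe_sort (window d n) fun p => F p.1 p.2, window, Finset.sum_product]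

omit [MeasurableSpace Ω] in
lemma normalizedSum_eq_sum_window (β : Fin (d + 1) → ℝ) (h : ℝ → ℝ) (n : ℕ) (ω : Ω) :
    normalizedSum (weightedSum β h) X n ω =
      ∑ a : window d n, windowWeight β n a * h (X a.1.1 a.1.2 ω) := by
  simp only [windowWeight]
  rw [normalizedSum, sum_window n fun j i => (√(n : ℝ))⁻¹ * β j * h (X j i ω), Finset.sum_comm,
    Finset.mul_sum]
  refine Finset.sum_congr rfl fun i _ => ?_
  rw [weightedSum, Finset.mul_sum]
  exact Finset.sum_congr rfl fun j _ => by ring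

lemma inv_sqrt_natCast_sq (n : ℕ) : (√(n : ℝ))⁻¹ ^ 2 = (n : ℝ)⁻¹ := by
  rw [inv_pow, Real.sq_sqrt n.cast_nonneg]

lemma windowWeight_sq_le (β : Fin (d + 1) → ℝ) (n : ℕ) (a : window d n) :
    windowWeight β n a ^ 2 ≤ (∑ j, β j ^ 2) * (n : ℝ)⁻¹ := by
  rw [windowWeight, mul_pow, inv_sqrt_natCast_sq, mul_comm]
  gcongr
  exact Finset.single_le_sum (f := fun j => β j ^ 2) (fun j _ => sq_nonneg _) (Finset.mem_univ _)

lemma sum_windowWeight_sq_le (β : Fin (d + 1) → ℝ) (n : ℕ) :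
    ∑ a : window d n, windowWeight β n a ^ 2 ≤ ∑ j, β j ^ 2 := by
  have h := sum_window (d := d) n fun j _ => ((√(n : ℝ))⁻¹ * β j) ^ 2
  simp only [windowWeight]
  rw [h]
  gcongr with j
  rw [Finset.sum_const, Nat.card_Icc, Nat.add_sub_cancel, nsmul_eq_mul, mul_pow,
    inv_sqrt_natCast_sq, ← mul_assoc]
  rcases n.eq_zero_or_pos with rfl | hn
  · simpa using sq_nonneg (β j)
  · rw [mul_inv_cancel₀ (by positivity), one_mul]

/-- Weighted sums of powers of the correlations over a window, in terms of lag averages. -/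
lemma sum_sum_windowWeight_mul_pow (hX : IsStandardStationaryGaussian X P)
    {f : Fin (d + 1) → Fin (d + 1) → ℝ → ℂ}
    (hf : ∀ j j', HasCrossSpectralDensity (X j) (X j') P (f j j')) (β : Fin (d + 1) → ℝ)
    (n l : ℕ) :
    ((∑ a, ∑ b, windowWeight β n a * windowWeight β n b *
      secondMoment (sampleLaw X P (window d n)) a b ^ l : ℝ) : ℂ) =
      ∑ j, ∑ j', ((β j * β j' : ℝ) : ℂ) * lagAverage (fun k => trigCoeff (f j j') k ^ l) n := by
  have hc : ∀ j j' k, trigCoeff (f j j') k = (crossCorr (X j) (X j') P k : ℂ) :=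
    fun j j' k => ((hf j j').2 k).symm
  have e1 : ∀ j i, ∑ b : window d n, ((√(n : ℝ))⁻¹ * β j) * ((√(n : ℝ))⁻¹ * β b.1.1) *
      crossCorr (X j) (X b.1.1) P ((b.1.2 : ℤ) - (i : ℤ)) ^ l =
      ∑ j', ∑ k ∈ Finset.Icc 1 n, ((√(n : ℝ))⁻¹ * β j) * ((√(n : ℝ))⁻¹ * β j') *
        crossCorr (X j) (X j') P ((k : ℤ) - (i : ℤ)) ^ l := fun j i =>
    sum_window n fun j' k => ((√(n : ℝ))⁻¹ * β j) * ((√(n : ℝ))⁻¹ * β j') *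
        crossCorr (X j) (X j') P ((k : ℤ) - (i : ℤ)) ^ l
  have e2 : ∀ j j', ((β j * β j' : ℝ) : ℂ) * lagAverage (fun k => trigCoeff (f j j') k ^ l) n =
      ((∑ i ∈ Finset.Icc 1 n, ∑ k ∈ Finset.Icc 1 n, ((√(n : ℝ))⁻¹ * β j) * ((√(n : ℝ))⁻¹ * β j') *
        crossCorr (X j) (X j') P ((k : ℤ) - (i : ℤ)) ^ l : ℝ) : ℂ) := fun j j' => by
    have e3 : ∀ r : ℝ, ((√(n : ℝ))⁻¹ * β j) * ((√(n : ℝ))⁻¹ * β j') * r =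
        β j * β j' * ((n : ℝ)⁻¹ * r) := fun r => by
      rw [← inv_sqrt_natCast_sq]
      ring
    simp_rw [e3, ← Finset.mul_sum]
    rw [lagAverage]
    simp only [hc]
    push_cast
    rfl
  simp_rw [e2, hX.secondMoment_sampleLaw, windowWeight, e1]
  rw [sum_window n fun j i => ∑ j', ∑ k ∈ Finset.Icc 1 n, ((√(n : ℝ))⁻¹ * β j) *
    ((√(n : ℝ))⁻¹ * β j') * crossCorr (X j) (X j') P ((k : ℤ) - (i : ℤ)) ^ l]
  push_cast
  exact Finset.sum_congr rfl fun j _ => Finset.sum_comm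

/-- The bound is uniform in `l` and `n`. It serves twice: to dominate the Hermite series of the
variance, and as the constant `K` in the `L²` stability estimate. -/
lemma sum_sum_windowWeight_mul_pow_le (hX : IsStandardStationaryGaussian X P)
    {f : Fin (d + 1) → Fin (d + 1) → ℝ → ℂ}
    (hf : ∀ j j', HasCrossSpectralDensity (X j) (X j') P (f j j')) (β : Fin (d + 1) → ℝ) {M : ℝ}
    (hM : ∀ j j', ∀ t ∈ Set.Ioo (-Real.pi) Real.pi, ‖f j j' t‖ ≤ M) (n : ℕ) {l : ℕ} (hl : 1 ≤ l) :
    |∑ a, ∑ b, windowWeight β n a * windowWeight β n b *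
      secondMoment (sampleLaw X P (window d n)) a b ^ l| ≤
      ∑ j, ∑ j', |β j * β j'| * (2 * Real.pi * M + (2 * Real.pi * M) ^ 2) := by
  rw [← Real.norm_eq_abs, ← Complex.norm_real, sum_sum_windowWeight_mul_pow hX hf]
  refine norm_sum_le_of_le _ fun j _ => norm_sum_le_of_le _ fun j' _ => ?_
  rw [norm_mul, Complex.norm_real, Real.norm_eq_abs]
  gcongr
  refine norm_lagAverage_trigCoeff_pow_le (hf j j').1 (hM j j') (fun k => ?_) hl n
  rw [show trigCoeff (f j j') k = (crossCorr (X j) (X j') P k : ℂ) from ((hf j j').2 k).symm,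
    Complex.norm_real]
  exact hX.abs_crossCorr_le j j' k

/-- The covariance matrix over a window has operator norm bounded in terms of the spectral
densities. -/
lemma sum_sum_mul_secondMoment_le (hX : IsStandardStationaryGaussian X P)
    {f : Fin (d + 1) → Fin (d + 1) → ℝ → ℂ}
    (hf : ∀ j j', HasCrossSpectralDensity (X j) (X j') P (f j j')) {M : ℝ}
    (hM : ∀ j j', ∀ t ∈ Set.Ioo (-Real.pi) Real.pi, ‖f j j' t‖ ≤ M) (n : ℕ) (v : window d n → ℝ) :
    ∑ a, ∑ b, v a * v b * secondMoment (sampleLaw X P (window d n)) a b ≤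
      2 * Real.pi * M * (d + 1) * ∑ a, v a ^ 2 := by
  -- A vector on the window is extended to all pairs `(j, i)` so that sums split into blocks; values
  -- off the window are never used.
  obtain ⟨V, hV⟩ : ∃ V : Fin (d + 1) → ℕ → ℝ, ∀ a : window d n, v a = V a.1.1 a.1.2 :=
    ⟨fun j i => Function.extend Subtype.val v 0 (j, i), fun a =>
      (Subtype.val_injective.extend_apply v 0 a).symm⟩
  simp_rw [hV, hX.secondMoment_sampleLaw]
  have e1 : ∀ j i, ∑ b : window d n, V j i * V b.1.1 b.1.2 *
      crossCorr (X j) (X b.1.1) P ((b.1.2 : ℤ) - (i : ℤ)) =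
      ∑ j', ∑ k ∈ Finset.Icc 1 n, V j i * V j' k *
        crossCorr (X j) (X j') P ((k : ℤ) - (i : ℤ)) := fun j i =>
    sum_window n fun j' k => V j i * V j' k * crossCorr (X j) (X j') P ((k : ℤ) - (i : ℤ))
  simp_rw [e1]
  rw [sum_window n fun j i => ∑ j', ∑ k ∈ Finset.Icc 1 n, V j i * V j' k *
    crossCorr (X j) (X j') P ((k : ℤ) - (i : ℤ)), sum_window n fun j i => V j i ^ 2]
  have hb : ∀ j j', ∑ i ∈ Finset.Icc 1 n, ∑ k ∈ Finset.Icc 1 n, V j i * V j' k *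
      crossCorr (X j) (X j') P ((k : ℤ) - (i : ℤ)) ≤
      Real.pi * M * (∑ i ∈ Finset.Icc 1 n, V j i ^ 2 + ∑ i ∈ Finset.Icc 1 n, V j' i ^ 2) :=
    fun j j' => by
      have h := norm_sum_sum_mul_trigCoeff_le (Finset.Icc 1 n) (V j) (V j') (hf j j').1 (hM j j')
      have e : ∑ i ∈ Finset.Icc 1 n, ∑ k ∈ Finset.Icc 1 n, ((V j i * V j' k : ℝ) : ℂ) *
          trigCoeff (f j j') ((k : ℤ) - (i : ℤ)) = ((∑ i ∈ Finset.Icc 1 n, ∑ k ∈ Finset.Icc 1 n,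
            V j i * V j' k * crossCorr (X j) (X j') P ((k : ℤ) - (i : ℤ)) : ℝ) : ℂ) := by
        push_cast
        refine Finset.sum_congr rfl fun i _ => Finset.sum_congr rfl fun k _ => ?_
        rw [(hf j j').2]
        rfl
      rw [e, Complex.norm_real] at h
      exact (le_abs_self _).trans h
  calc _ = ∑ j, ∑ j', ∑ i ∈ Finset.Icc 1 n, ∑ k ∈ Finset.Icc 1 n, V j i * V j' k *
        crossCorr (X j) (X j') P ((k : ℤ) - (i : ℤ)) :=
        Finset.sum_congr rfl fun j _ => Finset.sum_comm
    _ ≤ ∑ j, ∑ j', Real.pi * M *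
        (∑ i ∈ Finset.Icc 1 n, V j i ^ 2 + ∑ i ∈ Finset.Icc 1 n, V j' i ^ 2) := by
        gcongr with j _ j' _
        exact hb j j'
    _ = _ := by
        simp_rw [← Finset.mul_sum, Finset.sum_add_distrib]
        simp only [Finset.sum_const, Finset.card_univ, Fintype.card_fin, nsmul_eq_mul,
          ← Finset.mul_sum]
        push_cast
        ring

end Window

lemma memLp_of_bounded_or_isHermiteCombination {h : ℝ → ℝ} (hm : Measurable h)
    (hh : (∃ C : ℝ, ∀ x, |h x| ≤ C) ∨ IsHermiteCombination h) : MemLp h 2 (gaussianReal 0 1) := by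
  rcases hh with ⟨C, hC⟩ | ⟨N, a, ha⟩
  · exact MemLp.of_bound hm.aestronglyMeasurable C (ae_of_all _ hC)
  · rw [funext ha]
    exact memLp_finsetSum _ fun l _ => (memLp_hermiteFun l).const_mul (a l)

/-! ### Transfer from the probability space to the law of the window. -/

section NormalizedSum

variable {d : ℕ} {Ω : Type*} [MeasurableSpace Ω] {X : Fin (d + 1) → ℕ → Ω → ℝ} {P : Measure Ω}
  {h : ℝ → ℝ}

lemma aemeasurable_normalizedSum (hX : IsStandardStationaryGaussian X P) (hm : Measurable h)
    (β : Fin (d + 1) → ℝ) (n : ℕ) : AEMeasurable (normalizedSum (weightedSum β h) X n) P := by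
  rw [funext (normalizedSum_eq_sum_window β h n)]
  exact Finset.aemeasurable_fun_sum _ fun a _ =>
    (hm.comp_aemeasurable (hX.gaussian.aemeasurable (a.1.1, a.1.2))).const_mul _

lemma integral_comp_normalizedSum (hX : IsStandardStationaryGaussian X P) (hm : Measurable h)
    (β : Fin (d + 1) → ℝ) (n : ℕ) {E : Type*} [NormedAddCommGroup E] [NormedSpace ℝ E]
    {φ : ℝ → E} (hφ : StronglyMeasurable φ) :
    ∫ ω, φ (normalizedSum (weightedSum β h) X n ω) ∂P =
      ∫ x, φ (∑ a, windowWeight β n a * h (x a)) ∂(sampleLaw X P (window d n)) := by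
  have hmeas : Measurable fun x : window d n → ℝ => ∑ a, windowWeight β n a * h (x a) := by
    fun_prop
  rw [hX.integral_sampleLaw (window d n)
    (φ := fun x => φ (∑ a, windowWeight β n a * h (x a)))
    (hφ.comp_measurable hmeas).aestronglyMeasurable]
  simp only [normalizedSum_eq_sum_window]

/-- As `c_0 = 0` makes every summand centred, the variance is a plain second moment and the Hermite
expansion applies. -/
lemma variance_normalizedSum (hX : IsStandardStationaryGaussian X P) (hm : Measurable h)
    (hh : MemLp h 2 (gaussianReal 0 1)) (h0 : hermiteCoeff h 0 = 0) (β : Fin (d + 1) → ℝ) (n : ℕ) :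
    variance (normalizedSum (weightedSum β h) X n) P =
      ∫ x, (∑ a, windowWeight β n a * h (x a)) ^ 2 ∂(sampleLaw X P (window d n)) := by
  have := hX.isGaussian_sampleLaw (window d n)
  have hmean : ∫ ω, normalizedSum (weightedSum β h) X n ω ∂P = 0 := by
    rw [integral_comp_normalizedSum hX hm β n (φ := fun y => y) stronglyMeasurable_id]
    have hp := fun a => measurePreserving_coord (hX.integral_id_sampleLaw (window d n))
      (hX.secondMoment_sampleLaw_self (window d n)) a
    have hi : ∀ a, Integrable (fun x : window d n → ℝ => h (x a)) (sampleLaw X P (window d n)) :=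
      fun a => (hp a).integrable_comp_of_integrable (hh.integrable one_le_two)
    rw [integral_finsetSum _ fun a _ => (hi a).const_mul _]
    refine Finset.sum_eq_zero fun a _ => ?_
    have hz : ∫ y, h y ∂(gaussianReal 0 1) = 0 := by
      simpa only [hermiteCoeff, hermiteFun_zero, mul_one] using h0
    rw [← (hp a).map_eq, integral_map (hp a).aemeasurable hm.aestronglyMeasurable] at hz
    rw [integral_const_mul, hz, mul_zero]
  rw [variance_of_integral_eq_zero (aemeasurable_normalizedSum hX hm β n) hmean]
  exact integral_comp_normalizedSum hX hm β n (φ := fun y => y ^ 2)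
    (Continuous.stronglyMeasurable (by fun_prop))

end NormalizedSum

/-! ### Assembly: limiting variance and convergence in law. -/

theorem mainTheorem6 {d : ℕ} {Ω : ℕ → Type*} [∀ J, MeasurableSpace (Ω J)]
    (P : (J : ℕ) → Measure (Ω J)) [∀ J, IsProbabilityMeasure (P J)]
    (X : (J : ℕ) → Fin (d + 1) → ℕ → Ω J → ℝ)
    (hX : ∀ J, IsStandardStationaryGaussian (X J) (P J))
    (f : ℕ → Fin (d + 1) → Fin (d + 1) → ℝ → ℂ)
    (hf : ∀ J j j', HasCrossSpectralDensity (X J j) (X J j') (P J) (f J j j'))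
    (g : Fin (d + 1) → Fin (d + 1) → ℝ → ℂ)
    (hg_periodic : ∀ j j', Function.Periodic (g j j') (2 * Real.pi))
    (hg_bounded : ∀ j j', ∃ C : ℝ, ∀ t ∈ Set.Ioo (-Real.pi) Real.pi, ‖g j j' t‖ ≤ C)
    (hg_cont : ∀ j j', ContinuousAt (g j j') 0)
    (u : ℕ → ℝ) (hu_anti : Antitone u) (hu_lim : Tendsto u atTop (𝓝 0))
    (hfg : ∀ J j j', ∀ t ∈ Set.Ioo (-Real.pi) Real.pi, ‖f J j j' t - g j j' t‖ ≤ u J)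
    (h : ℝ → ℝ) (hh_meas : Measurable h)
    (hh : (∃ C : ℝ, ∀ x, |h x| ≤ C) ∨ IsHermiteCombination h)
    (τ : ℕ) (hτ : 1 ≤ τ) (hh_rank : HasHermiteRank h τ)
    (β : Fin (d + 1) → ℝ)
    (n : ℕ → ℕ) (hn : Tendsto n atTop atTop) :
    ∃ v : NNReal,
      TendstoInDistribution
        (fun J => normalizedSum (weightedSum β h) (X J) (n J)) atTop
        (id : ℝ → ℝ) P (gaussianReal 0 v) ∧
      Tendsto (fun J => variance (normalizedSum (weightedSum β h) (X J) (n J)) (P J))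
        atTop (𝓝 (v : ℝ)) ∧
      HasSum (fun l : Set.Ici τ =>
          ((2 * Real.pi * (hermiteCoeff h l ^ 2 / (Nat.factorial l : ℝ)) : ℝ) : ℂ) *
            ∑ j, ∑ j', ((β j * β j' : ℝ) : ℂ) * selfConv (g j j') l 0)
        ((v : ℝ) : ℂ) := by
  have hpi := Real.pi_pos
  have h0mem : (0 : ℝ) ∈ Set.Ioo (-Real.pi) Real.pi := ⟨by linarith, hpi⟩
  have hL2 := memLp_of_bounded_or_isHermiteCombination hh_meas hh
  have hc0 : ∀ l < τ, hermiteCoeff h l = 0 := fun l hl => by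
    by_contra hne
    exact absurd (hh_rank.2 hne) (not_le.2 hl)
  have h0 := hc0 0 hτ
  choose C hC using hg_bounded
  obtain ⟨C₀, hC₀⟩ := Finite.exists_le fun p : Fin (d + 1) × Fin (d + 1) => C p.1 p.2
  -- As `u` is non-increasing, `u 0` bounds the distance of every `f J j j'` from its limit, making
  -- `M` uniform in `J`.
  set M := C₀ + u 0
  have hfM : ∀ J j j', ∀ t ∈ Set.Ioo (-Real.pi) Real.pi, ‖f J j j' t‖ ≤ M := fun J j j' t ht => by
    calc ‖f J j j' t‖ = ‖g j j' t + (f J j j' t - g j j' t)‖ := by rw [add_sub_cancel]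
      _ ≤ ‖g j j' t‖ + ‖f J j j' t - g j j' t‖ := norm_add_le _ _
      _ ≤ M := add_le_add ((hC j j' t ht).trans (hC₀ (j, j')))
          ((hfg J j j' t ht).trans (hu_anti (Nat.zero_le J)))
  have hM0 : 0 ≤ M := (norm_nonneg _).trans (hfM 0 0 0 0 h0mem)
  set K := ∑ j, ∑ j', |β j * β j'| * (2 * Real.pi * M + (2 * Real.pi * M) ^ 2)
  set μ : ∀ J, Measure (window d (n J) → ℝ) := fun J => sampleLaw (X J) (P J) (window d (n J))
  have hμG : ∀ J, IsGaussian (μ J) := fun J => (hX J).isGaussian_sampleLaw _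
  have hμ0 : ∀ J, ∫ x, x ∂(μ J) = 0 := fun J => (hX J).integral_id_sampleLaw _
  have hμ1 : ∀ J a, secondMoment (μ J) a a = 1 := fun J => (hX J).secondMoment_sampleLaw_self _
  set w : ∀ J, window d (n J) → ℝ := fun J => windowWeight β (n J)
  set V : ℕ → ℕ → ℝ := fun J l => ∑ a, ∑ b, w J a * w J b * secondMoment (μ J) a b ^ l
  have hVK : ∀ J l, 1 ≤ l → |V J l| ≤ K := fun J l hl =>
    sum_sum_windowWeight_mul_pow_le (hX J) (hf J) β (hfM J) (n J) hl
  set σ2 : ℕ → ℝ := fun J => ∫ x, (∑ a, w J a * h (x a)) ^ 2 ∂(μ J) with hσ2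
  have hσV : ∀ J, HasSum (fun l => ((hermiteCoeff h l ^ 2 / (l.factorial : ℝ) : ℝ) : ℂ) * (V J l : ℂ))
      (σ2 J : ℂ) := fun J => by
    have := Complex.hasSum_ofReal.2 (hasSum_integral_linearStatistic_sq (hμ0 J) (hμ1 J) hL2 (w J))
    simpa only [Complex.ofReal_mul] using this
  set G : ℕ → ℂ := fun l => ((2 * Real.pi * (hermiteCoeff h l ^ 2 / (l.factorial : ℝ)) : ℝ) : ℂ) *
    ∑ j, ∑ j', ((β j * β j' : ℝ) : ℂ) * selfConv (g j j') l 0 with hG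
  have hG0 : ∀ l < τ, G l = 0 := fun l hl => by simp [hG, hc0 l hl]
  have hterm : ∀ l, Tendsto (fun J => ((hermiteCoeff h l ^ 2 / (l.factorial : ℝ) : ℝ) : ℂ) *
      (V J l : ℂ)) atTop (𝓝 (G l)) := fun l => by
    -- Below the rank the Hermite coefficient vanishes; this includes `l = 0`, where `selfConv` has
    -- only a dummy value.
    rcases lt_or_ge l τ with hl | hl
    · simp [hG0 l hl, hc0 l hl]
    · have hlag : ∀ j j', Tendsto
          (fun J => lagAverage (fun k => trigCoeff (f J j j') k ^ l) (n J)) atTop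
          (𝓝 (((2 * Real.pi : ℝ) : ℂ) * selfConv (g j j') l 0)) := fun j j' =>
        tendsto_lagAverage_trigCoeff_pow (fun J => (hf J j j').1) (hg_periodic j j') (hC j j')
          (hg_cont j j') hu_anti hu_lim (fun J => hfg J j j') (fun J k => by
            rw [show trigCoeff (f J j j') k = (crossCorr (X J j) (X J j') (P J) k : ℂ) from
              ((hf J j j').2 k).symm, Complex.norm_real]
            exact (hX J).abs_crossCorr_le j j' k) hn (hτ.trans hl)
      have hV : ∀ J, (V J l : ℂ) = ∑ j, ∑ j', ((β j * β j' : ℝ) : ℂ) *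
          lagAverage (fun k => trigCoeff (f J j j') k ^ l) (n J) := fun J =>
        sum_sum_windowWeight_mul_pow (hX J) (hf J) β (n J) l
      simp_rw [hV]
      have := (tendsto_finsetSum Finset.univ fun j _ => tendsto_finsetSum Finset.univ fun j' _ =>
        (hlag j j').const_mul ((β j * β j' : ℝ) : ℂ)).const_mul
          ((hermiteCoeff h l ^ 2 / (l.factorial : ℝ) : ℝ) : ℂ)
      convert this using 2
      simp only [hG, Finset.mul_sum]
      refine Finset.sum_congr rfl fun j _ => Finset.sum_congr rfl fun j' _ => ?_
      push_cast
      ring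
  have hbd : ∀ J l, ‖((hermiteCoeff h l ^ 2 / (l.factorial : ℝ) : ℝ) : ℂ) * (V J l : ℂ)‖ ≤
      hermiteCoeff h l ^ 2 / (l.factorial : ℝ) * K := fun J l => by
    rcases l.eq_zero_or_pos with rfl | hl
    · simp [h0]
    · rw [norm_mul, Complex.norm_real, Complex.norm_real, Real.norm_of_nonneg (by positivity)]
      exact mul_le_mul_of_nonneg_left (hVK J l hl) (by positivity)
  have hsumb : Summable fun l => hermiteCoeff h l ^ 2 / (l.factorial : ℝ) * K :=
    (hasSum_hermiteCoeff_sq hL2).summable.mul_right K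
  have hGs : Summable G := Summable.of_norm_bounded hsumb fun l =>
    le_of_tendsto (hterm l).norm (Eventually.of_forall fun J => hbd J l)
  have hσlim : Tendsto (fun J => (σ2 J : ℂ)) atTop (𝓝 (∑' l, G l)) := by
    have := tendsto_tsum_of_dominated_convergence hsumb hterm
      (Eventually.of_forall fun J l => hbd J l)
    simpa only [(hσV _).tsum_eq] using this
  have hσre : Tendsto σ2 atTop (𝓝 (∑' l, G l).re) :=
    (Complex.continuous_re.tendsto _).comp hσlim
  -- The convolutions may be complex, but their combined sum is a limit of real second moments,
  -- hence real; the same limit shows that it is nonnegative.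
  have hs : ((∑' l, G l).re : ℂ) = ∑' l, G l :=
    tendsto_nhds_unique ((Complex.continuous_ofReal.tendsto _).comp hσre) hσlim
  have hs0 : 0 ≤ (∑' l, G l).re :=
    ge_of_tendsto' hσre fun J => integral_nonneg fun x => sq_nonneg _
  obtain ⟨v, hv⟩ : ∃ v : NNReal, (v : ℝ) = (∑' l, G l).re := ⟨⟨_, hs0⟩, rfl⟩
  rw [← hv] at hσre hs
  refine ⟨v, ?_, ?_, ?_⟩
  · refine ⟨fun J => aemeasurable_normalizedSum (hX J) hh_meas β (n J), aemeasurable_id, ?_⟩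
    refine ProbabilityMeasure.tendsto_of_tendsto_charFun fun t => ?_
    have hnR : Tendsto (fun J => (n J : ℝ)) atTop atTop := tendsto_natCast_atTop_atTop.comp hn
    -- `M + 1` replaces `M` so that the operator norm bound is strictly positive even when `M = 0`.
    -- The squared weights are at most `(∑ β_j²) / n_J`, which tends to `0`.
    have key := tendsto_charFun_linearStatistic (Λ := 2 * Real.pi * (M + 1) * (d + 1)) hμ0 hμ1
      (by positivity)
      (fun J v => sum_sum_mul_secondMoment_le (hX J) (hf J)
        (fun j j' t ht => (hfM J j j' t ht).trans (by linarith)) (n J) v)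
      (fun J => by positivity) (fun J a => windowWeight_sq_le β (n J) a)
      (by simpa using hnR.inv_tendsto_atTop.const_mul (∑ j, β j ^ 2))
      (fun J => sum_windowWeight_sq_le β (n J))
      (fun J l hl => (le_abs_self _).trans (hVK J l hl)) hL2 h0 hσre t
    have e1 : ∀ J, charFun ((P J).map (normalizedSum (weightedSum β h) (X J) (n J))) t =
        ∫ x, Complex.exp (t * (∑ a, w J a * h (x a) : ℝ) * Complex.I) ∂(μ J) := fun J => by
      have c : Continuous fun y : ℝ => Complex.exp (t * (y : ℂ) * Complex.I) := by fun_prop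
      rw [charFun_apply_real, integral_map (aemeasurable_normalizedSum (hX J) hh_meas β (n J))
        c.aestronglyMeasurable]
      exact integral_comp_normalizedSum (hX J) hh_meas β (n J) c.stronglyMeasurable
    simp only [ProbabilityMeasure.coe_mk, e1, Measure.map_id, charFun_gaussianReal]
    convert key using 3
    simp
  · simp_rw [variance_normalizedSum (hX _) hh_meas hL2 h0]
    exact hσre
  · have hsupp : Function.support G ⊆ Set.Ici τ := fun l hl => by
      by_contra hlt
      exact hl (hG0 l (not_le.1 hlt))
    have := (hasSum_subtype_iff_of_support_subset hsupp).2 hGs.hasSum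
    rw [hs]
    exact this
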